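/- Let $R$ be a complete local reduced noetherian commutative ring of Krull dimension $1$ with residue field $\mathbb k$ and total ring of fractions $K$. An $R$-lattice is a finitely generated torsion free $R$-module $M$; write $KM=K\otimes_R M\supseteq M$. An $R$-order is an $R$-algebra that is an $R$-lattice and has no nonzero nilpotent two-sided ideals; a lattice over an order $A$ is a left $A$-module that is an $R$-lattice. An overring of $A$ is an $R$-order $A'$ with $A\subseteq A'\subseteq KA$; an overmodule of an $A$-lattice $M$ is an $A$-lattice $N$ with $M\subseteq N\subseteq KM$. Let $\mathfrak r=\operatorname{rad}A$, and let $M^{\mathfrak r}$ be the sum of all minimal proper overmodules of $M$. Write $N\subset_{+}M$ if $N$ is isomorphic to a direct summand of a finite direct sum of copies of $M$. An $A$-lattice $I$ is L-injective if every exact sequence $0\to I\to N\to M\to 0$ of $A$-lattices splits, and bijective if it is both projective and L-injective. A principal $A$-module is an indecomposable finitely generated projective $A$-module; a coprincipal $A$-lattice is an indecomposable L-injective $A$-lattice. Let $A$ be a connected (that is, nonzero and indecomposable as a ring) non-hereditary $R$-order and $B$ a bijective $A$-lattice. There is a unique overring $A'=A^-(B)$ of $A$ such that every $A$-lattice is isomorphic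 to $B'\oplus M'$ with $B'\subset_{+}B$ and $M'$ an $A'$-lattice, and such that no nonzero $A'$-lattice $M$ satisfies $M\subset_{+}B$ as an $A$-lattice. A $B$-link is a sequence of indecomposable $A$-lattices $B_1,\dots,B_l$ ($l\ge 1$) inside one $KA$-module such that $B_i\subset_{+}B$ for all $i$, $B_i=\mathfrak rB_{i-1}$ for $2\le i\le l$, and neither $\mathfrak rB_l\subset_{+}B$ nor $B_1^{\mathfrak r}\subset_{+}B$. For an indecomposable $A$-lattice $M$ set $M^{+,B}=M^{-,B}=M$ if $M\not\subset_{+}B$, and $M^{+,B}=B_1^{\mathfrak r}$, $M^{-,B}=\mathfrak rB_l$ if $M$ is a member of a $B$-link $B_1,\dots,B_l$. 1. If $A=\bigoplus_{i=1}^nP_i$ with left ideals $P_i$ that are indecomposable $A$-modules, then $P_i^{+,B}\subseteq KA$ is well defined for every $i$ and $A'=\bigoplus_{i=1}^nP_i^{+,B}$ as left $A'$-modules. In particular every $P_i^{+,B}$ is a projective $A'$-module, and every principal $A'$-module is isomorphic to a direct summand of some $P_i^{+,B}$. 2. Let $\omega_R$ be a canonical module of $R$, that is, an $R$-lattice with $\operatorname{inj.dim}_R\omega_R=1$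 and $\operatorname{Ext}^1_R(\mathbb k,\omega_R)\simeq\mathbb k$. Put $\omega_A=\operatorname{Hom}_R(A,\omega_R)$ and $\omega_{A'}=\operatorname{Hom}_R(A',\omega_R)$, considered as left modules, and embed $\omega_{A'}$ into $\omega_A$ by restriction of maps to $A$. If $\omega_A=\bigoplus_{i=1}^nI_i$ with indecomposable $A$-submodules $I_i$, then $I_i^{-,B}\subseteq I_i$ is well defined for every $i$ and $\omega_{A'}=\bigoplus_{i=1}^nI_i^{-,B}$ as $A'$-modules. In particular every $I_i^{-,B}$ is L-injective as an $A'$-lattice, and every coprincipal $A'$-lattice is isomorphic to a direct summand of some $I_i^{-,B}$. -/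

import Mathlib

open scoped TensorProduct

universe u

namespace RejectionOrders

/-! ### Lattices, orders, elementary module theory -/

/-- `M` is an `R`-lattice: finitely generated and torsion free (regular elements of `R` act
injectively).  For an `R`-algebra `A`, an `A`-lattice is an `A`-module which is an `R`-lattice. -/
def IsLattice (R M : Type*) [CommRing R] [AddCommGroup M] [Module R M] : Prop :=
  Module.Finite R M ∧ Module.IsTorsionFree R M

/-- An `R`-order: an `R`-algebra which is an `R`-lattice and has no nonzero nilpotent
two-sided ideals. -/
def IsOrder (R A : Type*) [CommRing R] [Ring A] [Algebra R A] : Prop :=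
  IsLattice R A ∧ ∀ I : Ideal A, I.IsTwoSided → (∃ n : ℕ, I ^ n = ⊥) → I = ⊥

/-- `A` does not decompose as a ring: it is nonzero and has only trivial central idempotents. -/
def IsConnectedRing (A : Type*) [Ring A] : Prop :=
  Nontrivial A ∧ ∀ e : A, IsIdempotentElem e → (∀ a : A, e * a = a * e) → e = 0 ∨ e = 1

/-- Every left ideal is projective. -/
def IsHereditary (A : Type*) [Ring A] : Prop :=
  ∀ I : Ideal A, Module.Projective A I

/-- A nonzero module which is not a direct sum of two nonzero submodules. -/
def IsIndecomposable (A M : Type*) [Ring A] [AddCommGroup M] [Module A M] : Prop :=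
  Nontrivial M ∧ ∀ N N' : Submodule A M, IsCompl N N' → N = ⊥ ∨ N' = ⊥

/-- `N` is isomorphic to a direct summand of `M`. -/
def IsSummand (A N M : Type*) [Ring A] [AddCommGroup N] [Module A N]
    [AddCommGroup M] [Module A M] : Prop :=
  ∃ (i : N →ₗ[A] M) (p : M →ₗ[A] N), p ∘ₗ i = LinearMap.id

/-- `N` is isomorphic to a direct summand of a direct sum of finitely many copies of `M`. -/
def IsSummandOfPow (A N M : Type*) [Ring A] [AddCommGroup N] [Module A N]
    [AddCommGroup M] [Module A M] : Prop :=
  ∃ r : ℕ, IsSummand A N (Fin r → M)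

/-- An `A`-lattice `I` is L-injective: every exact sequence `0 → I → N → M → 0` of `A`-lattices
splits. -/
def IsLInjective (R A I : Type u) [CommRing R] [Ring A] [Algebra R A]
    [AddCommGroup I] [Module R I] [Module A I] [IsScalarTower R A I] : Prop :=
  IsLattice R I ∧
  ∀ (N M : Type u) [AddCommGroup N] [Module R N] [Module A N] [IsScalarTower R A N]
    [AddCommGroup M] [Module R M] [Module A M] [IsScalarTower R A M]
    (i : I →ₗ[A] N) (q : N →ₗ[A] M),
    IsLattice R N → IsLattice R M →
    Function.Injective i → Function.Exact i q → Function.Surjective q →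
    ∃ p : N →ₗ[A] I, p ∘ₗ i = LinearMap.id

/-- A bijective `A`-lattice: projective and L-injective. -/
def IsBijective (R A B : Type u) [CommRing R] [Ring A] [Algebra R A]
    [AddCommGroup B] [Module R B] [Module A B] [IsScalarTower R A B] : Prop :=
  Module.Projective A B ∧ IsLInjective R A B

/-! ### The rational hull and overrings -/

/-- `KM`, where `K` is the total ring of fractions of `R`.  For an `R`-algebra `A` this is the
`R`-algebra `KA`; for an `A`-module `M` it is an `A`-module through the factor `M`. -/
abbrev Hull (R M : Type u) [CommRing R] [AddCommGroup M] [Module R M] : Type u :=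
  M ⊗[R] FractionRing R

/-- The natural `A`-linear map `M → KM`, `m ↦ m ⊗ 1`. -/
noncomputable def toHull (R A M : Type u) [CommRing R] [Ring A] [Algebra R A]
    [AddCommGroup M] [Module R M] [Module A M] [IsScalarTower R A M] : M →ₗ[A] Hull R M where
  toFun m := m ⊗ₜ[R] (1 : FractionRing R)
  map_add' x y := TensorProduct.add_tmul x y _
  map_smul' a x := (TensorProduct.smul_tmul' a x _).symm

/-- An overring of `A`: an `R`-order `A'` with `A ⊆ A' ⊆ KA` (`A' = A` is allowed). -/
@[ext] structure Overring (R A : Type u) [CommRing R] [Ring A] [Algebra R A] where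
  alg : Subalgebra R (Hull R A)
  le : (Algebra.TensorProduct.includeLeft :
    A →ₐ[R] A ⊗[R] FractionRing R).range ≤ alg
  isOrder : IsOrder R alg

/-- The overring `A'` as a type; it carries the `R`-algebra structure of the subalgebra. -/
def Overring.Carrier {R A : Type u} [CommRing R] [Ring A] [Algebra R A]
    (A' : Overring R A) : Type u := A'.alg

section Carrier

variable {R A : Type u} [CommRing R] [Ring A] [Algebra R A] (A' : Overring R A)

noncomputable instance : Ring A'.Carrier := inferInstanceAs (Ring A'.alg)

noncomputable instance : Algebra R A'.Carrier := inferInstanceAs (Algebra R A'.alg)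

/-- The inclusion `A' → KA`. -/
noncomputable def Overring.toKA : A'.Carrier →ₐ[R] A ⊗[R] FractionRing R := A'.alg.val

end Carrier

/-- The inclusion `A → A'`. -/
noncomputable def Overring.incl {R A : Type u} [CommRing R] [Ring A] [Algebra R A]
    (A' : Overring R A) : A →ₐ[R] A'.Carrier :=
  (Algebra.TensorProduct.includeLeft : A →ₐ[R] A ⊗[R] FractionRing R).codRestrict A'.alg
    (fun a => A'.le ⟨a, rfl⟩)

/-- The `A`-module `M` is (the restriction to `A` of) an `A'`-module. -/
def Overring.ActsOn {R A : Type u} [CommRing R] [Ring A] [Algebra R A] (A' : Overring R A)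
    (M : Type*) [AddCommGroup M] [Module R M] [Module A M] [IsScalarTower R A M] : Prop :=
  ∃ φ : A'.Carrier →ₐ[R] Module.End R M, φ.comp A'.incl = Algebra.lsmul R R M

/-- `A'` is obtained from `A` by rejection of `B`, i.e. `A' = A⁻(B)`: every `A`-lattice is the
direct sum of a lattice that is a summand of copies of `B` and of an `A'`-lattice, and no nonzero
`A'`-lattice is a summand of copies of `B`. -/
def IsRejection {R A : Type u} [CommRing R] [Ring A] [Algebra R A] (B : Type u)
    [AddCommGroup B] [Module A B] (A' : Overring R A) : Prop :=
  (∀ (M : Type u) [AddCommGroup M] [Module R M] [Module A M] [IsScalarTower R A M],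
    IsLattice R M → ∃ B' M' : Submodule A M, IsCompl B' M' ∧
      IsSummandOfPow A B' B ∧ A'.ActsOn M') ∧
  (∀ (M : Type u) [AddCommGroup M] [Module R M] [Module A M] [IsScalarTower R A M],
    IsLattice R M → A'.ActsOn M → IsSummandOfPow A M B → Subsingleton M)

/-! ### Minimal overmodules and links -/

section Links

variable (R : Type u) {A V : Type u} [CommRing R] [Ring A] [Algebra R A]
  [AddCommGroup V] [Module R V] [Module A V] [IsScalarTower R A V]

/-- For a lattice `M` inside a `KA`-module `V`, the sum of all minimal overmodules of `M`; an
overmodule of `M` is a lattice `N` with `M ⊆ N ⊆ KM`. -/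
def radOver (M : Submodule A V) : Submodule A V :=
  sSup {N | M ⋖ N ∧ IsLattice R N ∧ ∀ x ∈ N, ∃ r ∈ nonZeroDivisors R, r • x ∈ M}

variable (B : Type u) [AddCommGroup B] [Module A B]

/-- A `B`-link `L 0, …, L n`, realized by submodules of one `KA`-module `V`. -/
structure IsLink {n : ℕ} (L : Fin (n + 1) → Submodule A V) : Prop where
  indecomposable : ∀ i, IsIndecomposable A (L i)
  summand : ∀ i, IsSummandOfPow A (L i) B
  step : ∀ i : Fin n, L i.succ = Ring.jacobson A • L i.castSucc
  lower : ¬ IsSummandOfPow A ↥(Ring.jacobson A • L (Fin.last n)) B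
  upper : ¬ IsSummandOfPow A (radOver R (L 0)) B

/-- `N = M^{+,B}` for an indecomposable lattice `M` inside a `KA`-module `V`. -/
def IsPlus (M N : Submodule A V) : Prop :=
  (¬ IsSummandOfPow A M B ∧ N = M) ∨
  ∃ (n : ℕ) (L : Fin (n + 1) → Submodule A V),
    IsLink R B L ∧ (∃ k, L k = M) ∧ N = radOver R (L 0)

/-- `N = M^{-,B}` for an indecomposable lattice `M` inside a `KA`-module `V`. -/
def IsMinus (M N : Submodule A V) : Prop :=
  (¬ IsSummandOfPow A M B ∧ N = M) ∨
  ∃ (n : ℕ) (L : Fin (n + 1) → Submodule A V),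
    IsLink R B L ∧ (∃ k, L k = M) ∧ N = Ring.jacobson A • L (Fin.last n)

end Links

/-! ### The canonical module and the dual of an order -/

/-- `W` is a canonical module of the local ring `R` (of dimension one): a lattice of injective
dimension one with `Ext¹(k, W) ≅ k`, where `k` is the residue field. -/
def IsCanonicalModule (R W : Type u) [CommRing R] [IsLocalRing R] [AddCommGroup W]
    [Module R W] : Prop :=
  IsLattice R W ∧
  CategoryTheory.injectiveDimension (ModuleCat.of R W) = 1 ∧
  Nonempty (CategoryTheory.Abelian.Ext
    (ModuleCat.of R (IsLocalRing.ResidueField R)) (ModuleCat.of R W) 1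
      ≃ₗ[R] IsLocalRing.ResidueField R)

/-- `Hom_R(A, W)`, which is `ω_A` when `W = ω_R`; as left `A`-module by `(a • f) x = f (x * a)`. -/
def Omega (R A W : Type u) [CommRing R] [Ring A] [Algebra R A] [AddCommGroup W] [Module R W] :
    Type u :=
  A →ₗ[R] W

section Omega

variable (R A W : Type u) [CommRing R] [Ring A] [Algebra R A] [AddCommGroup W] [Module R W]

noncomputable instance : AddCommGroup (Omega R A W) := inferInstanceAs (AddCommGroup (A →ₗ[R] W))

noncomputable instance : Module R (Omega R A W) := inferInstanceAs (Module R (A →ₗ[R] W))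

noncomputable instance : Module A (Omega R A W) where
  smul a f := LinearMap.comp (show A →ₗ[R] W from f) (LinearMap.mulRight R a)
  one_smul f := LinearMap.ext fun x => congrArg (show A →ₗ[R] W from f) (mul_one x)
  mul_smul a b f := LinearMap.ext fun x =>
    congrArg (show A →ₗ[R] W from f) (mul_assoc x a b).symm
  smul_zero _ := rfl
  smul_add _ _ _ := rfl
  add_smul a b f := LinearMap.ext fun x =>
    (congrArg (show A →ₗ[R] W from f) (mul_add x a b)).trans
      ((show A →ₗ[R] W from f).map_add (x * a) (x * b))
  zero_smul f := LinearMap.ext fun x =>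
    (congrArg (show A →ₗ[R] W from f) (mul_zero x)).trans (show A →ₗ[R] W from f).map_zero

theorem Omega.smul_apply (a : A) (f : Omega R A W) (x : A) :
    (show A →ₗ[R] W from a • f) x = (show A →ₗ[R] W from f) (x * a) := rfl

instance : IsScalarTower R A (Omega R A W) where
  smul_assoc r a f := LinearMap.ext fun x => by
    have h : (show A →ₗ[R] W from f) (x * (r • a)) = r • (show A →ₗ[R] W from f) (x * a) := by
      rw [mul_smul_comm, LinearMap.map_smul]
    exact h

end Omega

section Compare

variable {R A : Type u} [CommRing R] [Ring A] [Algebra R A] (A' : Overring R A)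

/-- A left ideal of the overring `A'`, as an `A`-submodule of `KA`. -/
def Overring.idealToHull (Q : Submodule A'.Carrier A'.Carrier) : Submodule A (Hull R A) where
  carrier := A'.toKA '' (Q : Set A'.Carrier)
  add_mem' := by
    rintro _ _ ⟨x, hx, rfl⟩ ⟨y, hy, rfl⟩
    exact ⟨x + y, Q.add_mem hx hy, rfl⟩
  zero_mem' := ⟨0, Q.zero_mem, rfl⟩
  smul_mem' := by
    rintro a _ ⟨x, hx, rfl⟩
    refine ⟨A'.incl a • x, Q.smul_mem _ hx, ?_⟩
    change (a ⊗ₜ[R] (1 : FractionRing R)) * A'.toKA x = a • A'.toKA x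
    induction A'.toKA x using TensorProduct.induction_on with
    | zero => simp
    | tmul b k => simp [TensorProduct.smul_tmul']
    | add y z hy hz => rw [mul_add, smul_add, hy, hz]

/-- Restriction of maps `ω_{A'} = Hom_R(A', W) → Hom_R(A, W) = ω_A`. -/
noncomputable def Overring.res {W : Type u} [AddCommGroup W] [Module R W]
    (f : Omega R A'.Carrier W) : Omega R A W :=
  LinearMap.comp (show A'.Carrier →ₗ[R] W from f) A'.incl.toLinearMap

/-- An `A'`-submodule of `ω_{A'}`, restricted to `A` and regarded as an `A`-submodule of
`Kω_A`. -/
noncomputable def Overring.omegaToHull {W : Type u} [AddCommGroup W] [Module R W]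
    (J : Submodule A'.Carrier (Omega R A'.Carrier W)) : Submodule A (Hull R (Omega R A W)) where
  carrier := (fun f => toHull R A (Omega R A W) (A'.res f)) '' (J : Set (Omega R A'.Carrier W))
  add_mem' := by
    rintro _ _ ⟨x, hx, rfl⟩ ⟨y, hy, rfl⟩
    exact ⟨x + y, J.add_mem hx hy, (toHull R A (Omega R A W)).map_add (A'.res x) (A'.res y)⟩
  zero_mem' := ⟨0, J.zero_mem, (toHull R A (Omega R A W)).map_zero⟩
  smul_mem' := by
    rintro a _ ⟨x, hx, rfl⟩
    refine ⟨A'.incl a • x, J.smul_mem _ hx, ?_⟩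
    have h : A'.res (A'.incl a • x) = a • A'.res x := LinearMap.ext fun b =>
      congrArg (show A'.Carrier →ₗ[R] W from x) (A'.incl.map_mul b a).symm
    change toHull R A (Omega R A W) (A'.res (A'.incl a • x)) = _
    rw [h, LinearMap.map_smul]

end Compare

end RejectionOrders

/-!
The overring `A⁻(B)` is the set of all `x ∈ KA` that map every `A`-lattice without nonzero summands
from `B` into itself (`rejectionAlg`).  Everything rests on how the indecomposable lattices in the
additive closure of `B` sit among their neighbours.

*Steps.*  Let `M` be an indecomposable summand of copies of `B`.  As `M` is projective, `𝔯M` is its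
largest proper submodule.  As `M` is L-injective, the inclusion into a proper overmodule splits or
extends, and `M` has a least proper overmodule, which is `M^𝔯` (`radOver_spec`).  More generally, a
map from `M` to a lattice either splits or extends to `M^𝔯` (`exists_isUnit_or_exists_extension`).
Consequently `𝔯M` and `M^𝔯` are either without summands from `B`, or again indecomposable summands of
copies of `B`: a summand from `B` of a neighbour of `M` is the whole neighbour
(`eq_bot_of_isCompl_of_covBy`, `eq_bot_of_isCompl_of_covBy_of_projective`).

*Links are finite.*  If the descent `M, 𝔯M, 𝔯²M, …` consisted of summands of copies of `B` only, these
projective modules would be all nonzero submodules of `M`, and the connected order `A` would be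
hereditary (`IsMember.exists_not_isSummandOfPow`).  An infinite ascent would reach `t⁻¹M` for a regular
nonunit `t` of `R`, and hence give an infinite descent.  So `M^{+,B}` and `M^{-,B}` exist
(`exists_isPlus`, `exists_isMinus`).

*The overring.*  For an indecomposable summand `P` of `A` the lattice `P^{+,B}` has no summands from
`B`, so that `A⁻(B)P ⊆ P^{+,B}`; this makes `A⁻(B)` finitely generated, hence an order.  In the other
direction, a map from `P` to a lattice without summands from `B` extends along each step up to
`P^{+,B}`, which puts the elements of `P^{+,B}` into `A⁻(B)` (`mem_rejectionAlg_of_extension`,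
`exists_isInternal_isPlus`).  A nonzero `A⁻(B)`-lattice that is a summand of copies of `B` would have an
indecomposable summand `X`, and a dual basis of the projective module `X` would show `X^{+,B} = X`,
which is absurd (`subsingleton_of_stabilizes`); this and the splitting off of a maximal summand from
`B` give `isRejection_rejection`.  For uniqueness, an overring
that arises by rejection of `B` consists of the same lattices (`IsRejection.eq_rejection`).

*Duals.*  The part of `ω_{A'}` that restricts into `I i` is the largest `A'`-lattice contained in `I i`,
which is `(I i)^{-,B}` (`exists_isInternal_isMinus`).  The canonical module enters through the
vanishing of `Ext¹(C, ω_R)` for lattices `C`, which makes `ω_A` L-injective, and through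
`Ext¹(𝕜, ω_R) ≠ 0`, which makes lattices reflexive with respect to `ω_R`
(`IsCanonicalModule.exists_eq_smul`) and every L-injective lattice a summand of copies of `ω_A`
(`IsLInjective.exists_isSummand_omega`).
-/

namespace RejectionOrders

/-! ### One-dimensional reduced local rings -/

/-- If all elements of the maximal ideal are zero divisors, then a nonzero `x` annihilates it; either
`x` is a unit, and the dimension is zero, or `x ^ 2 = 0`, and the ring is not reduced. -/
theorem exists_regular_mem_maximalIdeal {R : Type u} [CommRing R] [IsLocalRing R]
    [IsNoetherianRing R] [IsReduced R] (hdim : ringKrullDim R = 1) :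
    ∃ t ∈ IsLocalRing.maximalIdeal R, t ∈ nonZeroDivisors R := by
  by_contra! h
  have hlt := Ideal.bot_lt_annihilator_of_disjoint_nonZeroDivisors
    (I := IsLocalRing.maximalIdeal R) (Set.disjoint_left.mpr h)
  obtain ⟨x, hx, hx0⟩ := Submodule.exists_mem_ne_zero_of_ne_bot hlt.ne'
  have hxm : ∀ y ∈ IsLocalRing.maximalIdeal R, x * y = 0 := fun y hy =>
    Submodule.mem_annihilator.mp hx y hy
  by_cases hxu : IsUnit x
  · have hbot : IsLocalRing.maximalIdeal R = ⊥ := by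
      rw [eq_bot_iff]
      intro y hy
      exact (hxu.mul_right_eq_zero).mp (hxm y hy)
    have hf := IsLocalRing.isField_iff_maximalIdeal_eq.mpr hbot
    rw [ringKrullDim_eq_zero_of_isField hf] at hdim
    exact zero_ne_one hdim
  · refine hx0 (IsReduced.eq_zero x ⟨2, ?_⟩)
    rw [sq, hxm x ((IsLocalRing.mem_maximalIdeal x).mpr hxu)]

theorem isArtinianRing_quotient_span {R : Type u} [CommRing R] [IsNoetherianRing R]
    (hdim : ringKrullDim R = 1) {r : R} (hr : r ∈ nonZeroDivisors R) :
    IsArtinianRing (R ⧸ Ideal.span {r}) := by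
  rw [isArtinianRing_iff_krullDimLE_zero, Ring.krullDimLE_iff]
  have h := ringKrullDim_quotient_succ_le_of_nonZeroDivisor hr
  rw [hdim] at h
  generalize ringKrullDim (R ⧸ Ideal.span {r}) = d at h
  induction d with
  | bot => simp
  | coe d =>
    have h' : d + 1 ≤ 0 + 1 := by
      rw [zero_add]
      exact_mod_cast h
    have := (ENat.add_le_add_iff_right ENat.one_ne_top).mp h'
    exact_mod_cast this

theorem isArtinian_of_isTorsionBySet {R : Type u} [CommRing R] {I : Ideal R}
    [IsArtinianRing (R ⧸ I)] {M : Type*} [AddCommGroup M] [Module R M] [Module.Finite R M]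
    (ht : Module.IsTorsionBySet R M (I : Set R)) : IsArtinian R M := by
  let := ht.module
  have : IsScalarTower R (R ⧸ I) M := ht.isScalarTower
  have : Module.Finite (R ⧸ I) M := Module.Finite.of_restrictScalars_finite R _ M
  have : IsArtinian (R ⧸ I) M := inferInstance
  exact (ht.semilinearMap.isArtinian_iff_of_bijective Function.bijective_id).mpr this

/-- A finitely generated module killed by a regular element is artinian. -/
theorem isArtinian_of_smul_eq_zero {R : Type u} [CommRing R] [IsNoetherianRing R]
    (hdim : ringKrullDim R = 1) {r : R} (hr : r ∈ nonZeroDivisors R) {M : Type*}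
    [AddCommGroup M] [Module R M] [Module.Finite R M] (h : ∀ x : M, r • x = 0) :
    IsArtinian R M :=
  have := isArtinianRing_quotient_span hdim hr
  isArtinian_of_isTorsionBySet ((Module.isTorsionBySet_span_singleton_iff r).mpr h)

/-! ### Endomorphism rings of indecomposable modules -/

section Local

variable {R : Type u} [CommRing R] [IsLocalRing R] [IsNoetherianRing R]
  [IsAdicComplete (IsLocalRing.maximalIdeal R) R]

/-- A finite algebra over a complete local ring is complete, being a quotient of a power of the ring. -/
theorem isAdicComplete_map_of_finite (S : Type*) [CommRing S] [Algebra R S] [Module.Finite R S] :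
    IsAdicComplete ((IsLocalRing.maximalIdeal R).map (algebraMap R S)) S := by
  set m := IsLocalRing.maximalIdeal R
  have h1 : IsHausdorff m S := IsHausdorff.of_le_jacobson m S
    (IsLocalRing.jacobson_eq_maximalIdeal (⊥ : Ideal R) bot_ne_top).ge
  have h2 : IsPrecomplete m S := by
    obtain ⟨n, f, hf⟩ := Module.Finite.exists_fin' R S
    rw [← AdicCompletion.of_surjective_iff]
    intro y
    obtain ⟨x, rfl⟩ := AdicCompletion.map_surjective m hf y
    choose z hz using fun j : Fin n => AdicCompletion.of_surjective m R
      (AdicCompletion.map m (LinearMap.proj j : (Fin n → R) →ₗ[R] R) x)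
    have hx : AdicCompletion.of m (Fin n → R) z = x := by
      refine (AdicCompletion.piEquivFin m n).injective (funext fun j => ?_)
      rw [AdicCompletion.piEquivFin_apply, AdicCompletion.piEquivFin_apply]
      have h1 := AdicCompletion.map_of m (LinearMap.proj j : (Fin n → R) →ₗ[R] R) z
      exact h1.trans (hz j)
    exact ⟨f z, by rw [← hx]; exact (AdicCompletion.map_of m f z).symm⟩
  exact { IsHausdorff.map_algebraMap_iff.mpr h1, IsPrecomplete.map_algebraMap_iff.mpr h2 with }

open Polynomial in
/-- Idempotents lift along a henselian ideal: the derivative of `X ^ 2 - X` at an idempotent is its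
own inverse. -/
theorem exists_idempotent_sub_mem {S : Type*} [CommRing S] (I : Ideal S) [HenselianRing S I]
    {a : S} (ha : a * a - a ∈ I) : ∃ e : S, e * e = e ∧ e - a ∈ I := by
  have hmonic : (X ^ 2 - X : S[X]).Monic :=
    monic_X_pow_sub (n := 2) (p := X) (degree_X_le.trans_lt (by norm_num))
  have heval : ∀ x : S, eval x (X ^ 2 - X : S[X]) = x * x - x := fun x => by
    rw [eval_sub, eval_pow, eval_X, sq]
  have hder : eval a (derivative (X ^ 2 - X : S[X])) = 2 * a - 1 := by
    simp [one_add_one_eq_two]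
  have hunit : IsUnit (Ideal.Quotient.mk I (eval a (derivative (X ^ 2 - X : S[X])))) := by
    have h0 : Ideal.Quotient.mk I (a * a - a) = 0 := Ideal.Quotient.eq_zero_iff_mem.mpr ha
    have h1 : Ideal.Quotient.mk I (2 * a - 1) * Ideal.Quotient.mk I (2 * a - 1) = 1 := by
      rw [← map_mul, show (2 * a - 1) * (2 * a - 1) = 4 * (a * a - a) + 1 by ring, map_add,
        map_mul, h0, mul_zero, zero_add, map_one]
    rw [hder]
    exact .of_mul_eq_one _ h1
  obtain ⟨e, he, hea⟩ := HenselianRing.is_henselian (I := I) _ hmonic a ((heval a).symm ▸ ha) hunit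
  exact ⟨e, sub_eq_zero.mp ((heval e).symm.trans he), hea⟩

/-- Let `S` be a commutative finite algebra over a complete local ring, mapping to a ring `E`
without nontrivial idempotents.  Fitting's lemma in the artinian ring `S / 𝔪 S` gives an idempotent
for `x`, which lifts to `S`; its image in `E` is `0` or `1`. -/
theorem isUnit_or_isUnit_one_sub_of_finite {S E : Type*} [CommRing S] [Algebra R S]
    [Module.Finite R S] [Ring E] (ψ : S →+* E)
    (hE : ∀ e : E, e * e = e → e = 0 ∨ e = 1) (x : S) : IsUnit (ψ x) ∨ IsUnit (1 - ψ x) := by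
  set I := (IsLocalRing.maximalIdeal R).map (algebraMap R S) with hI
  have : IsAdicComplete I S := isAdicComplete_map_of_finite S
  have hjac : ∀ z ∈ I, IsUnit (1 - z) := fun z hz => by
    have := Ideal.mem_jacobson_bot.mp (IsAdicComplete.le_jacobson_bot I hz) (-1)
    convert this using 1
    ring
  have : IsArtinianRing (R ⧸ IsLocalRing.maximalIdeal R) :=
    inferInstanceAs (IsArtinianRing (IsLocalRing.ResidueField R))
  have : IsArtinian R (S ⧸ I) := isArtinian_of_isTorsionBySet (I := IsLocalRing.maximalIdeal R) (by
    rintro y ⟨r, hr⟩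
    obtain ⟨s, rfl⟩ := Ideal.Quotient.mk_surjective y
    change r • (Ideal.Quotient.mk I s) = 0
    rw [Algebra.smul_def, IsScalarTower.algebraMap_apply R S (S ⧸ I)]
    change Ideal.Quotient.mk I _ * _ = 0
    rw [Ideal.Quotient.eq_zero_iff_mem.mpr (Ideal.mem_map_of_mem _ hr), zero_mul])
  have : IsArtinianRing (S ⧸ I) := isArtinian_of_tower R this
  obtain ⟨n, y, hy⟩ := IsArtinian.exists_pow_succ_smul_dvd (Ideal.Quotient.mk I x) (1 : S ⧸ I)
  obtain ⟨y, rfl⟩ := Ideal.Quotient.mk_surjective y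
  have hpow : ∀ k, Ideal.Quotient.mk I (x ^ n) = Ideal.Quotient.mk I (x ^ (n + k) * y ^ k) := by
    intro k
    induction k with
    | zero => simp
    | succ k ih =>
      rw [ih]
      simp only [map_mul, map_pow, smul_eq_mul, mul_one, Nat.succ_eq_add_one] at hy ⊢
      linear_combination (-1 : S ⧸ I) * Ideal.Quotient.mk I x ^ k * Ideal.Quotient.mk I y ^ k * hy
  have hn := hpow n
  obtain ⟨e, he, hea⟩ := exists_idempotent_sub_mem I (a := x ^ n * y ^ n) (by
    rw [← Ideal.Quotient.eq_zero_iff_mem]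
    simp only [map_mul, map_pow, map_sub, pow_add] at hn ⊢
    linear_combination (-1 : S ⧸ I) * Ideal.Quotient.mk I y ^ n * hn)
  have hcomm : ∀ a b : S, Commute (ψ a) (ψ b) := fun a b => by
    rw [Commute, SemiconjBy, ← map_mul, ← map_mul, mul_comm]
  rcases hE (ψ e) (by rw [← map_mul, he]) with h | h
  · -- `x ^ n` agrees with `x ^ n * e` modulo the radical, so `1 - x ^ n` becomes a unit
    right
    have hz : x ^ n * (1 - e) ∈ I := by
      rw [← Ideal.Quotient.eq_zero_iff_mem]
      have := Ideal.Quotient.eq_zero_iff_mem.mpr hea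
      simp only [map_mul, map_pow, map_sub, map_one, pow_add] at hn this ⊢
      linear_combination hn - Ideal.Quotient.mk I x ^ n * this
    have hu := (hjac _ hz).map ψ
    rw [map_sub, map_one, map_mul, map_sub, map_one, h, sub_zero, mul_one] at hu
    obtain ⟨q, hq⟩ : (1 - x) ∣ 1 - x ^ n := by simpa using sub_dvd_pow_sub_pow 1 x n
    rw [← map_one ψ, ← map_sub, hq, map_mul] at hu
    rw [← map_one ψ, ← map_sub]
    exact ((hcomm _ _).isUnit_mul_iff.mp hu).1
  · -- `x ^ n * y ^ n` is a unit; the case `n = 0`, where this says nothing, is treated separately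
    rcases Nat.eq_zero_or_pos n with rfl | hpos
    · left
      have hz : 1 - x * y ∈ I := by
        rw [← Ideal.Quotient.eq_zero_iff_mem]
        simp only [map_mul, map_sub, map_one, smul_eq_mul] at hy ⊢
        linear_combination (-1 : S ⧸ I) * hy
      have hu := (hjac _ hz).map ψ
      rw [sub_sub_cancel, map_mul] at hu
      exact ((hcomm _ _).isUnit_mul_iff.mp hu).1
    · left
      have hu := (hjac _ hea).map ψ
      rw [map_sub, map_one, map_sub, h, sub_sub_cancel, map_mul] at hu
      have := ((hcomm _ _).isUnit_mul_iff.mp hu).1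
      rw [map_pow] at this
      exact (isUnit_pow_iff hpos.ne').mp this

/-- The endomorphism ring of an indecomposable module which is finite over `R` is local. -/
theorem IsIndecomposable.isUnit_or_isUnit_one_sub {A M : Type*} [Ring A] [Algebra R A]
    [AddCommGroup M] [Module R M] [Module A M] [IsScalarTower R A M] [Module.Finite R M]
    (hM : IsIndecomposable A M) (f : Module.End A M) : IsUnit f ∨ IsUnit (1 - f) := by
  have : SMulCommClass A R M := inferInstance
  obtain ⟨p, hp, hpf⟩ := LinearMap.exists_monic_and_aeval_eq_zero R (f.restrictScalars R)
  let ρ : Module.End A M →ₐ[R] Module.End R M :=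
    { toFun := fun g => g.restrictScalars R
      map_one' := rfl
      map_mul' := fun _ _ => rfl
      map_zero' := rfl
      map_add' := fun _ _ => rfl
      commutes' := fun _ => rfl }
  have hρ : Function.Injective ρ := LinearMap.restrictScalars_injective R
  have hpf' : Polynomial.aeval f p = 0 := hρ (by
    rw [map_zero, ← Polynomial.aeval_algHom_apply]; exact hpf)
  let ψ : Polynomial R ⧸ Ideal.span {p} →ₐ[R] Module.End A M :=
    Ideal.Quotient.liftₐ _ (Polynomial.aeval f) (fun a ha => by
      obtain ⟨q, rfl⟩ := Ideal.mem_span_singleton'.mp ha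
      rw [map_mul, hpf', mul_zero])
  have : Module.Finite R (Polynomial R ⧸ Ideal.span {p}) := hp.finite_quotient
  -- the finite commutative subalgebra `R[f]` of the endomorphism ring
  have hx : ψ (Ideal.Quotient.mk _ Polynomial.X) = f := by
    exact (Ideal.Quotient.lift_mk _ _ _).trans (Polynomial.aeval_X f)
  rw [← hx]
  refine isUnit_or_isUnit_one_sub_of_finite (R := R) ψ.toRingHom (fun e he => ?_) _
  rcases hM.2 _ _ (LinearMap.IsIdempotentElem.isCompl (f := e) he) with h | h
  · exact .inl (LinearMap.range_eq_bot.mp h)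
  · right
    have hinj := LinearMap.ker_eq_bot.mp h
    ext x
    exact hinj (by rw [← Module.End.mul_apply, he]; rfl)

end Local

/-! ### Lattices and direct summands -/

section Lattice

variable {R M N : Type*} [CommRing R] [AddCommGroup M] [Module R M] [AddCommGroup N] [Module R N]

theorem isTorsionFree_iff :
    Module.IsTorsionFree R M ↔ ∀ r ∈ nonZeroDivisors R, ∀ x : M, r • x = 0 → x = 0 := by
  constructor
  · intro h r hr x hx
    exact (isRegular_iff_mem_nonZeroDivisors.mpr hr).smul_eq_zero_iff_right.mp hx
  · intro h
    refine ⟨fun r hr x y hxy => ?_⟩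
    rw [← sub_eq_zero]
    refine h r (isRegular_iff_mem_nonZeroDivisors.mp hr) _ ?_
    rw [smul_sub, sub_eq_zero]
    exact hxy

theorem IsLattice.eq_zero (h : IsLattice R M) {r : R} (hr : r ∈ nonZeroDivisors R) {x : M}
    (hx : r • x = 0) : x = 0 :=
  isTorsionFree_iff.mp h.2 r hr x hx

theorem IsLattice.smul_cancel (h : IsLattice R M) {r : R} (hr : r ∈ nonZeroDivisors R) {x y : M}
    (hx : r • x = r • y) : x = y := by
  rw [← sub_eq_zero]
  exact h.eq_zero hr (by rw [smul_sub, hx, sub_self])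

theorem IsLattice.of_injective [IsNoetherianRing R] (hN : IsLattice R N) (f : M →ₗ[R] N)
    (hf : Function.Injective f) : IsLattice R M := by
  have := hN.1
  refine ⟨Module.Finite.of_injective f hf, isTorsionFree_iff.mpr fun r hr x hx => hf ?_⟩
  rw [map_zero]
  exact hN.eq_zero hr (by rw [← map_smul, hx, map_zero])

theorem IsLattice.pi {ι : Type*} [Finite ι] {M : ι → Type*} [∀ i, AddCommGroup (M i)]
    [∀ i, Module R (M i)] (h : ∀ i, IsLattice R (M i)) : IsLattice R (∀ i, M i) := by
  have := fun i => (h i).1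
  refine ⟨inferInstance, isTorsionFree_iff.mpr fun r hr x hx => ?_⟩
  funext i
  exact (h i).eq_zero hr (congrFun hx i)

theorem IsLattice.prod (hM : IsLattice R M) (hN : IsLattice R N) : IsLattice R (M × N) := by
  have := hM.1
  have := hN.1
  refine ⟨inferInstance, isTorsionFree_iff.mpr fun r hr x hx => ?_⟩
  exact Prod.ext (hM.eq_zero hr (congrArg Prod.fst hx)) (hN.eq_zero hr (congrArg Prod.snd hx))

theorem IsLattice.submodule {A : Type*} [Ring A] [Algebra R A] [Module A M] [IsScalarTower R A M]
    [IsNoetherianRing R] (hM : IsLattice R M) (N : Submodule A M) : IsLattice R N :=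
  hM.of_injective (N.subtype.restrictScalars R) N.injective_subtype

theorem IsLattice.isNoetherian {A : Type*} [Ring A] [Algebra R A] [Module A M] [IsScalarTower R A M]
    [IsNoetherianRing R] (hM : IsLattice R M) : IsNoetherian A M :=
  have := hM.1
  isNoetherian_of_tower R inferInstance

end Lattice

section Summand

variable {A : Type*} [Ring A] {X Y M N P B : Type*} [AddCommGroup X] [Module A X] [AddCommGroup Y]
  [Module A Y] [AddCommGroup M] [Module A M] [AddCommGroup N] [Module A N]
  [AddCommGroup P] [Module A P] [AddCommGroup B] [Module A B]

theorem IsSummand.trans (h : IsSummand A M N) (h' : IsSummand A N P) : IsSummand A M P := by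
  obtain ⟨i, p, h⟩ := h
  obtain ⟨j, q, h'⟩ := h'
  refine ⟨j ∘ₗ i, p ∘ₗ q, LinearMap.ext fun x => ?_⟩
  have h1 := LinearMap.congr_fun h' (i x)
  have h2 := LinearMap.congr_fun h x
  simp only [LinearMap.comp_apply, LinearMap.id_apply] at h1 h2 ⊢
  rw [h1, h2]

theorem IsSummand.of_linearEquiv (e : M ≃ₗ[A] N) : IsSummand A M N :=
  ⟨e, e.symm, by ext; simp⟩

theorem IsSummand.of_isCompl {X Y : Submodule A M} (h : IsCompl X Y) : IsSummand A X M :=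
  ⟨X.subtype, X.projectionOnto Y h, by ext x; simp⟩

theorem isCompl_range_ker {i : M →ₗ[A] N} {p : N →ₗ[A] M} (hip : p ∘ₗ i = LinearMap.id) :
    IsCompl (LinearMap.range i) (LinearMap.ker p) := by
  have hinj : Function.Injective i := Function.LeftInverse.injective (g := p)
    fun x => LinearMap.congr_fun hip x
  have h := LinearMap.isCompl_of_proj (f := i.rangeRestrict ∘ₗ p) (p := LinearMap.range i) (by
    rintro ⟨_, x, rfl⟩
    exact Subtype.ext (congrArg i (LinearMap.congr_fun hip x)))
  rwa [LinearMap.ker_comp_of_ker_eq_bot] at h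
  rw [LinearMap.ker_rangeRestrict]
  exact LinearMap.ker_eq_bot.mpr hinj

theorem IsSummandOfPow.of_isSummand (h : IsSummand A M N) (h' : IsSummandOfPow A N B) :
    IsSummandOfPow A M B :=
  let ⟨r, hr⟩ := h'
  ⟨r, h.trans hr⟩

theorem IsSummandOfPow.congr (e : M ≃ₗ[A] N) (h : IsSummandOfPow A N B) : IsSummandOfPow A M B :=
  .of_isSummand (.of_linearEquiv e) h

theorem IsSummandOfPow.of_subsingleton [Subsingleton M] : IsSummandOfPow A M B :=
  ⟨0, 0, 0, by ext x; exact Subsingleton.elim _ _⟩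

theorem IsSummandOfPow.prod (hM : IsSummandOfPow A M B) (hN : IsSummandOfPow A N B) :
    IsSummandOfPow A (M × N) B := by
  obtain ⟨r, i, p, h⟩ := hM
  obtain ⟨s, j, q, h'⟩ := hN
  refine ⟨r + s, ?_⟩
  let e : (Fin (r + s) → B) ≃ₗ[A] (Fin r → B) × (Fin s → B) :=
    (LinearEquiv.funCongrLeft A B finSumFinEquiv).trans (LinearEquiv.sumArrowLequivProdArrow _ _ A B)
  refine IsSummand.trans ⟨i.prodMap j, p.prodMap q, ?_⟩ (.of_linearEquiv e.symm)
  ext1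
  · ext1 x
    simpa using LinearMap.congr_fun h x
  · ext1 x
    simpa using LinearMap.congr_fun h' x

theorem IsSummandOfPow.sup {X Y : Submodule A M} (hXY : Disjoint X Y)
    (hX : IsSummandOfPow A X B) (hY : IsSummandOfPow A Y B) :
    IsSummandOfPow A ↥(X ⊔ Y) B := by
  have hinj : Function.Injective (X.subtype.coprod Y.subtype) := by
    rw [← LinearMap.ker_eq_bot, LinearMap.ker_coprod_of_disjoint_range, Submodule.ker_subtype,
      Submodule.ker_subtype, Submodule.prod_bot]
    rwa [Submodule.range_subtype, Submodule.range_subtype]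
  have hr : LinearMap.range (X.subtype.coprod Y.subtype) = X ⊔ Y := by
    rw [LinearMap.range_coprod, Submodule.range_subtype, Submodule.range_subtype]
  exact .congr ((LinearEquiv.ofInjective _ hinj).trans (LinearEquiv.ofEq _ _ hr)).symm (hX.prod hY)

theorem IsSummandOfPow.projective [Module.Projective A B] (h : IsSummandOfPow A M B) :
    Module.Projective A M :=
  let ⟨r, i, p, h⟩ := h
  have : Module.Projective A (Fin r → B) :=
    .of_equiv (DirectSum.linearEquivFunOnFintype A (Fin r) fun _ => B)
  .of_split i p h

/-- `M` has no nonzero direct summand which is a direct summand of copies of `B`. -/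
def HasNoSummand (A B M : Type*) [Ring A] [AddCommGroup B] [Module A B] [AddCommGroup M]
    [Module A M] : Prop :=
  ∀ X Y : Submodule A M, IsCompl X Y → IsSummandOfPow A X B → X = ⊥

theorem HasNoSummand.subsingleton (hM : HasNoSummand A B M) (h : IsSummandOfPow A M B) :
    Subsingleton M := by
  have := hM ⊤ ⊥ isCompl_top_bot (.congr Submodule.topEquiv h)
  exact (Submodule.subsingleton_iff A).mp (subsingleton_of_bot_eq_top this.symm)

/-- A summand `X` of `M`, given by maps, is isomorphic to a complemented submodule. -/
theorem HasNoSummand.subsingleton_of_isSummand (hM : HasNoSummand A B M) (hX : IsSummand A X M)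
    (h : IsSummandOfPow A X B) : Subsingleton X := by
  obtain ⟨i, p, hip⟩ := hX
  have hinj : Function.Injective i := Function.LeftInverse.injective (g := p)
    fun x => LinearMap.congr_fun hip x
  have hcompl := isCompl_range_ker hip
  have := hM _ _ hcompl (.congr (LinearEquiv.ofInjective i hinj).symm h)
  exact ⟨fun x y => hinj (by
    rw [LinearMap.range_eq_bot] at this; rw [this]; rfl)⟩

theorem IsIndecomposable.congr (e : M ≃ₗ[A] N) (h : IsIndecomposable A N) :
    IsIndecomposable A M := by
  have := h.1
  refine ⟨e.toEquiv.nontrivial, fun X Y hXY => ?_⟩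
  have := h.2 _ _ ((Submodule.orderIsoMapComap e).isCompl hXY)
  exact this.imp (fun h => (map_eq_bot_iff (Submodule.orderIsoMapComap e)).mp h)
    (fun h => (map_eq_bot_iff (Submodule.orderIsoMapComap e)).mp h)

theorem IsIndecomposable.hasNoSummand (hM : IsIndecomposable A M) (h : ¬ IsSummandOfPow A M B) :
    HasNoSummand A B M := by
  intro X Y hXY hX
  refine (hM.2 X Y hXY).resolve_right fun hY => h ?_
  rw [hY] at hXY
  obtain rfl := eq_top_of_isCompl_bot hXY
  exact .congr Submodule.topEquiv.symm hX

theorem eq_bot_of_map_subtype_eq_bot {X : Submodule A M} {N : Submodule A X}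
    (h : N.map X.subtype = ⊥) : N = ⊥ :=
  Submodule.map_injective_of_injective X.injective_subtype (h.trans (Submodule.map_bot _).symm)

/-- A decomposition of a complement `X` of `Y` moves a summand of `X` over to `Y`. -/
theorem disjoint_and_isCompl_of_isCompl {X Y : Submodule A M} (hc : IsCompl Y X)
    {N N' : Submodule A X} (h : IsCompl N N') :
    Disjoint Y (N.map X.subtype) ∧ IsCompl (Y ⊔ N.map X.subtype) (N'.map X.subtype) := by
  have hdis : Disjoint (N.map X.subtype) (N'.map X.subtype) :=
    Submodule.disjoint_map X.injective_subtype h.disjoint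
  have hsup : N.map X.subtype ⊔ N'.map X.subtype = X := by
    rw [← Submodule.map_sup, h.sup_eq_top, Submodule.map_subtype_top]
  exact ⟨hc.disjoint.mono_right (Submodule.map_subtype_le _ _),
    hdis.isCompl_sup_left_of_isCompl_sup_right (hsup.symm ▸ hc)⟩

theorem eq_bot_of_not_lt_sup {X Y : Submodule A M} {N : Submodule A X}
    (hdis : Disjoint Y (N.map X.subtype)) (h : ¬ Y < Y ⊔ N.map X.subtype) : N = ⊥ := by
  have hXB : N.map X.subtype ≤ Y := by
    by_contra hcon
    exact h (left_lt_sup.mpr hcon)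
  exact eq_bot_of_map_subtype_eq_bot ((hdis.mono_left hXB).eq_bot_of_self)

variable (A B M) in
/-- A noetherian module is the sum of a summand of copies of `B` and of a module without such
summands. -/
theorem exists_isCompl_hasNoSummand [IsNoetherian A M] :
    ∃ B' M' : Submodule A M, IsCompl B' M' ∧ IsSummandOfPow A B' B ∧ HasNoSummand A B M' := by
  -- a maximal summand among those in the additive closure of `B`
  obtain ⟨B', ⟨⟨M', hc⟩, hB'⟩, hmax⟩ := set_has_maximal_iff_noetherian.mpr ‹IsNoetherian A M›
    {X : Submodule A M | (∃ Y, IsCompl X Y) ∧ IsSummandOfPow A X B}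
    ⟨⊥, ⟨⊤, isCompl_bot_top⟩, .of_subsingleton⟩
  refine ⟨B', M', hc, hB', fun X Y hXY hX => ?_⟩
  obtain ⟨hdis, hcompl⟩ := disjoint_and_isCompl_of_isCompl hc hXY
  exact eq_bot_of_not_lt_sup hdis (hmax _ ⟨⟨_, hcompl⟩, hB'.sup hdis
    (.congr (Submodule.equivMapOfInjective _ M'.injective_subtype X).symm hX)⟩)

variable (A M) in
/-- The complement of a maximal proper summand is indecomposable. -/
theorem exists_isCompl_isIndecomposable [IsNoetherian A M] [Nontrivial M] :
    ∃ X Y : Submodule A M, IsCompl X Y ∧ IsIndecomposable A X := by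
  obtain ⟨Y, ⟨⟨X, hc⟩, hY⟩, hmax⟩ := set_has_maximal_iff_noetherian.mpr ‹IsNoetherian A M›
    {X : Submodule A M | (∃ Y, IsCompl X Y) ∧ X ≠ ⊤}
    ⟨⊥, ⟨⊤, isCompl_bot_top⟩, bot_ne_top⟩
  refine ⟨X, Y, hc.symm, ?_, fun N N' h => ?_⟩
  · rw [Submodule.nontrivial_iff_ne_bot]
    rintro rfl
    exact hY (eq_top_of_isCompl_bot hc)
  obtain ⟨hdis, hcompl⟩ := disjoint_and_isCompl_of_isCompl hc h
  by_cases htop : Y ⊔ N.map X.subtype = ⊤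
  · right
    rw [htop] at hcompl
    exact eq_bot_of_map_subtype_eq_bot (eq_bot_of_top_isCompl hcompl)
  · exact .inl (eq_bot_of_not_lt_sup hdis (hmax _ ⟨⟨_, hcompl⟩, htop⟩))

/-- Induction over a decomposition of a noetherian module into indecomposable summands. -/
theorem induction_isIndecomposable [IsNoetherian A M] (p : Submodule A M → Prop) (bot : p ⊥)
    (sup : ∀ X Y, p X → p Y → p (X ⊔ Y))
    (indecomposable : ∀ X : Submodule A M, IsIndecomposable A X → p X) : p ⊤ := by
  obtain ⟨Y, ⟨⟨X, hc⟩, hY⟩, hmax⟩ := set_has_maximal_iff_noetherian.mpr ‹IsNoetherian A M›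
    {X : Submodule A M | (∃ Y, IsCompl X Y) ∧ p X} ⟨⊥, ⟨⊤, isCompl_bot_top⟩, bot⟩
  by_cases hX : X = ⊥
  · rw [hX] at hc
    exact eq_top_of_isCompl_bot hc ▸ hY
  have := Submodule.nontrivial_iff_ne_bot.mpr hX
  obtain ⟨N, N', h, hN⟩ := exists_isCompl_isIndecomposable A X
  obtain ⟨hdis, hcompl⟩ := disjoint_and_isCompl_of_isCompl hc h
  have := eq_bot_of_not_lt_sup hdis (hmax _ ⟨⟨_, hcompl⟩, sup _ _ hY (indecomposable _
    (hN.congr (Submodule.equivMapOfInjective _ X.injective_subtype N).symm))⟩)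
  exact absurd this (Submodule.nontrivial_iff_ne_bot.mp hN.1)

end Summand

/-! ### L-injective lattices -/

section LInjective

variable {R A : Type u} [CommRing R] [Ring A] [Algebra R A]

/-- A submodule `X` of an `R`-module is saturated if the quotient by it is torsion free. -/
def IsSaturated (R : Type*) {A N : Type*} [CommRing R] [Ring A] [Algebra R A] [AddCommGroup N]
    [Module R N] [Module A N] (X : Submodule A N) : Prop :=
  ∀ r ∈ nonZeroDivisors R, ∀ n : N, r • n ∈ X → n ∈ X

/-- `I` has the extension property for saturated submodules of lattices.  For a lattice `I` this is
equivalent to L-injectivity; it does not presuppose that `I` is a lattice, and passes to products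
and summands. -/
def HasExtension (R A I : Type u) [CommRing R] [Ring A] [Algebra R A]
    [AddCommGroup I] [Module A I] : Prop :=
  ∀ (N : Type u) [AddCommGroup N] [Module R N] [Module A N] [IsScalarTower R A N],
    IsLattice R N → ∀ X : Submodule A N, IsSaturated R X → ∀ f : X →ₗ[A] I,
      ∃ g : N →ₗ[A] I, ∀ x : X, g x = f x

variable {I J : Type u} [AddCommGroup I] [Module R I] [Module A I] [IsScalarTower R A I]
  [AddCommGroup J] [Module A J]

theorem IsSaturated.isLattice_quotient {N : Type*} [AddCommGroup N] [Module R N] [Module A N]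
    [IsScalarTower R A N] (hN : Module.Finite R N) {X : Submodule A N} (hX : IsSaturated R X) :
    IsLattice R (N ⧸ X) := by
  refine ⟨Module.Finite.of_surjective (X.mkQ.restrictScalars R) X.mkQ_surjective,
    isTorsionFree_iff.mpr fun r hr x hx => ?_⟩
  obtain ⟨n, rfl⟩ := X.mkQ_surjective x
  have hx' : X.mkQ (r • n) = 0 := hx
  rw [Submodule.mkQ_apply, Submodule.Quotient.mk_eq_zero] at hx' ⊢
  exact hX r hr n hx'

/-- L-injectivity gives the extension property: form the pushout of `X → N` along `X → I`; its
quotient by `I` is `N ⧸ X`, so it is a lattice. -/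
theorem IsLInjective.hasExtension (hI : IsLInjective R A I) : HasExtension R A I := by
  intro N _ _ _ _ hN X hX f
  let ρ : X →ₗ[A] I × N := f.prod (-X.subtype)
  let S : Submodule A (I × N) := LinearMap.range ρ
  let i : I →ₗ[A] (I × N) ⧸ S := S.mkQ ∘ₗ LinearMap.inl A I N
  let q : ((I × N) ⧸ S) →ₗ[A] N ⧸ X := S.liftQ (X.mkQ ∘ₗ LinearMap.snd A I N) (by
    rintro _ ⟨x, rfl⟩
    simp [ρ])
  have hS : IsSaturated R S := by
    rintro r hr ⟨c, n⟩ ⟨x, hx⟩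
    obtain ⟨hx1, hx2⟩ := Prod.ext_iff.mp hx
    have hx1 : f x = r • c := hx1
    have hx2 : -(x : N) = r • n := hx2
    have hn : n ∈ X := hX r hr n (hx2 ▸ X.neg_mem x.2)
    have hxn : x = -(r • ⟨n, hn⟩ : X) := Subtype.ext (by
      change (x : N) = -(r • n)
      rw [← hx2, neg_neg])
    refine ⟨-⟨n, hn⟩, Prod.ext ?_ (by simp [ρ])⟩
    refine hI.1.smul_cancel hr ?_
    change r • f _ = r • c
    rw [← hx1, hxn, map_neg, smul_neg, map_neg, LinearMap.map_smul_of_tower f r]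
  have := hI.1.1
  have := hN.1
  have hfin : Module.Finite R (I × N) := inferInstance
  obtain ⟨p, hp⟩ := hI.2 ((I × N) ⧸ S) (N ⧸ X) i q (hS.isLattice_quotient hfin)
    (hX.isLattice_quotient hN.1) (by
      rw [injective_iff_map_eq_zero]
      intro c hc
      obtain ⟨x, hx⟩ := (Submodule.Quotient.mk_eq_zero S).mp hc
      obtain ⟨hx1, hx2⟩ := Prod.ext_iff.mp hx
      have hx0 : x = 0 := Subtype.ext (neg_eq_zero.mp hx2)
      have hx1 : f x = c := hx1
      rw [← hx1, hx0, map_zero]) (by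
      intro y
      obtain ⟨⟨c, n⟩, rfl⟩ := S.mkQ_surjective y
      constructor
      · intro h
        have hn : n ∈ X := (Submodule.Quotient.mk_eq_zero X).mp h
        refine ⟨c + f ⟨n, hn⟩, ?_⟩
        refine (Submodule.Quotient.eq S).mpr ⟨⟨n, hn⟩, ?_⟩
        simp [ρ]
      · rintro ⟨d, hd⟩
        rw [← hd]
        exact (Submodule.Quotient.mk_eq_zero X).mpr X.zero_mem) (by
      intro y
      obtain ⟨n, rfl⟩ := X.mkQ_surjective y
      exact ⟨S.mkQ (0, n), rfl⟩)
  refine ⟨p ∘ₗ S.mkQ ∘ₗ LinearMap.inr A I N, fun x => ?_⟩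
  have h1 : p (i (f x)) = f x := LinearMap.congr_fun hp (f x)
  have h2 : S.mkQ (0, (x : N)) = i (f x) := by
    refine (Submodule.Quotient.eq S).mpr ⟨-x, ?_⟩
    simp [ρ]
  change p (S.mkQ (0, (x : N))) = f x
  rw [h2, h1]

theorem HasExtension.isLInjective (h : HasExtension R A I) (hI : IsLattice R I) :
    IsLInjective R A I := by
  refine ⟨hI, fun N M _ _ _ _ _ _ _ _ i q hN hM hi hiq _ => ?_⟩
  obtain ⟨g, hg⟩ := h N hN (LinearMap.range i) (by
    intro r hr n hn
    rw [← LinearMap.exact_iff.mp hiq, LinearMap.mem_ker] at hn ⊢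
    refine hM.eq_zero hr ?_
    rw [← LinearMap.map_smul_of_tower, hn]) (LinearEquiv.ofInjective i hi).symm.toLinearMap
  refine ⟨g, LinearMap.ext fun x => ?_⟩
  have := hg (LinearEquiv.ofInjective i hi x)
  simpa using this

omit [Module R I] [IsScalarTower R A I] in
theorem HasExtension.of_isSummand (h : HasExtension R A I) (hJ : IsSummand A J I) :
    HasExtension R A J := by
  obtain ⟨i, p, hip⟩ := hJ
  intro N _ _ _ _ hN X hX f
  obtain ⟨g, hg⟩ := h N hN X hX (i ∘ₗ f)
  exact ⟨p ∘ₗ g, fun x => (congrArg p (hg x)).trans (LinearMap.congr_fun hip (f x))⟩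

omit [Module R I] [IsScalarTower R A I] in
theorem HasExtension.fin {r : ℕ} (h : HasExtension R A I) : HasExtension R A (Fin r → I) := by
  intro N _ _ _ _ hN X hX f
  choose g hg using fun i => h N hN X hX (LinearMap.proj i ∘ₗ f)
  exact ⟨LinearMap.pi g, fun x => funext fun i => hg i x⟩

theorem IsSummandOfPow.hasExtension (hJ : IsSummandOfPow A J I) (hI : IsLInjective R A I) :
    HasExtension R A J :=
  let ⟨_, h⟩ := hJ
  hI.hasExtension.fin.of_isSummand h

theorem IsSummandOfPow.isLattice [IsNoetherianRing R] {J : Type*} [AddCommGroup J] [Module A J]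
    [Module R J] [IsScalarTower R A J] (hJ : IsSummandOfPow A J I) (hI : IsLattice R I) :
    IsLattice R J := by
  obtain ⟨r, i, p, h⟩ := hJ
  refine IsLattice.of_injective (.pi fun _ : Fin r => hI) (i.restrictScalars R) ?_
  exact Function.LeftInverse.injective (g := p) fun x => LinearMap.congr_fun h x

/-- A saturated submodule with the extension property is a direct summand. -/
theorem HasExtension.exists_isCompl {N : Type u} [AddCommGroup N] [Module R N] [Module A N]
    [IsScalarTower R A N] (hN : IsLattice R N) {X : Submodule A N} (hX : IsSaturated R X)
    (h : HasExtension R A X) : ∃ Y, IsCompl X Y := by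
  obtain ⟨g, hg⟩ := h N hN X hX LinearMap.id
  exact ⟨_, LinearMap.isCompl_of_proj hg⟩

end LInjective

/-! ### Internal direct sums and projections -/

section Internal

variable {A N ι : Type*} [Ring A] [AddCommGroup N] [Module A N] [Fintype ι] [DecidableEq ι]
  {X : ι → Submodule A N}

theorem exists_projections (hX : DirectSum.IsInternal X) :
    ∃ π : ι → Module.End A N, (∀ k x, π k x ∈ X k) ∧ (∀ x, ∑ k, π k x = x) ∧
      (∀ k, ∀ x ∈ X k, π k x = x) ∧ ∀ k j, j ≠ k → ∀ x ∈ X j, π k x = 0 := by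
  let := hX.chooseDecomposition
  let π : ι → Module.End A N := fun k => (X k).subtype ∘ₗ
    DirectSum.component A ι (fun k => X k) k ∘ₗ (DirectSum.decomposeLinearEquiv X).toLinearMap
  have hmem : ∀ k x, π k x ∈ X k := fun k x => Subtype.prop _
  have hsame : ∀ k, ∀ x ∈ X k, π k x = x := fun k x hx => DirectSum.decompose_of_mem_same X hx
  have hne : ∀ k j, j ≠ k → ∀ x ∈ X j, π k x = 0 := fun k j hjk x hx =>
    DirectSum.decompose_of_mem_ne X hx hjk
  refine ⟨π, hmem, fun x => ?_, hsame, hne⟩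
  have hx : x ∈ iSup X := hX.submodule_iSup_eq_top ▸ Submodule.mem_top
  induction hx using Submodule.iSup_induction' with
  | mem j x hx =>
    rw [Finset.sum_eq_single j (fun k _ hk => hne k j hk.symm x hx) (by simp), hsame j x hx]
  | zero => simp
  | add x y _ _ hx hy => simp only [map_add, Finset.sum_add_distrib, hx, hy]

theorem isInternal_of_projections (π : ι → Module.End A N) (hmem : ∀ k x, π k x ∈ X k)
    (hsum : ∀ x, ∑ k, π k x = x) (hne : ∀ k j, j ≠ k → ∀ x ∈ X j, π k x = 0) :
    DirectSum.IsInternal X := by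
  have hsame : ∀ k, ∀ x ∈ X k, π k x = x := fun k x hx => by
    conv_rhs => rw [← hsum x]
    rw [Finset.sum_eq_single k (fun j _ hj => hne j k hj.symm x hx) (by simp)]
  rw [DirectSum.isInternal_submodule_iff_iSupIndep_and_iSup_eq_top]
  constructor
  · rw [iSupIndep_def]
    intro k
    rw [Submodule.disjoint_def]
    intro x hx hx'
    have h0 : (⨆ j, ⨆ (_ : j ≠ k), X j) ≤ LinearMap.ker (π k) :=
      iSup₂_le fun j hj x hx => hne k j hj x hx
    rw [← hsame k x hx]
    exact h0 hx'
  · rw [eq_top_iff]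
    intro x _
    rw [← hsum x]
    exact Submodule.sum_mem _ fun k _ => Submodule.mem_iSup_of_mem k (hmem k x)

end Internal

/-! ### Consequences of local endomorphism rings -/

section Local

variable {R : Type u} [CommRing R] [IsLocalRing R] [IsNoetherianRing R]
  [IsAdicComplete (IsLocalRing.maximalIdeal R) R]
  {A M N : Type*} [Ring A] [Algebra R A]
  [AddCommGroup M] [Module R M] [Module A M] [IsScalarTower R A M] [Module.Finite R M]
  [AddCommGroup N] [Module A N]

variable (R) in
include R in
theorem IsIndecomposable.exists_isUnit_of_sum (hM : IsIndecomposable A M)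
    {ι : Type*} (s : Finset ι) (f : ι → Module.End A M) (h : IsUnit (∑ i ∈ s, f i)) :
    ∃ i ∈ s, IsUnit (f i) := by
  classical
  induction s using Finset.induction_on with
  | empty =>
    have := hM.1
    have : Nontrivial (Module.End A M) := inferInstance
    exact absurd h (by simp)
  | insert j s hj ih =>
    rw [Finset.sum_insert hj] at h
    obtain ⟨u, hu⟩ := h
    have h1 : 1 - (↑u⁻¹ : Module.End A M) * f j = ↑u⁻¹ * ∑ i ∈ s, f i := by
      have : (↑u⁻¹ : Module.End A M) * ↑u = 1 := u.inv_mul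
      rw [hu, mul_add] at this
      rw [← this, add_sub_cancel_left]
    rcases hM.isUnit_or_isUnit_one_sub (R := R) ((↑u⁻¹ : Module.End A M) * f j) with h | h
    · exact ⟨j, Finset.mem_insert_self _ _, by simpa using h⟩
    · rw [h1, Units.isUnit_units_mul] at h
      obtain ⟨i, hi, h⟩ := ih h
      exact ⟨i, Finset.mem_insert_of_mem hi, h⟩

theorem isSummand_of_isUnit_comp {A M N : Type*} [Ring A] [AddCommGroup M] [Module A M]
    [AddCommGroup N] [Module A N] (p : N →ₗ[A] M) (i : M →ₗ[A] N)
    (h : IsUnit (p ∘ₗ i : Module.End A M)) : IsSummand A M N := by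
  obtain ⟨u, hu⟩ := h
  refine ⟨i, (↑u⁻¹ : Module.End A M) ∘ₗ p, ?_⟩
  rw [LinearMap.comp_assoc, ← hu]
  exact u.inv_mul

variable (R) in
include R in
/-- An indecomposable summand of a finite direct sum is a summand of one of its terms. -/
theorem IsIndecomposable.exists_isSummand (hM : IsIndecomposable A M) {ι : Type*} [Fintype ι]
    [DecidableEq ι] {X : ι → Submodule A N} (hX : DirectSum.IsInternal X) {r : ℕ}
    (h : IsSummand A M (Fin r → N)) : ∃ i, IsSummand A M (X i) := by
  obtain ⟨i, p, hip⟩ := h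
  let f : Fin r → Module.End A M := fun j =>
    (p ∘ₗ LinearMap.single A (fun _ => N) j) ∘ₗ (LinearMap.proj j ∘ₗ i)
  have hf : ∑ j, f j = 1 := by
    ext x
    have h1 := LinearMap.congr_fun hip x
    rw [LinearMap.sum_apply]
    simp only [f, LinearMap.comp_apply, LinearMap.proj_apply, LinearMap.coe_single] at h1 ⊢
    rw [← map_sum, Finset.univ_sum_single, h1]
    rfl
  obtain ⟨j, -, hj⟩ := hM.exists_isUnit_of_sum R Finset.univ f (hf ▸ isUnit_one)
  obtain ⟨i, p, hip⟩ := isSummand_of_isUnit_comp _ _ hj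
  obtain ⟨π, hπ, hsum, -, -⟩ := exists_projections hX
  let g : ι → Module.End A M := fun k =>
    (p ∘ₗ (X k).subtype) ∘ₗ ((π k).codRestrict (X k) (hπ k) ∘ₗ i)
  have hg : ∑ k, g k = 1 := by
    ext x
    rw [LinearMap.sum_apply]
    change ∑ k, p (π k (i x)) = x
    rw [← map_sum, hsum]
    exact LinearMap.congr_fun hip x
  obtain ⟨k, -, hk⟩ := hM.exists_isUnit_of_sum R Finset.univ g (hg ▸ isUnit_one)
  exact ⟨k, isSummand_of_isUnit_comp _ _ hk⟩

end Local

/-! ### Radicals of indecomposable projective modules -/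

section Top

variable {A P : Type*} [Ring A] [AddCommGroup P] [Module A P]

/-- Coordinates in a dual basis map the radical of `P` to the radical of `A`. -/
theorem jacobson_le_jacobson_smul_top [Module.Projective A P] :
    Module.jacobson A P ≤ Ring.jacobson A • (⊤ : Submodule A P) := by
  obtain ⟨s, hs⟩ := Module.projective_def.mp ‹Module.Projective A P›
  intro x hx
  rw [← hs x, Finsupp.linearCombination_apply]
  refine Submodule.sum_mem _ fun p _ => Submodule.smul_mem_smul ?_ Submodule.mem_top
  exact Module.le_comap_jacobson (Finsupp.lapply p ∘ₗ s : P →ₗ[A] A) hx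

variable (R : Type u) [CommRing R] [IsLocalRing R] [IsNoetherianRing R]
  [IsAdicComplete (IsLocalRing.maximalIdeal R) R] [Algebra R A] [Module R P] [IsScalarTower R A P]
  [Module.Finite R P]

include R in
/-- If `X + Y = P`, then the identity of `P` is the sum of a map with image in `Y` and a map with image
in `X`, one of which is invertible. -/
theorem IsIndecomposable.eq_top_or_eq_top (hP : IsIndecomposable A P) [Module.Projective A P]
    {X Y : Submodule A P} (h : X ⊔ Y = ⊤) : X = ⊤ ∨ Y = ⊤ := by
  have hsurj : Function.Surjective (X.mkQ ∘ₗ Y.subtype) := by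
    intro z
    obtain ⟨p, rfl⟩ := X.mkQ_surjective z
    obtain ⟨x, hx, y, hy, rfl⟩ := Submodule.mem_sup.mp (h ▸ Submodule.mem_top : p ∈ X ⊔ Y)
    refine ⟨⟨y, hy⟩, ?_⟩
    change X.mkQ y = X.mkQ (x + y)
    have h0 : X.mkQ x = 0 := (Submodule.Quotient.mk_eq_zero X).mpr hx
    rw [map_add, h0, zero_add]
  obtain ⟨g, hg⟩ := Module.projective_lifting_property (X.mkQ ∘ₗ Y.subtype) X.mkQ hsurj
  rcases hP.isUnit_or_isUnit_one_sub (R := R) (Y.subtype ∘ₗ g) with hu | hu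
  · right
    rw [eq_top_iff]
    intro x _
    obtain ⟨y, rfl⟩ := ((Module.End.isUnit_iff _).mp hu).2 x
    exact (g y).2
  · left
    rw [eq_top_iff]
    intro x _
    obtain ⟨y, rfl⟩ := ((Module.End.isUnit_iff _).mp hu).2 x
    have h1 : X.mkQ (g y) = X.mkQ y := LinearMap.congr_fun hg y
    exact (Submodule.Quotient.eq X).mp h1.symm

include R in
/-- `𝔯P` is the only maximal submodule of an indecomposable projective module `P`. -/
theorem IsIndecomposable.isCoatom_jacobson (hP : IsIndecomposable A P) [Module.Projective A P] :
    IsCoatom (Ring.jacobson A • (⊤ : Submodule A P)) ∧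
      ∀ X : Submodule A P, X ≠ ⊤ → X ≤ Ring.jacobson A • (⊤ : Submodule A P) := by
  have := hP.1
  have : Module.Finite A P := Module.Finite.of_restrictScalars_finite R A P
  obtain ⟨N, hN, -⟩ := (eq_top_or_exists_le_coatom (⊥ : Submodule A P)).resolve_left bot_ne_top
  have hle : ∀ X : Submodule A P, X ≠ ⊤ → X ≤ N := by
    intro X hX
    by_contra hcon
    have : X ⊔ N = ⊤ := hN.2 _ (by rw [sup_comm]; exact left_lt_sup.mpr hcon)
    rcases hP.eq_top_or_eq_top R this with h | h
    exacts [hX h, hN.1 h]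
  have hjac : Module.jacobson A P = N := by
    refine le_antisymm (sInf_le hN) (le_sInf fun N' hN' => ?_)
    exact (hN'.le_iff.mp (hle N' hN'.1)).elim (fun h => absurd h hN.1) (fun h => h.le)
  have heq : Ring.jacobson A • (⊤ : Submodule A P) = N :=
    le_antisymm ((Ring.jacobson_smul_top_le A P).trans_eq hjac)
      (hjac.symm.le.trans jacobson_le_jacobson_smul_top)
  rw [heq]
  exact ⟨hN, hle⟩

variable {V : Type*} [AddCommGroup V] [Module A V] [Module R V] [IsScalarTower R A V]

include R in
/-- `𝔯M` is the largest proper submodule of an indecomposable projective module `M`. -/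
theorem IsIndecomposable.jacobson_smul_covBy {M : Submodule A V} (hM : IsIndecomposable A M)
    [Module.Finite R M] [Module.Projective A M] :
    Ring.jacobson A • M ⋖ M ∧ ∀ X : Submodule A V, X < M → X ≤ Ring.jacobson A • M := by
  obtain ⟨h1, h2⟩ := hM.isCoatom_jacobson R
  have hmap : (Ring.jacobson A • (⊤ : Submodule A M)).map M.subtype = Ring.jacobson A • M := by
    rw [Submodule.map_smul'', Submodule.map_top, Submodule.range_subtype]
  have hle : ∀ X : Submodule A V, X < M → X ≤ Ring.jacobson A • M := by
    intro X hX
    rw [← hmap]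
    have hX' : X.submoduleOf M ≠ ⊤ := fun h => hX.not_ge (Submodule.submoduleOf_eq_top.mp h)
    have := Submodule.map_mono (f := M.subtype) (h2 _ hX')
    rwa [Submodule.submoduleOf, Submodule.map_comap_subtype, inf_eq_right.mpr hX.le] at this
  have hlt : Ring.jacobson A • M < M := by
    refine lt_of_le_of_ne (Submodule.smul_le_right) fun h => h1.1 ?_
    apply Submodule.map_injective_of_injective M.injective_subtype
    rw [hmap, h, Submodule.map_top, Submodule.range_subtype]
  exact ⟨⟨hlt, fun X hX hXM => (hle X hXM).not_gt hX⟩, hle⟩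

end Top

/-! ### Overmodules in a rational space -/

/-- `V` is a module over the total ring of fractions of `R`: regular elements act bijectively. -/
def IsRational (R V : Type*) [CommRing R] [AddCommGroup V] [Module R V] : Prop :=
  ∀ r ∈ nonZeroDivisors R, Function.Bijective fun v : V => r • v

section Over

variable {R A V : Type u} [CommRing R] [Ring A] [Algebra R A]
  [AddCommGroup V] [Module R V] [Module A V] [IsScalarTower R A V]

theorem IsRational.eq_zero (hV : IsRational R V) {r : R} (hr : r ∈ nonZeroDivisors R) {v : V}
    (h : r • v = 0) : v = 0 :=
  (hV r hr).1 (h.trans (smul_zero r).symm)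

theorem IsRational.isLattice (hV : IsRational R V) (M : Submodule A V) (hM : Module.Finite R M) :
    IsLattice R M :=
  ⟨hM, isTorsionFree_iff.mpr fun _ hr _ hx =>
    Subtype.ext (hV.eq_zero hr (congrArg Subtype.val hx))⟩

/-- `N` is an overmodule of `M`: a lattice with `M ⊆ N ⊆ KM`. -/
structure IsOvermodule (R : Type u) {A V : Type u} [CommRing R] [Ring A] [Algebra R A]
    [AddCommGroup V] [Module R V] [Module A V] [IsScalarTower R A V] (M N : Submodule A V) :
    Prop where
  le : M ≤ N
  isLattice : IsLattice R N
  exists_smul_mem : ∀ x ∈ N, ∃ r ∈ nonZeroDivisors R, r • x ∈ M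

theorem IsOvermodule.trans {M N P : Submodule A V} (h : IsOvermodule R M N)
    (h' : IsOvermodule R N P) : IsOvermodule R M P := by
  refine ⟨h.le.trans h'.le, h'.isLattice, fun x hx => ?_⟩
  obtain ⟨r, hr, hrx⟩ := h'.exists_smul_mem x hx
  obtain ⟨s, hs, hsx⟩ := h.exists_smul_mem _ hrx
  exact ⟨s * r, mul_mem hs hr, by rwa [mul_smul]⟩

theorem IsOvermodule.refl {M : Submodule A V} (h : IsLattice R M) : IsOvermodule R M M :=
  ⟨le_rfl, h, fun x hx => ⟨1, one_mem _, by rwa [one_smul]⟩⟩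

theorem IsOvermodule.mono {M N P : Submodule A V} (h : IsOvermodule R M P) (h1 : M ≤ N)
    (h2 : N ≤ P) : IsOvermodule R N P :=
  ⟨h2, h.isLattice, fun x hx => (h.exists_smul_mem x hx).imp fun _ hr => ⟨hr.1, h1 hr.2⟩⟩

theorem IsOvermodule.mono_right [IsNoetherianRing R] {M N P : Submodule A V}
    (h : IsOvermodule R M P) (h1 : M ≤ N) (h2 : N ≤ P) : IsOvermodule R M N :=
  ⟨h1, h.isLattice.of_injective ((Submodule.inclusion h2).restrictScalars R)
    (Submodule.inclusion_injective h2), fun x hx => h.exists_smul_mem x (h2 hx)⟩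

theorem IsOvermodule.exists_forall_smul_mem {M N : Submodule A V} (h : IsOvermodule R M N) :
    ∃ r ∈ nonZeroDivisors R, ∀ x ∈ N, r • x ∈ M := by
  obtain ⟨s, hs⟩ := h.isLattice.1
  choose r hr hrx using fun x : N => h.exists_smul_mem x x.2
  refine ⟨∏ x ∈ s, r x, prod_mem fun x _ => hr x, fun x hx => ?_⟩
  have hx' : (⟨x, hx⟩ : N) ∈ Submodule.span R (s : Set N) := hs ▸ Submodule.mem_top
  suffices hle : Submodule.span R (s : Set N) ≤
      ((M.restrictScalars R).comap ((∏ x ∈ s, r x) • (N.subtype.restrictScalars R))) from hle hx'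
  rw [Submodule.span_le]
  intro y hy
  classical
  change (∏ x ∈ s, r x) • (y : V) ∈ M
  rw [← Finset.prod_erase_mul s r hy, mul_smul]
  exact Submodule.smul_of_tower_mem M _ (hrx y)

/-- A proper overmodule contains a minimal one. -/
theorem IsOvermodule.exists_covBy_le [IsNoetherianRing R] (hdim : ringKrullDim R = 1)
    {M N : Submodule A V} (h : IsOvermodule R M N) (hne : M ≠ N) : ∃ U, M ⋖ U ∧ U ≤ N := by
  obtain ⟨r, hr, hrx⟩ := h.exists_forall_smul_mem
  have := h.isLattice.1
  let M' := M.submoduleOf N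
  have hfin : Module.Finite R (N ⧸ M') :=
    Module.Finite.of_surjective (M'.mkQ.restrictScalars R) M'.mkQ_surjective
  have hart : IsArtinian R (N ⧸ M') := isArtinian_of_smul_eq_zero hdim hr (by
    intro x
    obtain ⟨x, rfl⟩ := M'.mkQ_surjective x
    exact (Submodule.Quotient.mk_eq_zero M').mpr (hrx x x.2))
  have : IsArtinian A (N ⧸ M') := isArtinian_of_tower R hart
  have hlt : M < N := lt_of_le_of_ne h.le hne
  have hnt : (⊤ : Submodule A (N ⧸ M')) ≠ ⊥ := by
    intro h0
    refine hlt.not_ge fun x hx => ?_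
    have : M'.mkQ ⟨x, hx⟩ ∈ (⊥ : Submodule A (N ⧸ M')) := h0 ▸ Submodule.mem_top
    exact (Submodule.Quotient.mk_eq_zero M').mp ((Submodule.mem_bot A).mp this)
  obtain ⟨a, ha, -⟩ := (eq_bot_or_exists_atom_le (⊤ : Submodule A (N ⧸ M'))).resolve_left hnt
  have hcov : M' ⋖ a.comap M'.mkQ := by
    have := (Submodule.comapMkQRelIso M').isAtom_iff a |>.mpr ha
    exact (covBy_iff_atom_Ici (Submodule.le_comap_mkQ M' a)).mpr this
  have hMM' : M'.map N.subtype = M := by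
    change (M.submoduleOf N).map N.subtype = M
    rw [Submodule.submoduleOf, Submodule.map_comap_subtype, inf_eq_right.mpr h.le]
  refine ⟨(a.comap M'.mkQ).map N.subtype, ⟨?_, fun Z hZ hZ' => ?_⟩, Submodule.map_subtype_le _ _⟩
  · conv_lhs => rw [← hMM']
    exact Submodule.map_strictMono_of_injective N.injective_subtype hcov.lt
  · have hZN : Z ≤ N := hZ'.le.trans (Submodule.map_subtype_le _ _)
    have hZmap : (Z.submoduleOf N).map N.subtype = Z := by
      rw [Submodule.submoduleOf, Submodule.map_comap_subtype, inf_eq_right.mpr hZN]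
    refine hcov.2 (c := Z.submoduleOf N) ?_ ?_
    · rw [← Submodule.map_lt_map_iff_of_injective N.injective_subtype, hMM', hZmap]
      exact hZ
    · rw [← Submodule.map_lt_map_iff_of_injective N.injective_subtype, hZmap]
      exact hZ'

variable [IsLocalRing R] [IsNoetherianRing R] [IsAdicComplete (IsLocalRing.maximalIdeal R) R]

omit [IsLocalRing R] [IsAdicComplete (IsLocalRing.maximalIdeal R) R] in
/-- An overmodule of an indecomposable lattice `M` which maps to `M` by a map that is invertible on
`M` coincides with `M`. -/
theorem IsOvermodule.eq_of_isUnit {M X : Submodule A V} (h : IsOvermodule R M X)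
    (p : X →ₗ[A] M) (hp : IsUnit (p ∘ₗ Submodule.inclusion h.le : Module.End A M)) : M = X := by
  obtain ⟨h1, h2⟩ := (Module.End.isUnit_iff _).mp hp
  have hM : IsLattice R M := h.isLattice.of_injective
    ((Submodule.inclusion h.le).restrictScalars R) (Submodule.inclusion_injective h.le)
  have hinj : ∀ x, p x = 0 → x = 0 := by
    intro x hx
    obtain ⟨r, hr, hrx⟩ := h.exists_smul_mem x x.2
    refine h.isLattice.eq_zero hr ?_
    have h3 : (⟨r • (x : V), hrx⟩ : M) = 0 := by
      refine h1 ?_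
      rw [map_zero]
      change p (r • x) = 0
      rw [LinearMap.map_smul_of_tower, hx, smul_zero]
    exact Subtype.ext (congrArg (fun m : M => (m : V)) h3)
  refine le_antisymm h.le fun x hx => ?_
  obtain ⟨m, hm⟩ := h2 (p ⟨x, hx⟩)
  have := hinj (⟨x, hx⟩ - Submodule.inclusion h.le m) (by
    rw [map_sub, sub_eq_zero, ← hm]; rfl)
  have hxm : x = m := congrArg Subtype.val (sub_eq_zero.mp this)
  exact hxm ▸ m.2

/-- A map from an indecomposable L-injective lattice `M` to a lattice either splits or extends to
any minimal overmodule `U`: the saturation of its graph in `U × N` projects onto `M` or onto `U`. -/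
theorem exists_isUnit_or_exists_extension {M U : Submodule A V} (hM : IsIndecomposable A M)
    (hMe : HasExtension R A M) (hU : IsOvermodule R M U) (hcov : M ⋖ U) {N : Type u}
    [AddCommGroup N] [Module R N] [Module A N] [IsScalarTower R A N] (hN : IsLattice R N)
    (φ : M →ₗ[A] N) :
    (∃ q : N →ₗ[A] M, IsUnit (q ∘ₗ φ : Module.End A M)) ∨
      ∃ ψ : U →ₗ[A] N, ∀ m : M, ψ (Submodule.inclusion hU.le m) = φ m := by
  let G : Submodule A (U × N) :=
    { carrier := {x | ∃ r ∈ nonZeroDivisors R, ∃ m : M, r • (x.1 : V) = m ∧ r • x.2 = φ m}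
      add_mem' := by
        rintro x y ⟨r, hr, m, h1, h2⟩ ⟨s, hs, n, h3, h4⟩
        refine ⟨s * r, mul_mem hs hr, s • m + r • n, ?_, ?_⟩
        · change (s * r) • ((x.1 : V) + (y.1 : V)) = s • (m : V) + r • (n : V)
          rw [smul_add, mul_smul, h1, mul_comm, mul_smul, h3]
        · change (s * r) • (x.2 + y.2) = _
          rw [smul_add, mul_smul, h2, mul_comm, mul_smul, h4, map_add,
            LinearMap.map_smul_of_tower, LinearMap.map_smul_of_tower]
      zero_mem' := ⟨1, one_mem _, 0, by simp, by simp⟩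
      smul_mem' := by
        rintro a x ⟨r, hr, m, h1, h2⟩
        refine ⟨r, hr, a • m, ?_, ?_⟩
        · change r • (a • (x.1 : V)) = a • (m : V)
          rw [smul_comm, h1]
        · change r • (a • x.2) = _
          rw [smul_comm, h2, map_smul] }
  have hG : ∀ x, x ∈ G ↔ ∃ r ∈ nonZeroDivisors R, ∃ m : M, r • (x.1 : V) = m ∧ r • x.2 = φ m :=
    fun x => Iff.rfl
  have hMG : ∀ m : M, (Submodule.inclusion hU.le m, φ m) ∈ G := fun m =>
    ⟨1, one_mem _, m, by simp, by simp⟩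
  have hsat : IsSaturated R G := by
    rintro r hr x ⟨s, hs, m, h1, h2⟩
    exact ⟨s * r, mul_mem hs hr, m, by rw [mul_smul]; exact h1, by rw [mul_smul]; exact h2⟩
  let π : G →ₗ[A] U := LinearMap.fst A U N ∘ₗ G.subtype
  have hπ : Function.Injective π := by
    rw [injective_iff_map_eq_zero]
    rintro ⟨⟨u, n⟩, r, hr, m, h1, h2⟩ h0
    have h0 : u = 0 := h0
    subst h0
    have hm : m = 0 := Subtype.ext (by rw [← h1]; simp)
    have hn : n = 0 := hN.eq_zero hr (by rw [h2, hm, map_zero])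
    subst hn
    rfl
  let D : Submodule A V := (LinearMap.range π).map U.subtype
  have hDU : D ≤ U := Submodule.map_subtype_le _ _
  have hMD : M ≤ D := fun m hm => ⟨⟨m, hU.le hm⟩, ⟨⟨_, hMG ⟨m, hm⟩⟩, rfl⟩, rfl⟩
  -- the projection `D` of `G` to `U` is `M` or `U`
  rcases hcov.eq_or_eq hMD hDU with hD | hD
  · -- the first projection `G → M` extends to `U × N`, which writes `1` as a sum in `End M`
    left
    have hfst : ∀ x : G, (x.1.1 : V) ∈ M := fun x => hD ▸ ⟨x.1.1, ⟨x, rfl⟩, rfl⟩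
    let f : G →ₗ[A] M := (U.subtype ∘ₗ π).codRestrict M hfst
    obtain ⟨g, hg⟩ := hMe (U × N) (hU.isLattice.prod hN) G hsat f
    let p : U →ₗ[A] M := g ∘ₗ LinearMap.inl A U N
    let q : N →ₗ[A] M := g ∘ₗ LinearMap.inr A U N
    have hpq : p ∘ₗ Submodule.inclusion hU.le + q ∘ₗ φ = (1 : Module.End A M) := by
      ext1 m
      have h1 := hg ⟨_, hMG m⟩
      have h2 : p (Submodule.inclusion hU.le m) + q (φ m) =
          g (Submodule.inclusion hU.le m, φ m) := by
        change g (_, 0) + g (0, _) = _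
        rw [← map_add, Prod.mk_add_mk, add_zero, zero_add]
        rfl
      exact h2.trans h1
    have hfin : Module.Finite R M := (hU.isLattice.of_injective
      ((Submodule.inclusion hU.le).restrictScalars R) (Submodule.inclusion_injective hU.le)).1
    rcases hM.isUnit_or_isUnit_one_sub (R := R) (q ∘ₗ φ) with h | h
    · exact ⟨q, h⟩
    · rw [← hpq, add_sub_cancel_right] at h
      exact absurd (hU.eq_of_isUnit p h) hcov.lt.ne
  · -- `G` is the graph of an extension
    right
    have hsurj : Function.Surjective π := by
      intro u
      obtain ⟨u', hu', h⟩ : (u : V) ∈ D := by rw [hD]; exact u.2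
      have huu' : u' = u := Subtype.ext h
      exact huu' ▸ hu'
    let e := LinearEquiv.ofBijective π ⟨hπ, hsurj⟩
    refine ⟨LinearMap.snd A U N ∘ₗ G.subtype ∘ₗ e.symm.toLinearMap, fun m => ?_⟩
    have : e.symm (Submodule.inclusion hU.le m) = ⟨_, hMG m⟩ := by
      rw [LinearEquiv.symm_apply_eq]
      rfl
    change (e.symm (Submodule.inclusion hU.le m)).1.2 = φ m
    rw [this]

/-- The inclusion of `M` in a proper overmodule `X` does not split, so it extends to a minimal overmodule
`U`; the extension is again an inclusion. -/
theorem IsOvermodule.le_of_covBy {M U X : Submodule A V} (hM : IsIndecomposable A M)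
    (hMe : HasExtension R A M) (hU : IsOvermodule R M U) (hcov : M ⋖ U)
    (hX : IsOvermodule R M X) (hne : M ≠ X) (hV : IsRational R V) : U ≤ X := by
  rcases exists_isUnit_or_exists_extension hM hMe hU hcov hX.isLattice
    (Submodule.inclusion hX.le) with ⟨q, hq⟩ | ⟨ψ, hψ⟩
  · exact absurd (hX.eq_of_isUnit q hq) hne
  · intro u hu
    obtain ⟨r, hr, hru⟩ := hU.exists_smul_mem u hu
    have h1 : r • ψ ⟨u, hu⟩ = Submodule.inclusion hX.le ⟨r • u, hru⟩ := by
      rw [← hψ, ← LinearMap.map_smul_of_tower]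
      rfl
    have h2 : (ψ ⟨u, hu⟩ : V) = u := (hV r hr).1 (congrArg Subtype.val h1)
    exact h2 ▸ (ψ ⟨u, hu⟩).2

/-- Multiplication by a scalar, as an `A`-linear map. -/
def scalarMul {R : Type u} (A V : Type u) [CommRing R] [Ring A] [Algebra R A] [AddCommGroup V]
    [Module R V] [Module A V] [IsScalarTower R A V] (t : R) : V →ₗ[A] V :=
  t • LinearMap.id

omit [IsLocalRing R] [IsAdicComplete (IsLocalRing.maximalIdeal R) R] in
/-- For a regular `t` the lattice `t⁻¹M` is an overmodule of `M`. -/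
theorem isOvermodule_comap_scalarMul (hV : IsRational R V) {M : Submodule A V}
    (hM : Module.Finite R M) {t : R} (ht : t ∈ nonZeroDivisors R) :
    IsOvermodule R M (M.comap (scalarMul A V t)) := by
  refine ⟨fun m hm => Submodule.smul_of_tower_mem M t hm, ?_, fun x hx => ⟨t, ht, hx⟩⟩
  let f : M.comap (scalarMul A V t) →ₗ[A] M :=
    (scalarMul A V t ∘ₗ Submodule.subtype _).codRestrict M fun x => x.2
  refine (hV.isLattice M hM).of_injective (f.restrictScalars R) fun x y hxy => Subtype.ext ?_
  exact (hV t ht).1 (congrArg Subtype.val hxy)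

omit [IsNoetherianRing R] [IsAdicComplete (IsLocalRing.maximalIdeal R) R] in
/-- For `t` in the maximal ideal `t⁻¹M` is a proper overmodule of `M`, by Nakayama's lemma. -/
theorem ne_comap_scalarMul (hV : IsRational R V) {M : Submodule A V}
    (hM : Module.Finite R M) (hne : M ≠ ⊥) {t : R} (ht : t ∈ nonZeroDivisors R)
    (htm : t ∈ IsLocalRing.maximalIdeal R) : M ≠ M.comap (scalarMul A V t) := by
  intro h
  have h1 := Submodule.eq_bot_of_le_smul_of_le_jacobson_bot (IsLocalRing.maximalIdeal R)
    (⊤ : Submodule R M) hM.1 (by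
      rintro ⟨m, hm⟩ -
      obtain ⟨v, rfl⟩ := (hV t ht).2 m
      have hv : v ∈ M := h ▸ hm
      exact Submodule.smul_mem_smul htm (Submodule.mem_top : (⟨v, hv⟩ : M) ∈ _))
    (IsLocalRing.jacobson_eq_maximalIdeal (⊥ : Ideal R) bot_ne_top).ge
  refine hne ((Submodule.eq_bot_iff M).mpr fun m hm => ?_)
  have : (⟨m, hm⟩ : M) ∈ (⊥ : Submodule R M) := h1 ▸ Submodule.mem_top
  exact congrArg Subtype.val ((Submodule.mem_bot R).mp this)

/-- An indecomposable L-injective lattice `M` in a rational space has a least proper overmodule,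
namely `M^𝔯`. -/
theorem radOver_spec [IsReduced R] (hdim : ringKrullDim R = 1) (hV : IsRational R V)
    {M : Submodule A V} (hM : IsIndecomposable A M) (hfin : Module.Finite R M)
    (hMe : HasExtension R A M) :
    M ⋖ radOver R M ∧ IsOvermodule R M (radOver R M) ∧
      ∀ X, IsOvermodule R M X → M ≠ X → radOver R M ≤ X := by
  obtain ⟨t, htm, ht⟩ := exists_regular_mem_maximalIdeal hdim
  have hX := isOvermodule_comap_scalarMul hV hfin ht
  have hne := ne_comap_scalarMul hV hfin (Submodule.nontrivial_iff_ne_bot.mp hM.1) ht htm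
  obtain ⟨U, hcov, hUX⟩ := hX.exists_covBy_le hdim hne
  have hU : IsOvermodule R M U := hX.mono_right hcov.le hUX
  have heq : radOver R M = U := by
    refine le_antisymm (sSup_le fun N hN => ?_) (le_sSup ⟨hcov, hU.isLattice, hU.exists_smul_mem⟩)
    exact IsOvermodule.le_of_covBy hM hMe ⟨hN.1.le, hN.2.1, hN.2.2⟩ hN.1 hU hcov.lt.ne hV
  rw [heq]
  exact ⟨hcov, hU, fun X hX hne => IsOvermodule.le_of_covBy hM hMe hU hcov hX hne hV⟩

end Over

/-! ### A criterion for hereditary orders -/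

section Hereditary

variable {A : Type*} [Ring A]

/-- If all submodules of `P` are projective, so are all submodules of `Pⁿ`. -/
theorem projective_submodule_pi {P : Type*} [AddCommGroup P] [Module A P]
    (hP : ∀ X : Submodule A P, Module.Projective A X) (n : ℕ) (N : Submodule A (Fin n → P)) :
    Module.Projective A N := by
  induction n with
  | zero => exact Module.Projective.of_free
  | succ n ih =>
    let f : N →ₗ[A] P := LinearMap.proj 0 ∘ₗ N.subtype
    have := hP (LinearMap.range f)
    obtain ⟨g, hg⟩ := Module.projective_lifting_property f.rangeRestrict LinearMap.id
      f.surjective_rangeRestrict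
    let T : (Fin (n + 1) → P) →ₗ[A] (Fin n → P) := LinearMap.funLeft A P Fin.succ
    have hinj : Function.Injective (T ∘ₗ N.subtype ∘ₗ (LinearMap.ker f).subtype) := by
      rw [injective_iff_map_eq_zero]
      rintro ⟨⟨x, hx⟩, hx0⟩ h
      refine Subtype.ext (Subtype.ext (funext fun i => ?_))
      refine Fin.cases ?_ (fun j => ?_) i
      · exact hx0
      · exact congrFun h j
    have hker : Module.Projective A (LinearMap.ker f) := by
      have := ih (LinearMap.range (T ∘ₗ N.subtype ∘ₗ (LinearMap.ker f).subtype))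
      exact .of_equiv (LinearEquiv.ofInjective _ hinj).symm
    let k : N →ₗ[A] LinearMap.ker f :=
      (LinearMap.id - g ∘ₗ f.rangeRestrict).codRestrict _ fun x => by
        have h1 : f.rangeRestrict (g (f.rangeRestrict x)) = f.rangeRestrict x :=
          LinearMap.congr_fun hg _
        rw [LinearMap.mem_ker]
        change f (x - g (f.rangeRestrict x)) = 0
        rw [map_sub, sub_eq_zero]
        exact (congrArg Subtype.val h1).symm
    refine Module.Projective.of_split (k.prod f.rangeRestrict) ((LinearMap.ker f).subtype.coprod g)
      (LinearMap.ext fun x => ?_)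
    change (x - g (f.rangeRestrict x)) + g (f.rangeRestrict x) = x
    exact sub_add_cancel _ _

/-- In a semiprime ring, `x A x = 0` forces `x = 0`. -/
theorem eq_zero_of_forall_mul_mul_eq_zero
    (hA : ∀ I : Ideal A, I.IsTwoSided → (∃ n : ℕ, I ^ n = ⊥) → I = ⊥)
    {x : A} (h : ∀ a : A, x * a * x = 0) : x = 0 := by
  let I : Ideal A := Ideal.span {y | ∃ a b, y = a * x * b}
  have hI : I.IsTwoSided := ⟨fun {y} c hy => by
    induction hy using Submodule.span_induction with
    | mem y hy =>
      obtain ⟨a, b, rfl⟩ := hy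
      exact Ideal.subset_span ⟨a, b * c, mul_assoc _ _ _⟩
    | zero => rw [zero_mul]; exact I.zero_mem
    | add y z _ _ hy hz => rw [add_mul]; exact I.add_mem hy hz
    | smul a y _ hy => rw [smul_eq_mul, mul_assoc]; exact I.mul_mem_left a hy⟩
  have hsq : ∀ y ∈ I, ∀ z ∈ I, y * z = 0 := by
    intro y hy z hz
    induction hy using Submodule.span_induction with
    | mem y hy =>
      obtain ⟨a, b, rfl⟩ := hy
      suffices ∀ c, a * x * c * z = 0 from this b
      induction hz using Submodule.span_induction with
      | mem z hz =>
        obtain ⟨a', b', rfl⟩ := hz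
        intro c
        calc a * x * c * (a' * x * b') = a * (x * (c * a') * x) * b' := by noncomm_ring
          _ = 0 := by rw [h, mul_zero, zero_mul]
      | zero => intro c; rw [mul_zero]
      | add y z _ _ hy hz => intro c; rw [mul_add, hy, hz, add_zero]
      | smul d y _ hy => intro c; rw [smul_eq_mul, ← mul_assoc, mul_assoc (a * x), hy]
    | zero => rw [zero_mul]
    | add y w _ _ hy hw => rw [add_mul, hy, hw, add_zero]
    | smul a y _ hy => rw [smul_eq_mul, mul_assoc, hy, mul_zero]
  have hbot : I = ⊥ := hA I hI ⟨2, by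
    rw [eq_bot_iff, Ideal.IsTwoSided.pow_succ, Submodule.pow_one, Ideal.mul_le]
    intro y hy z hz
    exact (Submodule.mem_bot A).mpr (hsq y hy z hz)⟩
  have hx : x ∈ I := Ideal.subset_span ⟨1, 1, by rw [one_mul, mul_one]⟩
  rw [hbot] at hx
  exact (Submodule.mem_bot A).mp hx

/-- A connected semiprime ring is hereditary if it has a nonzero module, finite over a commutative
base, all of whose submodules are projective: the annihilator of such a module is generated by a
central idempotent, so it vanishes, and `A` embeds in a power of the module. -/
theorem isHereditary_of_projective_submodules {R : Type*} [CommRing R] [Algebra R A]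
    (hA : ∀ I : Ideal A, I.IsTwoSided → (∃ n : ℕ, I ^ n = ⊥) → I = ⊥) (hconn : IsConnectedRing A)
    {P : Type*} [AddCommGroup P] [Module A P] [Module R P] [IsScalarTower R A P]
    [Module.Finite R P] [Nontrivial P] (hP : ∀ X : Submodule A P, Module.Projective A X) :
    IsHereditary A := by
  obtain ⟨n, s, hs⟩ := Module.Finite.exists_fin (R := R) (M := P)
  let ρ : A →ₗ[A] (Fin n → P) := LinearMap.pi fun i => LinearMap.toSpanSingleton A P (s i)
  have hρ : ∀ a, ρ a = 0 ↔ ∀ x : P, a • x = 0 := by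
    intro a
    constructor
    · intro h x
      have hx : x ∈ Submodule.span R (Set.range s) := hs ▸ Submodule.mem_top
      induction hx using Submodule.span_induction with
      | mem x hx =>
        obtain ⟨i, rfl⟩ := hx
        exact congrFun h i
      | zero => exact smul_zero a
      | add x y _ _ hx hy => rw [smul_add, hx, hy, add_zero]
      | smul r x _ hx => rw [smul_comm, hx, smul_zero]
    · intro h
      exact funext fun i => h (s i)
  have hproj : Module.Projective A (LinearMap.range ρ) := projective_submodule_pi hP n _
  obtain ⟨g, hg⟩ := Module.projective_lifting_property ρ.rangeRestrict LinearMap.id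
    ρ.surjective_rangeRestrict
  -- `1 - f` is the component of `1` in a complement of the annihilator
  set f : A := 1 - g (ρ.rangeRestrict 1) with hf
  have hsub : ∀ a, a * (1 - f) = g (ρ.rangeRestrict a) := by
    intro a
    rw [hf, sub_sub_cancel, ← smul_eq_mul, ← map_smul, ← map_smul, smul_eq_mul, mul_one]
  have hann : ∀ a, (∀ x : P, a • x = 0) ↔ a * f = a := by
    intro a
    have h1 := hsub a
    rw [mul_sub, mul_one] at h1
    constructor
    · intro h
      have h2 : ρ.rangeRestrict a = 0 := Subtype.ext ((hρ a).mpr h)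
      rw [h2, map_zero, sub_eq_zero] at h1
      exact h1.symm
    · intro h
      rw [h, sub_self] at h1
      have h2 : ρ.rangeRestrict (g (ρ.rangeRestrict a)) = ρ.rangeRestrict a :=
        LinearMap.congr_fun hg _
      rw [← h1, map_zero] at h2
      exact (hρ a).mp (congrArg Subtype.val h2).symm
  have hρf : ∀ x : P, f • x = 0 := by
    refine (hρ f).mp ?_
    have h2 : ρ.rangeRestrict (g (ρ.rangeRestrict 1)) = ρ.rangeRestrict 1 :=
      LinearMap.congr_fun hg _
    have : ρ.rangeRestrict f = 0 := by rw [hf, map_sub, h2, sub_self]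
    exact congrArg Subtype.val this
  have hidem : f * f = f := (hann f).mp hρf
  have hfa : ∀ a, f * a * f = f * a := fun a => (hann _).mp fun x => by
    rw [mul_smul, hρf]
  have haf : ∀ a, f * a * f = a * f := by
    intro a
    have h0 : (1 - f) * a * f = 0 := by
      refine eq_zero_of_forall_mul_mul_eq_zero hA fun b => ?_
      have h1 : f * b * (1 - f) = 0 := by rw [mul_sub, mul_one, hfa, sub_self]
      calc (1 - f) * a * f * b * ((1 - f) * a * f)
          = (1 - f) * a * (f * b * (1 - f)) * (a * f) := by noncomm_ring
        _ = 0 := by rw [h1, mul_zero, zero_mul]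
    rw [sub_mul, sub_mul, one_mul, sub_eq_zero] at h0
    exact h0.symm
  have hf0 : f = 0 := by
    refine (hconn.2 f hidem fun a => by rw [← hfa, haf]).resolve_right fun h1 => ?_
    obtain ⟨x, hx⟩ := exists_ne (0 : P)
    exact hx (by rw [← hρf x, h1, one_smul])
  have hinj : Function.Injective ρ := by
    rw [injective_iff_map_eq_zero]
    intro a ha
    rw [hρ, hann, hf0, mul_zero] at ha
    exact ha.symm
  intro I
  have hI := projective_submodule_pi hP n (Submodule.map ρ I)
  exact .of_equiv (Submodule.equivMapOfInjective ρ hinj I).symm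

end Hereditary

/-! ### Neighbours of an indecomposable bijective lattice -/

section Neighbours

variable {R A V : Type u} [CommRing R] [IsLocalRing R] [IsNoetherianRing R]
  [IsAdicComplete (IsLocalRing.maximalIdeal R) R] [Ring A] [Algebra R A]
  [AddCommGroup V] [Module R V] [Module A V] [IsScalarTower R A V]

omit [IsNoetherianRing R] [IsAdicComplete (IsLocalRing.maximalIdeal R) R] in
/-- The maximal ideal of `R` lies in `rad A`: it kills the simple `A`-modules by Nakayama's lemma. -/
theorem algebraMap_mem_jacobson [Module.Finite R A] {t : R} (ht : t ∈ IsLocalRing.maximalIdeal R) :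
    algebraMap R A t ∈ Ring.jacobson A := by
  rw [Ring.jacobson_eq_sInf_isMaximal, Submodule.mem_sInf]
  intro L hL
  have hL : Ideal.IsMaximal L := hL
  by_contra htL
  have hsup : L ⊔ Ideal.span {algebraMap R A t} = ⊤ := by
    refine hL.1.2 _ (left_lt_sup.mpr fun h => htL (h (Ideal.mem_span_singleton_self _)))
  obtain ⟨l, hl, y, hy, hly⟩ := Submodule.mem_sup.mp (hsup ▸ Submodule.mem_top : (1 : A) ∈ _)
  obtain ⟨a, rfl⟩ := Ideal.mem_span_singleton'.mp hy
  have hfin : Module.Finite R (A ⧸ L) :=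
    Module.Finite.of_surjective ((Submodule.mkQ L).restrictScalars R) (Submodule.mkQ_surjective L)
  have h1 := Submodule.eq_bot_of_le_smul_of_le_jacobson_bot (IsLocalRing.maximalIdeal R)
    (⊤ : Submodule R (A ⧸ L)) hfin.1 (by
      intro x _
      obtain ⟨b, rfl⟩ := Submodule.mkQ_surjective L x
      have hb : b = b * l + t • (b * a) := by
        rw [Algebra.smul_def, Algebra.commutes, mul_assoc, ← mul_add, hly, mul_one]
      have h2 : Submodule.mkQ L b = t • Submodule.mkQ L (b * a) := by
        conv_lhs => rw [hb]
        have h3 : Submodule.mkQ L (b * l) = 0 :=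
          (Submodule.Quotient.mk_eq_zero L).mpr (Ideal.mul_mem_left L b hl)
        rw [map_add, h3, zero_add]
        rfl
      rw [h2]
      exact Submodule.smul_mem_smul ht Submodule.mem_top)
    (IsLocalRing.jacobson_eq_maximalIdeal (⊥ : Ideal R) bot_ne_top).ge
  have h4 : Submodule.mkQ L 1 ∈ (⊥ : Submodule R (A ⧸ L)) := h1 ▸ Submodule.mem_top
  exact hL.ne_top ((Ideal.eq_top_iff_one L).mpr
    ((Submodule.Quotient.mk_eq_zero L).mp ((Submodule.mem_bot R).mp h4)))

omit [IsAdicComplete (IsLocalRing.maximalIdeal R) R] in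
theorem isOvermodule_jacobson_smul [Module.Finite R A] [IsReduced R] (hdim : ringKrullDim R = 1)
    {M : Submodule A V} (hM : IsLattice R M) : IsOvermodule R (Ring.jacobson A • M) M := by
  obtain ⟨t, htm, ht⟩ := exists_regular_mem_maximalIdeal hdim
  refine ⟨Submodule.smul_le_right, hM, fun x hx => ⟨t, ht, ?_⟩⟩
  rw [← algebraMap_smul A t x]
  exact Submodule.smul_mem_smul (algebraMap_mem_jacobson htm) hx

/-- Indecomposability of a submodule `M` of `V`, in terms of submodules of `V`. -/
theorem isIndecomposable_iff {M : Submodule A V} : IsIndecomposable A M ↔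
    M ≠ ⊥ ∧ ∀ X Y : Submodule A V, X ⊔ Y = M → Disjoint X Y → X = ⊥ ∨ Y = ⊥ := by
  have hsub : ∀ X : Submodule A V, X ≤ M → (X.submoduleOf M).map M.subtype = X := fun X hX => by
    rw [Submodule.submoduleOf, Submodule.map_comap_subtype, inf_eq_right.mpr hX]
  rw [IsIndecomposable, Submodule.nontrivial_iff_ne_bot]
  refine and_congr_right fun _ => ⟨fun h X Y hXY hdis => ?_, fun h X Y hXY => ?_⟩
  · have hX := hsub X (hXY ▸ le_sup_left)
    have hY := hsub Y (hXY ▸ le_sup_right)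
    have := h (X.submoduleOf M) (Y.submoduleOf M) ⟨?_, ?_⟩
    · rcases this with h | h
      · exact .inl (by rw [← hX, h, Submodule.map_bot])
      · exact .inr (by rw [← hY, h, Submodule.map_bot])
    · refine disjoint_iff.mpr (eq_bot_of_map_subtype_eq_bot ?_)
      rw [Submodule.map_inf _ M.injective_subtype, hX, hY, hdis.eq_bot]
    · refine codisjoint_iff.mpr (Submodule.map_injective_of_injective M.injective_subtype ?_)
      rw [Submodule.map_sup, hX, hY, hXY, Submodule.map_subtype_top]
  · refine (h (X.map M.subtype) (Y.map M.subtype) ?_ ?_).imp eq_bot_of_map_subtype_eq_bot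
      eq_bot_of_map_subtype_eq_bot
    · rw [← Submodule.map_sup, hXY.sup_eq_top, Submodule.map_subtype_top]
    · exact Submodule.disjoint_map M.injective_subtype hXY.disjoint

omit [IsLocalRing R] [IsNoetherianRing R] [IsAdicComplete (IsLocalRing.maximalIdeal R) R] in
/-- Let `N` be a maximal submodule of an indecomposable lattice `M` with torsion quotient.  If `N`
has a nonzero L-injective summand `X`, then `X = N`: otherwise `M ∩ KX` or `X` splits off `M`. -/
theorem eq_bot_of_isCompl_of_covBy {N M : Submodule A V} (hM : IsIndecomposable A M)
    (h : IsOvermodule R N M) (hcov : N ⋖ M) (hV : IsRational R V) {X Y : Submodule A N}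
    (hXY : IsCompl X Y) (hX : HasExtension R A X) (hX0 : X ≠ ⊥) : Y = ⊥ := by
  rw [isIndecomposable_iff] at hM
  set X' := X.map N.subtype with hX'
  set Y' := Y.map N.subtype with hY'
  have hsup : X' ⊔ Y' = N := by
    rw [hX', hY', ← Submodule.map_sup, hXY.sup_eq_top, Submodule.map_subtype_top]
  have hdis : Disjoint X' Y' := Submodule.disjoint_map N.injective_subtype hXY.disjoint
  have hXN : X' ≤ N := Submodule.map_subtype_le _ _
  have hX0' : X' ≠ ⊥ := fun h0 => hX0 (eq_bot_of_map_subtype_eq_bot h0)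
  refine eq_bot_of_map_subtype_eq_bot (?_ : Y' = ⊥)
  -- the saturation of `X` in `M`
  let S : Submodule A V :=
    { carrier := {x | x ∈ M ∧ ∃ r ∈ nonZeroDivisors R, r • x ∈ X'}
      add_mem' := by
        rintro x y ⟨hx, r, hr, hrx⟩ ⟨hy, s, hs, hsy⟩
        refine ⟨M.add_mem hx hy, s * r, mul_mem hs hr, ?_⟩
        rw [smul_add, mul_smul, mul_comm, mul_smul]
        exact X'.add_mem (X'.smul_of_tower_mem s hrx) (X'.smul_of_tower_mem r hsy)
      zero_mem' := ⟨M.zero_mem, 1, one_mem _, by rw [smul_zero]; exact X'.zero_mem⟩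
      smul_mem' := by
        rintro a x ⟨hx, r, hr, hrx⟩
        exact ⟨M.smul_mem a hx, r, hr, by rw [smul_comm]; exact X'.smul_mem a hrx⟩ }
  have hXS : X' ≤ S := fun x hx => ⟨h.le (hXN hx), 1, one_mem _, by rwa [one_smul]⟩
  have hSM : S ≤ M := fun x hx => hx.1
  have hSY : Disjoint S Y' := by
    rw [Submodule.disjoint_def]
    rintro x ⟨-, r, hr, hrx⟩ hxY
    exact hV.eq_zero hr (Submodule.disjoint_def.mp hdis _ hrx (Y'.smul_of_tower_mem r hxY))
  by_cases hSN : S ≤ N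
  · exfalso
    have hSX : S = X' := by
      refine le_antisymm (fun x hx => ?_) hXS
      obtain ⟨y, hy, z, hz, rfl⟩ := Submodule.mem_sup.mp (hsup.symm ▸ hSN hx : x ∈ X' ⊔ Y')
      have hzS : z ∈ S := by simpa using S.sub_mem hx (hXS hy)
      rw [Submodule.disjoint_def.mp hSY z hzS hz, add_zero]
      exact hy
    have hXM : X' ≤ M := hXN.trans h.le
    have hsat : IsSaturated R (X'.submoduleOf M) := by
      intro r hr n hn
      have : (n : V) ∈ S := ⟨n.2, r, hr, hn⟩
      rwa [hSX] at this
    have e : X'.submoduleOf M ≃ₗ[A] X := (Submodule.submoduleOfEquivOfLe hXM).trans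
      (Submodule.equivMapOfInjective _ N.injective_subtype X).symm
    obtain ⟨Z, hZ⟩ := HasExtension.exists_isCompl h.isLattice hsat
      (hX.of_isSummand (.of_linearEquiv e))
    have hmap : (X'.submoduleOf M).map M.subtype = X' := by
      rw [Submodule.submoduleOf, Submodule.map_comap_subtype, inf_eq_right.mpr hXM]
    have hsup' : X' ⊔ Z.map M.subtype = M := by
      rw [← hmap, ← Submodule.map_sup, hZ.sup_eq_top, Submodule.map_subtype_top]
    have hdis' : Disjoint X' (Z.map M.subtype) := by
      rw [← hmap]
      exact Submodule.disjoint_map M.injective_subtype hZ.disjoint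
    have hZ0 := (hM.2 _ _ hsup' hdis').resolve_left hX0'
    rw [hZ0, sup_bot_eq] at hsup'
    exact hcov.lt.not_ge (hsup' ▸ hXN)
  · have hSN' : S ⊔ N = M := by
      refine (hcov.eq_or_eq le_sup_right (sup_le hSM h.le)).resolve_left fun h1 => hSN ?_
      exact h1 ▸ le_sup_left
    have hSY' : S ⊔ Y' = M := by
      rw [← hSN', ← hsup, ← sup_assoc, sup_eq_left.mpr hXS]
    refine (hM.2 S Y' hSY' hSY).resolve_left fun h0 => hX0' ?_
    exact le_bot_iff.mp (h0 ▸ hXS)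

omit [IsLocalRing R] [IsNoetherianRing R] [IsAdicComplete (IsLocalRing.maximalIdeal R) R] in
/-- Let `U` be a minimal overmodule of an indecomposable lattice `M`.  If `U` has a nonzero
projective summand `X`, then `X = U`: otherwise `X` or its complement splits off `M`. -/
theorem eq_bot_of_isCompl_of_covBy_of_projective {M U : Submodule A V} (hM : IsIndecomposable A M)
    (h : IsOvermodule R M U) (hcov : M ⋖ U) {X Y : Submodule A U}
    (hXY : IsCompl X Y) [Module.Projective A X] (hX0 : X ≠ ⊥) : Y = ⊥ := by
  let p : U →ₗ[A] X := X.projectionOnto Y hXY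
  have hpX : ∀ x : X, p x = x := fun x => Submodule.projectionOnto_apply_left hXY x
  have hpY : ∀ y, p y = 0 ↔ y ∈ Y := fun y => Submodule.projectionOnto_apply_eq_zero_iff hXY
  let f : M →ₗ[A] X := p ∘ₗ Submodule.inclusion h.le
  have htors : ∀ u : U, ∃ r ∈ nonZeroDivisors R, ∃ m : M, r • u = Submodule.inclusion h.le m := by
    intro u
    obtain ⟨r, hr, hru⟩ := h.exists_smul_mem u u.2
    exact ⟨r, hr, ⟨_, hru⟩, rfl⟩
  by_cases hf : Function.Surjective f
  · obtain ⟨g, hg⟩ := Module.projective_lifting_property f LinearMap.id hf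
    have hcompl : IsCompl (LinearMap.range g) (LinearMap.ker f) := isCompl_range_ker hg
    rcases hM.2 _ _ hcompl with h0 | h0
    · exfalso
      rw [LinearMap.range_eq_bot] at h0
      refine hX0 ((Submodule.eq_bot_iff X).mpr fun x hx => ?_)
      have h1 : f (g ⟨x, hx⟩) = ⟨x, hx⟩ := LinearMap.congr_fun hg _
      rw [h0, LinearMap.zero_apply, map_zero] at h1
      exact congrArg Subtype.val h1.symm
    · refine (Submodule.eq_bot_iff Y).mpr fun y hy => ?_
      obtain ⟨r, hr, m, hm⟩ := htors y
      have hfm : f m = 0 := by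
        change p (Submodule.inclusion h.le m) = 0
        rw [← hm, LinearMap.map_smul_of_tower, (hpY y).mpr hy, smul_zero]
      have hm0 : m = 0 := LinearMap.ker_eq_bot'.mp h0 m hfm
      refine h.isLattice.eq_zero hr ?_
      rw [hm, hm0, map_zero]
  · let D : Submodule A V := ((LinearMap.range f).comap p).map U.subtype
    have hMD : M ≤ D := fun m hm => ⟨⟨m, h.le hm⟩, ⟨⟨m, hm⟩, rfl⟩, rfl⟩
    have hD : D = M := by
      refine (hcov.eq_or_eq hMD (Submodule.map_subtype_le _ _)).resolve_right fun hDU => hf ?_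
      intro x
      obtain ⟨u, hu, hux⟩ : ((x : U) : V) ∈ D := by rw [hDU]; exact (x : U).2
      have hux : u = x := Subtype.ext hux
      have hu : p u ∈ LinearMap.range f := hu
      rw [hux, hpX] at hu
      exact hu
    have hmem : ∀ u : U, p u ∈ LinearMap.range f → (u : V) ∈ M := fun u hu =>
      hD ▸ ⟨u, hu, rfl⟩
    have hYM : ∀ y ∈ Y, (y : V) ∈ M := fun y hy =>
      hmem y (by rw [(hpY y).mpr hy]; exact Submodule.zero_mem _)
    let X₁ : Submodule A M := X.comap (Submodule.inclusion h.le)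
    have hcompl : IsCompl X₁ (LinearMap.ker f) := by
      constructor
      · rw [Submodule.disjoint_def]
        intro m hm hfm
        have h1 : p (Submodule.inclusion h.le m) = 0 := hfm
        rw [hpX ⟨_, hm⟩] at h1
        exact Submodule.inclusion_injective h.le (congrArg Subtype.val h1)
      · rw [codisjoint_iff, eq_top_iff]
        intro m _
        have hfm : (((f m : X) : U) : V) ∈ M := hmem _ (by rw [hpX]; exact ⟨m, rfl⟩)
        refine Submodule.mem_sup.mpr ⟨⟨_, hfm⟩, (f m).2, m - ⟨_, hfm⟩, ?_, add_sub_cancel _ _⟩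
        rw [LinearMap.mem_ker, map_sub, sub_eq_zero]
        exact (hpX (f m)).symm
    rcases hM.2 _ _ hcompl with h0 | h0
    · exfalso
      refine hX0 ((Submodule.eq_bot_iff X).mpr fun x hx => ?_)
      obtain ⟨r, hr, m, hm⟩ := htors x
      have hm1 : m ∈ X₁ := by
        change Submodule.inclusion h.le m ∈ X
        rw [← hm]
        exact X.smul_of_tower_mem r hx
      rw [h0, Submodule.mem_bot] at hm1
      refine h.isLattice.eq_zero hr ?_
      rw [hm, hm1, map_zero]
    · refine (Submodule.eq_bot_iff Y).mpr fun y hy => ?_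
      have : (⟨y, hYM y hy⟩ : M) ∈ LinearMap.ker f := (hpY y).mpr hy
      rw [h0, Submodule.mem_bot] at this
      exact Subtype.ext (congrArg (fun m : M => (m : V)) this)

end Neighbours

/-! ### Links -/

section Members

/-- `M` is an indecomposable direct summand of copies of `B`. -/
structure IsMember (B : Type u) {A V : Type u} [Ring A] [AddCommGroup B] [Module A B]
    [AddCommGroup V] [Module A V] (M : Submodule A V) : Prop where
  indecomposable : IsIndecomposable A M
  summand : IsSummandOfPow A M B

variable {R A V B : Type u} [CommRing R] [IsLocalRing R] [IsNoetherianRing R] [IsReduced R]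
  [IsAdicComplete (IsLocalRing.maximalIdeal R) R] [Ring A] [Algebra R A]
  [AddCommGroup V] [Module R V] [Module A V] [IsScalarTower R A V]
  [AddCommGroup B] [Module R B] [Module A B] [IsScalarTower R A B]
  {M : Submodule A V}

omit [IsLocalRing R] [IsReduced R] [IsAdicComplete (IsLocalRing.maximalIdeal R) R] in
theorem IsMember.finite (hB : IsBijective R A B) (hM : IsMember B M) : Module.Finite R M :=
  (hM.summand.isLattice hB.2.1).1

omit [IsLocalRing R] [IsNoetherianRing R] [IsReduced R]
  [IsAdicComplete (IsLocalRing.maximalIdeal R) R] [Module R V] [IsScalarTower R A V] in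
theorem IsMember.projective (hB : IsBijective R A B) (hM : IsMember B M) : Module.Projective A M :=
  have := hB.1
  hM.summand.projective

theorem IsMember.radOver_spec (hdim : ringKrullDim R = 1) (hV : IsRational R V)
    (hB : IsBijective R A B) (hM : IsMember B M) :
    M ⋖ radOver R M ∧ IsOvermodule R M (radOver R M) ∧
      ∀ X, IsOvermodule R M X → M ≠ X → radOver R M ≤ X :=
  RejectionOrders.radOver_spec hdim hV hM.indecomposable (hM.finite hB)
    (hM.summand.hasExtension hB.2)

omit [IsReduced R] in
theorem IsMember.jacobson_smul_covBy (hB : IsBijective R A B) (hM : IsMember B M) :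
    Ring.jacobson A • M ⋖ M ∧ ∀ X : Submodule A V, X < M → X ≤ Ring.jacobson A • M :=
  have := hM.finite hB
  have := hM.projective hB
  hM.indecomposable.jacobson_smul_covBy R

omit [IsLocalRing R] [IsNoetherianRing R] [IsReduced R]
  [IsAdicComplete (IsLocalRing.maximalIdeal R) R] in
theorem IsOvermodule.ne_bot {N : Submodule A V} (h : IsOvermodule R N M) (hV : IsRational R V)
    (hM : M ≠ ⊥) : N ≠ ⊥ := by
  rintro rfl
  refine hM ((Submodule.eq_bot_iff M).mpr fun x hx => ?_)
  obtain ⟨r, hr, hrx⟩ := h.exists_smul_mem x hx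
  exact hV.eq_zero hr ((Submodule.mem_bot A).mp hrx)

omit [IsAdicComplete (IsLocalRing.maximalIdeal R) R] in
theorem IsMember.isOvermodule_jacobson_smul [Module.Finite R A] (hdim : ringKrullDim R = 1)
    (hB : IsBijective R A B) (hM : IsMember B M) : IsOvermodule R (Ring.jacobson A • M) M :=
  RejectionOrders.isOvermodule_jacobson_smul hdim (hM.summand.isLattice hB.2.1)

/-- A step down from a member of a link: if `𝔯M` is a summand of copies of `B`, then it is
indecomposable, and the step up from it leads back to `M`. -/
theorem IsMember.jacobson_smul [Module.Finite R A] (hdim : ringKrullDim R = 1)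
    (hV : IsRational R V) (hB : IsBijective R A B) (hM : IsMember B M)
    (h : IsSummandOfPow A ↥(Ring.jacobson A • M) B) :
    IsMember B (Ring.jacobson A • M) ∧ radOver R (Ring.jacobson A • M) = M := by
  have hover := hM.isOvermodule_jacobson_smul hdim hB
  have hcov := (hM.jacobson_smul_covBy hB).1
  have hmem : IsMember B (Ring.jacobson A • M) := by
    refine ⟨⟨Submodule.nontrivial_iff_ne_bot.mpr (hover.ne_bot hV
      (Submodule.nontrivial_iff_ne_bot.mp hM.indecomposable.1)), fun X Y hXY => ?_⟩, h⟩
    by_cases hX : X = ⊥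
    · exact .inl hX
    · exact .inr (eq_bot_of_isCompl_of_covBy hM.indecomposable hover hcov hV hXY
        ((IsSummandOfPow.of_isSummand (.of_isCompl hXY) h).hasExtension hB.2) hX)
  obtain ⟨h1, h2, h3⟩ := hmem.radOver_spec hdim hV hB
  exact ⟨hmem, ((hcov.eq_or_eq h2.le (h3 M hover hcov.lt.ne)).resolve_left h1.lt.ne')⟩

/-- Below the last member of a link there are no summands from `B`. -/
theorem IsMember.hasNoSummand_jacobson_smul [Module.Finite R A] (hdim : ringKrullDim R = 1)
    (hV : IsRational R V) (hB : IsBijective R A B) (hM : IsMember B M)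
    (h : ¬ IsSummandOfPow A ↥(Ring.jacobson A • M) B) :
    HasNoSummand A B ↥(Ring.jacobson A • M) := by
  intro X Y hXY hX
  by_contra hX0
  have hY := eq_bot_of_isCompl_of_covBy hM.indecomposable
    (hM.isOvermodule_jacobson_smul hdim hB) (hM.jacobson_smul_covBy hB).1 hV hXY
    (hX.hasExtension hB.2) hX0
  rw [hY] at hXY
  obtain rfl := eq_top_of_isCompl_bot hXY
  exact h (.congr Submodule.topEquiv.symm hX)

/-- A step up from a member of a link: if `M^𝔯` is a summand of copies of `B`, then it is
indecomposable, and the step down from it leads back to `M`. -/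
theorem IsMember.radOver (hdim : ringKrullDim R = 1)
    (hV : IsRational R V) (hB : IsBijective R A B) (hM : IsMember B M)
    (h : IsSummandOfPow A ↥(radOver R M) B) :
    IsMember B (radOver R M) ∧ Ring.jacobson A • radOver R M = M := by
  obtain ⟨h1, h2, h3⟩ := hM.radOver_spec hdim hV hB
  have hM0 := Submodule.nontrivial_iff_ne_bot.mp hM.indecomposable.1
  have hmem : IsMember B (RejectionOrders.radOver R M) := by
    refine ⟨⟨Submodule.nontrivial_iff_ne_bot.mpr fun h0 => hM0 (le_bot_iff.mp (h0 ▸ h2.le)),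
      fun X Y hXY => ?_⟩, h⟩
    by_cases hX : X = ⊥
    · exact .inl hX
    · have := hB.1
      have : Module.Projective A X :=
        (IsSummandOfPow.of_isSummand (.of_isCompl hXY) h).projective
      exact .inr (eq_bot_of_isCompl_of_covBy_of_projective hM.indecomposable h2 h1 hXY hX)
  obtain ⟨h4, h5⟩ := hmem.jacobson_smul_covBy hB
  exact ⟨hmem, (h1.eq_or_eq (h5 M h1.lt) h4.le).resolve_right h4.lt.ne⟩

/-- Above the first member of a link there are no summands from `B`. -/
theorem IsMember.hasNoSummand_radOver (hdim : ringKrullDim R = 1)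
    (hV : IsRational R V) (hB : IsBijective R A B) (hM : IsMember B M)
    (h : ¬ IsSummandOfPow A ↥(RejectionOrders.radOver R M) B) :
    HasNoSummand A B ↥(RejectionOrders.radOver R M) := by
  obtain ⟨h1, h2, h3⟩ := hM.radOver_spec hdim hV hB
  intro X Y hXY hX
  by_contra hX0
  have := hB.1
  have := hX.projective
  have hY := eq_bot_of_isCompl_of_covBy_of_projective hM.indecomposable h2 h1 hXY hX0
  rw [hY] at hXY
  obtain rfl := eq_top_of_isCompl_bot hXY
  exact h (.congr Submodule.topEquiv.symm hX)

/-- Maps from `M` to lattices without summands from `B` extend to `M^𝔯`. -/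
theorem IsMember.exists_extension (hdim : ringKrullDim R = 1) (hV : IsRational R V)
    (hB : IsBijective R A B) (hM : IsMember B M) {N : Type u} [AddCommGroup N] [Module R N]
    [Module A N] [IsScalarTower R A N] (hN : IsLattice R N) (hNB : HasNoSummand A B N)
    (φ : M →ₗ[A] N) (h : M ≤ RejectionOrders.radOver R M) :
    ∃ ψ : RejectionOrders.radOver R M →ₗ[A] N, ∀ m : M, ψ (Submodule.inclusion h m) = φ m := by
  obtain ⟨h1, h2, -⟩ := hM.radOver_spec hdim hV hB
  refine (exists_isUnit_or_exists_extension hM.indecomposable (hM.summand.hasExtension hB.2) h2 h1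
    hN φ).resolve_left ?_
  rintro ⟨q, hq⟩
  have := hM.indecomposable.1
  exact not_subsingleton M (hNB.subsingleton_of_isSummand (isSummand_of_isUnit_comp _ _ hq)
    hM.summand)

/-! ### Links are finite -/

omit [IsReduced R] in
/-- If all `𝔯ⁿM` are summands of copies of `B`, then every submodule of `M` that does not lie in all
of them is one of them. -/
theorem IsMember.eq_iterate (hB : IsBijective R A B)
    (hM : ∀ n, IsMember B ((Ring.jacobson A • · : Submodule A V → _)^[n] M)) {Z : Submodule A V}
    (hZ : Z ≤ M) (hZ' : ∃ n, ¬ Z ≤ (Ring.jacobson A • · : Submodule A V → _)^[n] M) :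
    ∃ n, Z = (Ring.jacobson A • · : Submodule A V → _)^[n] M := by
  classical
  obtain ⟨k, hk⟩ : ∃ k, Nat.find hZ' = k + 1 := Nat.exists_eq_succ_of_ne_zero fun h0 =>
    Nat.find_spec hZ' (by rw [h0]; exact hZ)
  have h1 := Nat.find_spec hZ'
  have h2 : Z ≤ (Ring.jacobson A • · : Submodule A V → _)^[k] M :=
    not_not.mp (Nat.find_min hZ' (by rw [hk]; exact Nat.lt_succ_self k))
  rw [hk, Function.iterate_succ_apply'] at h1
  refine ⟨k, h2.eq_of_not_lt fun hlt => h1 (((hM k).jacobson_smul_covBy hB).2 Z hlt)⟩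

omit [IsLocalRing R] [IsNoetherianRing R] [IsReduced R]
  [IsAdicComplete (IsLocalRing.maximalIdeal R) R] in
theorem map_scalarMul_jacobson_smul (t : R) (M : Submodule A V) :
    (Ring.jacobson A • M).map (scalarMul A V t) = Ring.jacobson A • M.map (scalarMul A V t) :=
  Submodule.map_smul'' _ _ _

omit [IsLocalRing R] [IsNoetherianRing R] [IsReduced R]
  [IsAdicComplete (IsLocalRing.maximalIdeal R) R] in
theorem map_scalarMul_iterate (t : R) (M : Submodule A V) (n : ℕ) :
    ((Ring.jacobson A • · : Submodule A V → _)^[n] M).map (scalarMul A V t) =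
      (Ring.jacobson A • · : Submodule A V → _)^[n] (M.map (scalarMul A V t)) := by
  induction n with
  | zero => rfl
  | succ n ih => rw [Function.iterate_succ_apply', Function.iterate_succ_apply',
      map_scalarMul_jacobson_smul, ih]

theorem iterate_jacobson_smul_le (M : Submodule A V) :
    Antitone fun n => (Ring.jacobson A • · : Submodule A V → _)^[n] M :=
  antitone_nat_of_succ_le fun n => by
    rw [Function.iterate_succ_apply']
    exact Submodule.smul_le_right

/-- Links end below.  If all `𝔯ⁿM` were summands of copies of `B`, then they would be projective and
would be all nonzero submodules of `M`, so `A` would be hereditary. -/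
theorem IsMember.exists_not_isSummandOfPow [Module.Finite R A] (hdim : ringKrullDim R = 1)
    (hA : ∀ I : Ideal A, I.IsTwoSided → (∃ n : ℕ, I ^ n = ⊥) → I = ⊥)
    (hconn : IsConnectedRing A) (hher : ¬ IsHereditary A)
    (hV : IsRational R V) (hB : IsBijective R A B) (hM : IsMember B M) :
    ∃ n, ¬ IsSummandOfPow A ↥((Ring.jacobson A • · : Submodule A V → _)^[n] M) B := by
  by_contra! hall
  set D := fun n => (Ring.jacobson A • · : Submodule A V → _)^[n] M with hD
  have hDs : ∀ n, D (n + 1) = Ring.jacobson A • D n := fun n =>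
    Function.iterate_succ_apply' _ _ _
  have hmem : ∀ n, IsMember B (D n) := by
    intro n
    induction n with
    | zero => exact hM
    | succ n ih =>
      have h : IsSummandOfPow A (D (n + 1)) B := hall (n + 1)
      rw [hDs] at h ⊢
      exact (ih.jacobson_smul hdim hV hB h).1
  have hanti : Antitone D := iterate_jacobson_smul_le M
  have hfin : Module.Finite R M := hM.finite hB
  obtain ⟨t, htm, ht⟩ := exists_regular_mem_maximalIdeal hdim
  have htM : M.map (scalarMul A V t) ≤ M := by
    rintro _ ⟨x, hx, rfl⟩
    exact M.smul_of_tower_mem t hx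
  -- `M / tM` is artinian, so `tM` does not lie in all of the `𝔯ⁿM`
  obtain ⟨k, hk⟩ : ∃ k, M.map (scalarMul A V t) = D k := by
    refine IsMember.eq_iterate hB hmem htM ?_
    by_contra! hle
    let T : Submodule A M := (M.map (scalarMul A V t)).submoduleOf M
    have hfinQ : Module.Finite R (M ⧸ T) :=
      Module.Finite.of_surjective (T.mkQ.restrictScalars R) T.mkQ_surjective
    have hart : IsArtinian R (M ⧸ T) := isArtinian_of_smul_eq_zero hdim ht (by
      intro x
      obtain ⟨x, rfl⟩ := T.mkQ_surjective x
      exact (Submodule.Quotient.mk_eq_zero T).mpr ⟨x, x.2, rfl⟩)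
    have : IsArtinian A (M ⧸ T) := isArtinian_of_tower R hart
    obtain ⟨n, hn⟩ := IsArtinian.monotone_stabilizes (R := A) (M := M ⧸ T)
      ⟨fun n => OrderDual.toDual (((D n).submoduleOf M).map T.mkQ), fun i j hij =>
        Submodule.map_mono (Submodule.comap_mono (hanti hij))⟩
    have hn1 : ((D n).submoduleOf M).map T.mkQ = ((D (n + 1)).submoduleOf M).map T.mkQ :=
      hn (n + 1) n.le_succ
    have hTD : ∀ n, T ≤ (D n).submoduleOf M := fun n => Submodule.comap_mono (hle n)
    have hn2 : (D n).submoduleOf M = (D (n + 1)).submoduleOf M := by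
      have := congrArg (Submodule.comap T.mkQ) hn1
      rwa [Submodule.comap_map_mkQ, Submodule.comap_map_mkQ, sup_eq_right.mpr (hTD _),
        sup_eq_right.mpr (hTD _)] at this
    have hn3 : D n ≤ D (n + 1) := fun x hx => by
      have : (⟨x, hanti (Nat.zero_le n) hx⟩ : M) ∈ (D n).submoduleOf M := hx
      rw [hn2] at this
      exact this
    have hlt := ((hmem n).jacobson_smul_covBy hB).1.lt
    refine hlt.not_ge ?_
    rwa [hDs] at hn3
  have hDk : ∀ i, D (i + k) = (D i).map (scalarMul A V t) := fun i => by
    rw [hD, map_scalarMul_iterate, hk]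
    exact Function.iterate_add_apply _ _ _ _
  -- hence the intersection of the `𝔯ⁿM` is `t`-divisible
  have hinf : ∀ x, (∀ n, x ∈ D n) → x = 0 := by
    let Z : Submodule R M := (⨅ n, (D n).restrictScalars R).comap (M.subtype.restrictScalars R)
    have hZ : ∀ x : M, x ∈ Z ↔ ∀ n, (x : V) ∈ D n := fun x => by
      simp [Z, Submodule.mem_iInf]
    have hZ0 := Submodule.eq_bot_of_le_smul_of_le_jacobson_bot (IsLocalRing.maximalIdeal R)
      Z (IsNoetherian.noetherian Z) (by
        intro x hx
        rw [hZ] at hx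
        have h1 := fun n => hDk n ▸ hx (n + k)
        obtain ⟨y, hy, hyx⟩ := h1 0
        have hyM : y ∈ M := hy
        have hyZ : (⟨y, hyM⟩ : M) ∈ Z := by
          rw [hZ]
          intro n
          obtain ⟨z, hz, hzx⟩ := h1 n
          have : z = y := (hV t ht).1 (hzx.trans hyx.symm)
          exact this ▸ hz
        have hxy : x = t • ⟨y, hyM⟩ := Subtype.ext hyx.symm
        rw [hxy]
        exact Submodule.smul_mem_smul htm hyZ)
      (IsLocalRing.jacobson_eq_maximalIdeal (⊥ : Ideal R) bot_ne_top).ge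
    intro x hx
    have h1 : (⟨x, hx 0⟩ : M) ∈ Z := (hZ _).mpr hx
    rw [hZ0, Submodule.mem_bot] at h1
    exact congrArg Subtype.val h1
  have := hM.indecomposable.1
  refine hher (isHereditary_of_projective_submodules (R := R) (P := M) hA hconn fun X => ?_)
  by_cases hX : X = ⊥
  · subst hX
    exact Module.Projective.of_free
  have hXM : X.map M.subtype ≤ M := Submodule.map_subtype_le _ _
  obtain ⟨n, hn⟩ := IsMember.eq_iterate hB hmem hXM (by
    by_contra! hle
    refine hX (eq_bot_of_map_subtype_eq_bot ((Submodule.eq_bot_iff _).mpr fun x hx => ?_))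
    exact hinf x fun n => hle n hx)
  have hproj := (hmem n).projective hB
  rw [← show X.map M.subtype = D n from hn] at hproj
  exact .of_equiv (Submodule.equivMapOfInjective _ M.injective_subtype X).symm

omit [IsLocalRing R] [IsNoetherianRing R] [IsReduced R]
  [IsAdicComplete (IsLocalRing.maximalIdeal R) R] [Module R B] [IsScalarTower R A B] in
theorem IsSummandOfPow.map_scalarMul (hV : IsRational R V) {t : R} (ht : t ∈ nonZeroDivisors R)
    {M : Submodule A V} (h : IsSummandOfPow A M B) :
    IsSummandOfPow A ↥(M.map (scalarMul A V t)) B :=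
  .congr (Submodule.equivMapOfInjective _ (hV t ht).1 M).symm h

/-- Links end above.  Otherwise the overmodule `t⁻¹M` is a step `U d` of the ascending chain that starts
with `M`.  The descent from `U d` arrives at `M = t U d` after `d` steps, all of them summands of
copies of `B`, and repeats itself from there on up to the factor `t`; so it never ends. -/
theorem IsMember.exists_not_isSummandOfPow_radOver [Module.Finite R A] (hdim : ringKrullDim R = 1)
    (hA : ∀ I : Ideal A, I.IsTwoSided → (∃ n : ℕ, I ^ n = ⊥) → I = ⊥)
    (hconn : IsConnectedRing A) (hher : ¬ IsHereditary A)
    (hV : IsRational R V) (hB : IsBijective R A B) (hM : IsMember B M) :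
    ∃ n, ¬ IsSummandOfPow A ↥((RejectionOrders.radOver R)^[n] M) B := by
  by_contra! hall
  set U := fun n => (RejectionOrders.radOver R)^[n] M with hU
  have hUs : ∀ n, U (n + 1) = RejectionOrders.radOver R (U n) := fun n =>
    Function.iterate_succ_apply' _ _ _
  have hmem : ∀ n, IsMember B (U n) := by
    intro n
    induction n with
    | zero => exact hM
    | succ n ih =>
      have h := hall (n + 1)
      change IsSummandOfPow A (U (n + 1)) B at h
      rw [hUs] at h ⊢
      exact (ih.radOver hdim hV hB h).1
  have hdown : ∀ n, Ring.jacobson A • U (n + 1) = U n := fun n => by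
    have h := hall (n + 1)
    change IsSummandOfPow A (U (n + 1)) B at h
    rw [hUs] at h ⊢
    exact ((hmem n).radOver hdim hV hB h).2
  have hdown' : ∀ n, (Ring.jacobson A • · : Submodule A V → _)^[n] (U n) = M := by
    intro n
    induction n with
    | zero => rfl
    | succ n ih => rw [Function.iterate_succ_apply, hdown, ih]
  have hover : ∀ n, IsOvermodule R M (U n) := by
    intro n
    induction n with
    | zero => exact .refl (hM.summand.isLattice hB.2.1)
    | succ n ih =>
      rw [hUs]
      exact ih.trans ((hmem n).radOver_spec hdim hV hB).2.1
  have hmono : StrictMono U := strictMono_nat_of_lt_succ fun n => by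
    rw [hUs]
    exact ((hmem n).radOver_spec hdim hV hB).1.lt
  obtain ⟨t, htm, ht⟩ := exists_regular_mem_maximalIdeal hdim
  have hX := isOvermodule_comap_scalarMul hV (hM.finite hB) ht
  have hne := ne_comap_scalarMul hV (hM.finite hB)
    (Submodule.nontrivial_iff_ne_bot.mp hM.indecomposable.1) ht htm
  set X := M.comap (scalarMul A V t) with hXdef
  -- `t⁻¹M` is one of the iterated minimal overmodules
  obtain ⟨d, hd⟩ : ∃ d, X = U d := by
    -- otherwise the whole chain lies in the noetherian module `X`
    by_contra! hcon
    have hle : ∀ n, U n ≤ X := by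
      intro n
      induction n with
      | zero => exact hX.le
      | succ n ih =>
        rw [hUs]
        exact ((hmem n).radOver_spec hdim hV hB).2.2 X (hX.mono (hover n).le ih) (hcon n).symm
    have := hX.isLattice.1
    have : IsNoetherian A X := hX.isLattice.isNoetherian
    obtain ⟨n, hn⟩ := monotone_stabilizes_iff_noetherian.mpr this
      ⟨fun n => (U n).submoduleOf X, fun i j hij => Submodule.comap_mono (hmono.monotone hij)⟩
    have h1 : (U n).submoduleOf X = (U (n + 1)).submoduleOf X := hn (n + 1) n.le_succ
    refine (hmono n.lt_succ_self).not_ge fun x hx => ?_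
    have h2 : (⟨x, hle _ hx⟩ : X) ∈ (U (n + 1)).submoduleOf X := hx
    rw [← h1] at h2
    exact h2
  have htU : (U d).map (scalarMul A V t) = M := by
    rw [← hd, hXdef, Submodule.map_comap_eq_of_surjective (hV t ht).2]
  classical
  have hex := (hmem d).exists_not_isSummandOfPow hdim hA hconn hher hV hB
  have hspec := Nat.find_spec hex
  by_cases hlt : Nat.find hex ≤ d
  · have h1 : ∀ i, i ≤ d → (Ring.jacobson A • · : Submodule A V → _)^[i] (U d) = U (d - i) := by
      intro i
      induction i with
      | zero => intro _; rfl
      | succ i ih =>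
        intro hi
        rw [Function.iterate_succ_apply', ih (by omega), ← hdown (d - (i + 1)),
          show d - (i + 1) + 1 = d - i by omega]
    rw [h1 _ hlt] at hspec
    exact hspec (hall _)
  · push Not at hlt
    obtain ⟨i, hi⟩ := Nat.exists_eq_add_of_lt hlt
    have hd0 : 0 < d := by
      rcases Nat.eq_zero_or_pos d with h0 | h0
      · rw [h0] at hd
        exact absurd hd.symm hne
      · exact h0
    have hmin : IsSummandOfPow A ↥((Ring.jacobson A • · : Submodule A V → _)^[i + 1] (U d)) B :=
      not_not.mp (Nat.find_min hex (by omega))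
    rw [hi, show d + i + 1 = (i + 1) + d by omega, Function.iterate_add_apply, hdown',
      ← htU, ← map_scalarMul_iterate] at hspec
    exact hspec (hmin.map_scalarMul hV ht)

end Members

/-! ### The lattices `M^{+,B}` and `M^{-,B}` -/

section LinkExistence

variable {R A V B : Type u} [CommRing R] [IsLocalRing R] [IsNoetherianRing R] [IsReduced R]
  [IsAdicComplete (IsLocalRing.maximalIdeal R) R] [Ring A] [Algebra R A]
  [AddCommGroup V] [Module R V] [Module A V] [IsScalarTower R A V]
  [AddCommGroup B] [Module R B] [Module A B] [IsScalarTower R A B]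
  {M : Submodule A V}

theorem IsMember.iterate_radOver (hdim : ringKrullDim R = 1) (hV : IsRational R V)
    (hB : IsBijective R A B) (hM : IsMember B M) (n : ℕ)
    (h : ∀ i ≤ n, IsSummandOfPow A ↥((RejectionOrders.radOver R)^[i] M) B) :
    IsMember B ((RejectionOrders.radOver R)^[n] M) ∧
      (Ring.jacobson A • · : Submodule A V → _)^[n] ((RejectionOrders.radOver R)^[n] M) = M := by
  induction n with
  | zero => exact ⟨hM, rfl⟩
  | succ n ih =>
    obtain ⟨h1, h2⟩ := ih fun i hi => h i (hi.trans n.le_succ)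
    have h3 := h (n + 1) le_rfl
    rw [Function.iterate_succ_apply' (RejectionOrders.radOver R)] at h3 ⊢
    obtain ⟨h4, h5⟩ := h1.radOver hdim hV hB h3
    refine ⟨h4, ?_⟩
    rw [Function.iterate_succ_apply, h5, h2]

theorem IsMember.iterate_jacobson_smul [Module.Finite R A] (hdim : ringKrullDim R = 1)
    (hV : IsRational R V) (hB : IsBijective R A B) (hM : IsMember B M) (n : ℕ)
    (h : ∀ i ≤ n, IsSummandOfPow A ↥((Ring.jacobson A • · : Submodule A V → _)^[i] M) B) :
    IsMember B ((Ring.jacobson A • · : Submodule A V → _)^[n] M) := by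
  induction n with
  | zero => exact hM
  | succ n ih =>
    have h1 := ih fun i hi => h i (hi.trans n.le_succ)
    have h3 := h (n + 1) le_rfl
    rw [Function.iterate_succ_apply'] at h3 ⊢
    exact (h1.jacobson_smul hdim hV hB h3).1

/-- Every member belongs to a link: ascend as far as possible, then descend from there as far as
possible. -/
theorem IsMember.exists_isLink [Module.Finite R A] (hdim : ringKrullDim R = 1)
    (hA : ∀ I : Ideal A, I.IsTwoSided → (∃ n : ℕ, I ^ n = ⊥) → I = ⊥)
    (hconn : IsConnectedRing A) (hher : ¬ IsHereditary A)
    (hV : IsRational R V) (hB : IsBijective R A B) (hM : IsMember B M) :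
    ∃ (n : ℕ) (L : Fin (n + 1) → Submodule A V), IsLink R B L ∧ ∃ k, L k = M := by
  classical
  have hex := hM.exists_not_isSummandOfPow_radOver hdim hA hconn hher hV hB
  have hspec := Nat.find_spec hex
  have hmin : ∀ i < Nat.find hex, IsSummandOfPow A ↥((RejectionOrders.radOver R)^[i] M) B :=
    fun i hi => not_not.mp (Nat.find_min hex hi)
  obtain ⟨a, ha⟩ : ∃ a, Nat.find hex = a + 1 := Nat.exists_eq_succ_of_ne_zero fun h0 => by
    rw [h0] at hspec
    exact hspec hM.summand
  rw [ha] at hspec hmin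
  obtain ⟨hT, hTM⟩ := hM.iterate_radOver hdim hV hB a fun i hi => hmin i (Nat.lt_succ_of_le hi)
  rw [Function.iterate_succ_apply'] at hspec
  set T := (RejectionOrders.radOver R)^[a] M
  have hex' := hT.exists_not_isSummandOfPow hdim hA hconn hher hV hB
  have hspec' := Nat.find_spec hex'
  have hmin' : ∀ i < Nat.find hex',
      IsSummandOfPow A ↥((Ring.jacobson A • · : Submodule A V → _)^[i] T) B :=
    fun i hi => not_not.mp (Nat.find_min hex' hi)
  obtain ⟨n, hn⟩ : ∃ n, Nat.find hex' = n + 1 := Nat.exists_eq_succ_of_ne_zero fun h0 => by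
    rw [h0] at hspec'
    exact hspec' hT.summand
  rw [hn] at hspec' hmin'
  have hL : ∀ i ≤ n, IsMember B ((Ring.jacobson A • · : Submodule A V → _)^[i] T) := fun i hi =>
    hT.iterate_jacobson_smul hdim hV hB i fun j hj => hmin' j (by omega)
  have han : a < n + 1 := by
    by_contra! hlt
    refine hspec' ?_
    obtain ⟨c, hc⟩ := Nat.exists_eq_add_of_le hlt
    have h1 : IsMember B ((RejectionOrders.radOver R)^[c] M) :=
      (hM.iterate_radOver hdim hV hB c fun i hi => hmin i (by omega)).1
    have h2 := (h1.iterate_radOver hdim hV hB (n + 1) fun i hi => by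
      rw [← Function.iterate_add_apply]
      exact hmin _ (by omega)).2
    rw [← Function.iterate_add_apply, ← hc] at h2
    rw [h2]
    exact h1.summand
  refine ⟨n, fun i => (Ring.jacobson A • · : Submodule A V → _)^[i] T,
    ⟨fun i => (hL i (Nat.lt_succ_iff.mp i.2)).indecomposable,
      fun i => (hL i (Nat.lt_succ_iff.mp i.2)).summand,
      fun i => Function.iterate_succ_apply' _ _ _, ?_, hspec⟩, ⟨a, han⟩, hTM⟩
  rwa [Function.iterate_succ_apply'] at hspec'

/-- The members of a link above a given one are its iterated minimal overmodules. -/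
theorem IsLink.iterate_radOver [Module.Finite R A] (hdim : ringKrullDim R = 1)
    (hV : IsRational R V) (hB : IsBijective R A B) {n : ℕ} {L : Fin (n + 1) → Submodule A V}
    (hL : IsLink R B L) (k : Fin (n + 1)) (i : ℕ) (hi : i ≤ k) :
    (radOver R)^[i] (L k) = L ⟨k - i, (Nat.sub_le _ _).trans_lt k.2⟩ := by
  induction i with
  | zero => rfl
  | succ i ih =>
    rw [Function.iterate_succ_apply', ih (Nat.le_of_succ_le hi)]
    have hk := k.2
    have h1 := hL.step ⟨k - (i + 1), by omega⟩
    have h2 : (⟨k - i, (Nat.sub_le _ _).trans_lt k.2⟩ : Fin (n + 1)) =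
        Fin.succ ⟨k - (i + 1), by omega⟩ := Fin.ext (by simp; omega)
    have h3 := hL.summand (Fin.succ ⟨k - (i + 1), by omega⟩)
    rw [h2, h1]
    rw [h1] at h3
    exact (IsMember.jacobson_smul hdim hV hB ⟨hL.indecomposable _, hL.summand _⟩ h3).2

omit [IsLocalRing R] [IsNoetherianRing R] [IsReduced R]
  [IsAdicComplete (IsLocalRing.maximalIdeal R) R] [Module R B] [IsScalarTower R A B] in
theorem IsLink.iterate_jacobson_smul {n : ℕ} {L : Fin (n + 1) → Submodule A V}
    (hL : IsLink R B L) (k : Fin (n + 1)) (i : ℕ) (hi : k + i < n + 1) :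
    (Ring.jacobson A • · : Submodule A V → _)^[i] (L k) = L ⟨k + i, hi⟩ := by
  induction i with
  | zero => rfl
  | succ i ih =>
    rw [Function.iterate_succ_apply', ih (by omega)]
    exact (hL.step ⟨k + i, by omega⟩).symm

/-- The lattice `M^{+,B}` is well defined, has no nonzero summand in common with powers of `B`,
and is a reflection of `M` into the lattices with that property. -/
theorem exists_isPlus [Module.Finite R A] (hdim : ringKrullDim R = 1)
    (hA : ∀ I : Ideal A, I.IsTwoSided → (∃ n : ℕ, I ^ n = ⊥) → I = ⊥)
    (hconn : IsConnectedRing A) (hher : ¬ IsHereditary A)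
    (hV : IsRational R V) (hB : IsBijective R A B) (hM : IsIndecomposable A M)
    (hfin : Module.Finite R M) :
    ∃ U : Submodule A V, (∀ N, IsPlus R B M N ↔ N = U) ∧ IsOvermodule R M U ∧
      HasNoSummand A B U ∧
      (∀ (N : Type u) [AddCommGroup N] [Module R N] [Module A N] [IsScalarTower R A N],
        IsLattice R N → HasNoSummand A B N → ∀ φ : M →ₗ[A] N,
          ∃ ψ : U →ₗ[A] N, ∀ (m : V) (hm : m ∈ M) (hm' : m ∈ U), ψ ⟨m, hm'⟩ = φ ⟨m, hm⟩) ∧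
      (IsSummandOfPow A M B → M ≠ U) := by
  classical
  by_cases hMB : IsSummandOfPow A M B
  swap
  · refine ⟨M, fun N => ⟨?_, fun h => Or.inl ⟨hMB, h⟩⟩, .refl (hV.isLattice M hfin),
      hM.hasNoSummand hMB, fun N _ _ _ _ _ _ φ => ⟨φ, fun _ _ _ => rfl⟩, fun h => (hMB h).elim⟩
    rintro (⟨_, h⟩ | ⟨n, L, hL, ⟨k, rfl⟩, rfl⟩)
    · exact h
    · exact (hMB (hL.summand k)).elim
  have hM' : IsMember B M := ⟨hM, hMB⟩
  have hex := hM'.exists_not_isSummandOfPow_radOver hdim hA hconn hher hV hB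
  have hspec := Nat.find_spec hex
  have hmin : ∀ i < Nat.find hex, IsSummandOfPow A ↥((radOver R)^[i] M) B :=
    fun i hi => not_not.mp (Nat.find_min hex hi)
  have hmem : ∀ i < Nat.find hex, IsMember B ((radOver R)^[i] M) := fun i hi =>
    (hM'.iterate_radOver hdim hV hB i fun j hj => hmin j (by omega)).1
  refine ⟨(radOver R)^[Nat.find hex] M, fun N => ?_, ?_, ?_, ?_, fun _ h => ?_⟩
  · have key : ∀ (n : ℕ) (L : Fin (n + 1) → Submodule A V), IsLink R B L → (∃ k, L k = M) →
        radOver R (L 0) = (radOver R)^[Nat.find hex] M := by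
      rintro n L hL ⟨k, rfl⟩
      have h0 : (radOver R)^[(k : ℕ) + 1] (L k) = radOver R (L 0) := by
        rw [Function.iterate_succ_apply', hL.iterate_radOver hdim hV hB k k le_rfl]
        congr 2
        exact Fin.ext (Nat.sub_self _)
      have h1 : Nat.find hex = k + 1 := by
        rw [Nat.find_eq_iff, h0]
        refine ⟨hL.upper, fun i hi h => h ?_⟩
        rw [hL.iterate_radOver hdim hV hB k i (Nat.lt_succ_iff.mp hi)]
        exact hL.summand _
      rw [h1, h0]
    constructor
    · rintro (⟨h, _⟩ | ⟨n, L, hL, hk, rfl⟩)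
      · exact (h hMB).elim
      · exact key n L hL hk
    · rintro rfl
      obtain ⟨n, L, hL, hk⟩ := hM'.exists_isLink hdim hA hconn hher hV hB
      exact Or.inr ⟨n, L, hL, hk, (key n L hL hk).symm⟩
  · have h : ∀ i ≤ Nat.find hex, IsOvermodule R M ((radOver R)^[i] M) := by
      intro i
      induction i with
      | zero => exact fun _ => .refl (hV.isLattice M hfin)
      | succ i ih =>
        intro hi
        rw [Function.iterate_succ_apply']
        exact (ih (by omega)).trans ((hmem i hi).radOver_spec hdim hV hB).2.1
    exact h _ le_rfl
  · obtain ⟨a, ha⟩ : ∃ a, Nat.find hex = a + 1 := Nat.exists_eq_succ_of_ne_zero fun h0 => by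
      rw [h0] at hspec
      exact hspec hMB
    rw [ha, Function.iterate_succ_apply'] at hspec ⊢
    exact (hmem a (by omega)).hasNoSummand_radOver hdim hV hB hspec
  · intro N _ _ _ _ hN hNB φ
    have h : ∀ i ≤ Nat.find hex, ∃ ψ : ↥((radOver R)^[i] M) →ₗ[A] N,
        ∀ (m : V) (hm : m ∈ M) (hm' : m ∈ (radOver R)^[i] M), ψ ⟨m, hm'⟩ = φ ⟨m, hm⟩ := by
      intro i
      induction i with
      | zero => exact fun _ => ⟨φ, fun _ _ _ => rfl⟩
      | succ i ih =>
        intro hi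
        obtain ⟨ψ, hψ⟩ := ih (by omega)
        have hle := ((hmem i hi).radOver_spec hdim hV hB).1.le
        obtain ⟨χ, hχ⟩ := (hmem i hi).exists_extension hdim hV hB hN hNB ψ hle
        have hle' : M ≤ (radOver R)^[i] M := by
          clear * - hmem hi hdim hV hB
          induction i with
          | zero => exact le_rfl
          | succ i ih =>
            rw [Function.iterate_succ_apply']
            exact (ih (by omega)).trans ((hmem i (by omega)).radOver_spec hdim hV hB).1.le
        rw [Function.iterate_succ_apply']
        exact ⟨χ, fun m hm hm' => (hχ ⟨m, hle' hm⟩).trans (hψ m hm _)⟩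
    exact h _ le_rfl
  · rw [← h] at hspec
    exact hspec hMB

/-- The lattice `M^{-,B}` is well defined, and is the largest submodule of `M` that has no nonzero
summand in common with powers of `B`. -/
theorem exists_isMinus [Module.Finite R A] (hdim : ringKrullDim R = 1)
    (hA : ∀ I : Ideal A, I.IsTwoSided → (∃ n : ℕ, I ^ n = ⊥) → I = ⊥)
    (hconn : IsConnectedRing A) (hher : ¬ IsHereditary A)
    (hV : IsRational R V) (hB : IsBijective R A B) (hM : IsIndecomposable A M) :
    ∃ L : Submodule A V, (∀ N, IsMinus R B M N ↔ N = L) ∧ L ≤ M ∧ HasNoSummand A B L ∧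
      ∀ X : Submodule A V, X ≤ M → HasNoSummand A B X → X ≤ L := by
  classical
  by_cases hMB : IsSummandOfPow A M B
  swap
  · refine ⟨M, fun N => ⟨?_, fun h => Or.inl ⟨hMB, h⟩⟩, le_rfl,
      hM.hasNoSummand hMB, fun X hX _ => hX⟩
    rintro (⟨_, h⟩ | ⟨n, L, hL, ⟨k, rfl⟩, rfl⟩)
    · exact h
    · exact (hMB (hL.summand k)).elim
  have hM' : IsMember B M := ⟨hM, hMB⟩
  have hex := hM'.exists_not_isSummandOfPow hdim hA hconn hher hV hB
  have hspec := Nat.find_spec hex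
  have hmin : ∀ i < Nat.find hex,
      IsSummandOfPow A ↥((Ring.jacobson A • · : Submodule A V → _)^[i] M) B :=
    fun i hi => not_not.mp (Nat.find_min hex hi)
  have hmem : ∀ i < Nat.find hex,
      IsMember B ((Ring.jacobson A • · : Submodule A V → _)^[i] M) := fun i hi =>
    hM'.iterate_jacobson_smul hdim hV hB i fun j hj => hmin j (by omega)
  refine ⟨(Ring.jacobson A • · : Submodule A V → _)^[Nat.find hex] M, fun N => ?_,
    iterate_jacobson_smul_le M (Nat.zero_le _), ?_, fun X hXM hX => ?_⟩
  · have key : ∀ (n : ℕ) (L : Fin (n + 1) → Submodule A V), IsLink R B L → (∃ k, L k = M) →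
        Ring.jacobson A • L (Fin.last n) =
          (Ring.jacobson A • · : Submodule A V → _)^[Nat.find hex] M := by
      rintro n L hL ⟨k, rfl⟩
      have hk := k.2
      have h0 : (Ring.jacobson A • · : Submodule A V → _)^[n - k + 1] (L k) =
          Ring.jacobson A • L (Fin.last n) := by
        rw [Function.iterate_succ_apply', hL.iterate_jacobson_smul k (n - k) (by omega)]
        congr 2
        exact Fin.ext (by simp; omega)
      have h1 : Nat.find hex = n - k + 1 := by
        rw [Nat.find_eq_iff, h0]
        refine ⟨hL.lower, fun i hi h => h ?_⟩
        rw [hL.iterate_jacobson_smul k i (by omega)]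
        exact hL.summand _
      rw [h1, h0]
    constructor
    · rintro (⟨h, _⟩ | ⟨n, L, hL, hk, rfl⟩)
      · exact (h hMB).elim
      · exact key n L hL hk
    · rintro rfl
      obtain ⟨n, L, hL, hk⟩ := hM'.exists_isLink hdim hA hconn hher hV hB
      exact Or.inr ⟨n, L, hL, hk, (key n L hL hk).symm⟩
  · obtain ⟨a, ha⟩ : ∃ a, Nat.find hex = a + 1 := Nat.exists_eq_succ_of_ne_zero fun h0 => by
      rw [h0] at hspec
      exact hspec hMB
    rw [ha, Function.iterate_succ_apply'] at hspec ⊢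
    exact (hmem a (by omega)).hasNoSummand_jacobson_smul hdim hV hB hspec
  · have h : ∀ i ≤ Nat.find hex, X ≤ (Ring.jacobson A • · : Submodule A V → _)^[i] M := by
      intro i
      induction i with
      | zero => exact fun _ => hXM
      | succ i ih =>
        intro hi
        rw [Function.iterate_succ_apply']
        refine ((hmem i hi).jacobson_smul_covBy hB).2 X ((ih (by omega)).lt_of_ne fun h => ?_)
        have h1 := hX.subsingleton (h ▸ (hmem i hi).summand)
        rw [h] at h1
        have := (hmem i hi).indecomposable.1
        exact not_subsingleton _ h1
    exact h _ le_rfl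

end LinkExistence

/-! ### The canonical module -/

section Canonical

open CategoryTheory Abelian

variable {R : Type u} [CommRing R]

/-- The short exact sequence of a pair of linear maps. -/
theorem shortExact_moduleCatMk {X N C : Type u} [AddCommGroup X] [Module R X] [AddCommGroup N]
    [Module R N] [AddCommGroup C] [Module R C] (i : X →ₗ[R] N) (q : N →ₗ[R] C)
    (hi : Function.Injective i) (hq : Function.Surjective q) (h : Function.Exact i q) :
    (ShortComplex.moduleCatMk i q h.linearMap_comp_eq_zero).ShortExact where
  exact := (ShortComplex.moduleCat_exact_iff _).mpr fun x hx => (h x).mp hx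
  mono_f := (ModuleCat.mono_iff_injective _).mpr hi
  epi_g := (ModuleCat.epi_iff_surjective _).mpr hq

/-- Maps to `W` extend along `X → N` if `Ext¹(N ⧸ X, W) = 0`. -/
theorem exists_extension_of_subsingleton_ext {X N C W : Type u} [AddCommGroup X] [Module R X]
    [AddCommGroup N] [Module R N] [AddCommGroup C] [Module R C] [AddCommGroup W] [Module R W]
    (i : X →ₗ[R] N) (q : N →ₗ[R] C)
    (hi : Function.Injective i) (hq : Function.Surjective q) (h : Function.Exact i q)
    (hC : Subsingleton (Ext (ModuleCat.of R C) (ModuleCat.of R W) 1)) (f : X →ₗ[R] W) :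
    ∃ g : N →ₗ[R] W, g ∘ₗ i = f := by
  have hS := shortExact_moduleCatMk i q hi hq h
  obtain ⟨x, hx⟩ := Ext.contravariant_sequence_exact₁ hS (ModuleCat.of R W)
    (Ext.mk₀ (ModuleCat.ofHom f)) (add_zero 1) (hC.elim _ _)
  obtain ⟨g, rfl⟩ := Ext.mk₀_bijective _ _ |>.2 x
  rw [Ext.mk₀_comp_mk₀] at hx
  have h1 := Ext.mk₀_bijective _ _ |>.1 hx
  exact ⟨g.hom, congrArg ModuleCat.Hom.hom h1⟩

theorem finite_ext_one_of_shortExact {S : ShortComplex (ModuleCat.{u} R)} (hS : S.ShortExact)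
    (Y : ModuleCat.{u} R) [Projective S.X₂] [Module.Finite R (S.X₁ ⟶ Y)] :
    Module.Finite R (Ext S.X₃ Y 1) := by
  refine Module.Finite.of_surjective
    (Ext.bilinearCompOfLinear R S.X₃ S.X₁ Y 1 0 1 (add_zero 1) hS.extClass ∘ₗ
      (Ext.linearEquiv₀ (R := R) (X := S.X₁) (Y := Y)).symm.toLinearMap) fun e => ?_
  obtain ⟨x, hx⟩ := Ext.contravariant_sequence_exact₃ hS Y e
    (Ext.eq_zero_of_projective _) (add_zero 1)
  exact ⟨Ext.linearEquiv₀ (R := R) x, by simpa using hx⟩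

/-- `Ext¹(C, W)` is finitely generated for finitely generated `C` and `W`. -/
theorem finite_ext_one [IsNoetherianRing R] {C W : Type u} [AddCommGroup C] [Module R C]
    [AddCommGroup W] [Module R W] [Module.Finite R C] [Module.Finite R W] :
    Module.Finite R (Ext (ModuleCat.of R C) (ModuleCat.of R W) 1) := by
  obtain ⟨n, q, hq⟩ := Module.Finite.exists_fin' R C
  have hS := shortExact_moduleCatMk (LinearMap.ker q).subtype q (Submodule.subtype_injective _)
    hq (LinearMap.exact_subtype_ker_map q)
  have h1 : Projective (ModuleCat.of R (Fin n → R)) :=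
    ModuleCat.projective_of_free (Pi.basisFun R _)
  have h2 : Module.Finite R (ModuleCat.of R (LinearMap.ker q) ⟶ ModuleCat.of R W) :=
    .equiv (ModuleCat.homLinearEquiv (S := R)).symm
  exact @finite_ext_one_of_shortExact R _ _ hS (ModuleCat.of R W) h1 h2

/-- Multiplication by `t` is surjective on `Ext¹(C, Y)` if `t` is injective on `C` with cokernel `Q`
and `Ext²(Q, Y) = 0`. -/
theorem exists_smul_eq_of_shortExact {C Q Y : ModuleCat.{u} R} (t : R) (q : C ⟶ Q)
    (w : (t • 𝟙 C) ≫ q = 0) (hS : (ShortComplex.mk (t • 𝟙 C) q w).ShortExact)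
    (h : Subsingleton (Ext Q Y 2)) (e : Ext C Y 1) : ∃ e', e = t • e' := by
  obtain ⟨x, hx⟩ := Ext.contravariant_sequence_exact₁ hS Y e (show 1 + 1 = 2 from rfl)
    (h.elim _ _)
  refine ⟨x, hx.symm.trans ?_⟩
  rw [Ext.mk₀_smul, Ext.smul_comp, Ext.mk₀_id_comp]

theorem extClass_comp_mk₀_eq_zero {S : ShortComplex (ModuleCat.{u} R)} (hS : S.ShortExact)
    {Y : ModuleCat.{u} R} {g : S.X₁ ⟶ Y} (h : S.X₂ ⟶ Y) (hg : g = S.f ≫ h) :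
    hS.extClass.comp (Ext.mk₀ g) (add_zero 1) = 0 := by
  rw [hg, ← Ext.mk₀_comp_mk₀, hS.extClass_comp_assoc]

/-- Over a one-dimensional reduced local ring `Ext¹(C, W) = 0` for a lattice `C` and a canonical
module `W`: multiplication by a regular `t` in the maximal ideal is surjective on `Ext¹(C, W)`,
because `Ext²(C ⧸ tC, W) = 0`. -/
theorem IsCanonicalModule.subsingleton_ext [IsLocalRing R] [IsNoetherianRing R] [IsReduced R]
    (hdim : ringKrullDim R = 1) {C W : Type u} [AddCommGroup C] [Module R C] [AddCommGroup W]
    [Module R W] (hW : IsCanonicalModule R W) (hC : IsLattice R C) :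
    Subsingleton (Ext (ModuleCat.of R C) (ModuleCat.of R W) 1) := by
  obtain ⟨t, htm, ht⟩ := exists_regular_mem_maximalIdeal hdim
  have := hC.1
  have := hW.1.1
  have : HasInjectiveDimensionLT (ModuleCat.of R W) 2 := by
    rw [← injectiveDimension_lt_iff, hW.2.1]
    norm_num
  let i : C →ₗ[R] C := LinearMap.lsmul R C t
  have hi : Function.Injective i := fun x y hxy => hC.smul_cancel ht hxy
  have hS := shortExact_moduleCatMk i (LinearMap.range i).mkQ hi
    (LinearMap.range i).mkQ_surjective (LinearMap.exact_map_mkQ_range i)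
  have hw := (ShortComplex.moduleCatMk i (LinearMap.range i).mkQ
    (LinearMap.exact_map_mkQ_range i).linearMap_comp_eq_zero).zero
  have hfin : Module.Finite R (Ext (ModuleCat.of R C) (ModuleCat.of R W) 1) := finite_ext_one
  have htop := Submodule.eq_bot_of_le_smul_of_le_jacobson_bot (IsLocalRing.maximalIdeal R)
    (⊤ : Submodule R (Ext (ModuleCat.of R C) (ModuleCat.of R W) 1)) hfin.1 (by
      intro e _
      obtain ⟨x, rfl⟩ := exists_smul_eq_of_shortExact t
        (ModuleCat.ofHom (LinearMap.range i).mkQ) hw hS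
        (HasInjectiveDimensionLT.subsingleton (ModuleCat.of R W) 2 2 le_rfl _) e
      exact Submodule.smul_mem_smul htm Submodule.mem_top)
    (IsLocalRing.jacobson_eq_maximalIdeal (⊥ : Ideal R) bot_ne_top).ge
  exact (Submodule.subsingleton_iff R).mp ((subsingleton_iff_bot_eq_top).mp htop.symm)

variable [IsLocalRing R] [IsNoetherianRing R] {W : Type u} [AddCommGroup W] [Module R W]

/-- Maps from a saturated submodule of an `R`-lattice to a canonical module extend. -/
theorem IsCanonicalModule.exists_extension [IsReduced R] (hdim : ringKrullDim R = 1)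
    (hW : IsCanonicalModule R W) {N : Type u} [AddCommGroup N] [Module R N] (hN : IsLattice R N)
    {X : Submodule R N} (hX : IsSaturated R X) (f : X →ₗ[R] W) :
    ∃ g : N →ₗ[R] W, ∀ x : X, g x = f x := by
  obtain ⟨g, hg⟩ := exists_extension_of_subsingleton_ext X.subtype X.mkQ X.injective_subtype
    X.mkQ_surjective (LinearMap.exact_subtype_mkQ X)
    (hW.subsingleton_ext hdim (hX.isLattice_quotient hN.1)) f
  exact ⟨g, LinearMap.congr_fun hg⟩

omit [IsNoetherianRing R] in
/-- Since `Ext¹(k, W) ≠ 0`, some map from the maximal ideal to `W` does not extend to `R`. -/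
theorem IsCanonicalModule.exists_not_extension (hW : IsCanonicalModule R W) :
    ∃ g : IsLocalRing.maximalIdeal R →ₗ[R] W,
      ∀ w : W, ∃ a : IsLocalRing.maximalIdeal R, g a ≠ (a : R) • w := by
  by_contra! hcon
  obtain ⟨e⟩ := hW.2.2
  have hS := shortExact_moduleCatMk (IsLocalRing.maximalIdeal R).subtype
    (Algebra.linearMap R (IsLocalRing.ResidueField R)) (Submodule.subtype_injective _)
    IsLocalRing.residue_surjective (by
      intro x
      change IsLocalRing.residue R x = 0 ↔ _
      rw [IsLocalRing.residue_eq_zero_iff]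
      exact ⟨fun h => ⟨⟨x, h⟩, rfl⟩, by rintro ⟨y, rfl⟩; exact y.2⟩)
  have hproj : Projective (ModuleCat.of R R) :=
    ModuleCat.projective_of_free (Module.Basis.singleton Unit R)
  have h0 : ∀ x : Ext (ModuleCat.of R (IsLocalRing.ResidueField R)) (ModuleCat.of R W) 1,
      x = 0 := by
    intro x
    obtain ⟨y, rfl⟩ := Ext.contravariant_sequence_exact₃ hS (ModuleCat.of R W) x
      (@Ext.eq_zero_of_projective _ _ _ _ _ _ _ hproj _) (add_zero 1)
    obtain ⟨g, rfl⟩ := Ext.mk₀_bijective _ _ |>.2 y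
    obtain ⟨w, hw⟩ := hcon g.hom
    exact extClass_comp_mk₀_eq_zero hS (ModuleCat.ofHom (LinearMap.toSpanSingleton R W w))
      (ModuleCat.hom_ext (LinearMap.ext fun a => hw a))
  have h1 := e.symm.injective ((h0 (e.symm 1)).trans (h0 (e.symm 0)).symm)
  exact one_ne_zero h1

/-- A lattice `X` is determined by the maps to a canonical module `W`: an element `x` of `X` with
`f x ∈ rW` for all maps `f` lies in `rX`.  If not, a multiple `y` of `x` spans the socle of
`(R y + r X) ⧸ r X`, and a map from the maximal ideal to `W` extends to `R` because it extends
along the relation module of `r` and `y`. -/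
theorem IsCanonicalModule.exists_eq_smul [IsReduced R] (hdim : ringKrullDim R = 1)
    (hW : IsCanonicalModule R W) {X : Type u} [AddCommGroup X] [Module R X] (hX : IsLattice R X)
    {r : R} (hr : r ∈ nonZeroDivisors R) {x : X} (hx : ∀ f : X →ₗ[R] W, ∃ w, f x = r • w) :
    ∃ z, x = r • z := by
  by_contra! hcon
  have := hX.1
  let T : Submodule R X := LinearMap.range (LinearMap.lsmul R X r)
  have hart : IsArtinian R (X ⧸ T) := isArtinian_of_smul_eq_zero hdim hr (by
    intro x
    obtain ⟨x, rfl⟩ := T.mkQ_surjective x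
    exact (Submodule.Quotient.mk_eq_zero T).mpr ⟨x, rfl⟩)
  have hxT : T.mkQ x ≠ 0 := fun h => by
    obtain ⟨z, hz⟩ := (Submodule.Quotient.mk_eq_zero T).mp h
    exact hcon z hz.symm
  obtain ⟨S, hS, hSx⟩ := (IsAtomic.eq_bot_or_exists_atom_le
    (Submodule.span R {T.mkQ x})).resolve_left (by simpa using hxT)
  obtain ⟨s, hs, hs0⟩ := S.exists_mem_ne_zero_of_ne_bot hS.1
  obtain ⟨c, rfl⟩ := Submodule.mem_span_singleton.mp (hSx hs)
  have hmS : IsLocalRing.maximalIdeal R • S = ⊥ := by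
    refine (hS.le_iff.mp Submodule.smul_le_right).resolve_right fun h => hS.1 ?_
    exact Submodule.eq_bot_of_le_smul_of_le_jacobson_bot _ S (IsNoetherian.noetherian S) h.ge
      (IsLocalRing.jacobson_eq_maximalIdeal (⊥ : Ideal R) bot_ne_top).ge
  set y := c • x with hy
  have hyT : ∀ a ∈ IsLocalRing.maximalIdeal R, ∃ z, r • z = a • y := fun a ha => by
    have h1 : a • (c • T.mkQ x) ∈ IsLocalRing.maximalIdeal R • S := Submodule.smul_mem_smul ha hs
    rw [hmS, Submodule.mem_bot, ← map_smul, ← map_smul] at h1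
    exact (Submodule.Quotient.mk_eq_zero T).mp h1
  have hy0 : ∀ z, r • z ≠ y := fun z hz => hs0 (by
    rw [← map_smul]
    exact (Submodule.Quotient.mk_eq_zero T).mpr ⟨z, hz⟩)
  obtain ⟨g, hg⟩ := hW.exists_not_extension
  -- the relations of `r X` and `y`; the second coordinate of a relation lies in the maximal ideal
  let ρ : X × R →ₗ[R] X :=
    (LinearMap.lsmul R X r).coprod (LinearMap.toSpanSingleton R X y)
  have hρ : ∀ z b, ρ (z, b) = r • z + b • y := fun _ _ => by simp [ρ]
  have hmem : ∀ p : LinearMap.ker ρ, p.1.2 ∈ IsLocalRing.maximalIdeal R := by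
    rintro ⟨⟨z, b⟩, hp⟩
    rw [IsLocalRing.mem_maximalIdeal, mem_nonunits_iff]
    rintro ⟨b, rfl⟩
    rw [LinearMap.mem_ker, hρ] at hp
    refine hy0 (-(((b⁻¹ : Rˣ) : R) • z)) ?_
    rw [smul_neg, smul_comm, neg_eq_iff_add_eq_zero]
    have := congrArg (fun v => ((b⁻¹ : Rˣ) : R) • v) hp
    simpa [smul_add, smul_smul] using this
  obtain ⟨G, hG⟩ := hW.exists_extension hdim (N := X × R)
    (hX.prod ⟨inferInstance, inferInstance⟩) (X := LinearMap.ker ρ)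
    (fun a ha p hp => by
      rw [LinearMap.mem_ker, map_smul] at hp
      exact hX.eq_zero ha hp)
    (g ∘ₗ (LinearMap.snd R X R ∘ₗ (LinearMap.ker ρ).subtype).codRestrict _ hmem)
  obtain ⟨w, hw⟩ : ∃ w, G (y, 0) = r • w := by
    obtain ⟨w, hw⟩ := hx (G ∘ₗ LinearMap.inl R X R)
    refine ⟨c • w, ?_⟩
    have h1 : G (x, 0) = r • w := hw
    rw [smul_comm, ← h1, ← map_smul, hy]
    simp
  -- `g` is multiplication with `G (0, 1) - w`
  obtain ⟨b, hb⟩ := hg (G (0, 1) - w)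
  refine hb ?_
  obtain ⟨z, hz⟩ := hyT b b.2
  have h1 : (-z, (b : R)) ∈ LinearMap.ker ρ := by
    rw [LinearMap.mem_ker, hρ, smul_neg, hz, neg_add_cancel]
  have h2 : G (-z, (b : R)) = g b := hG ⟨_, h1⟩
  have h3 : G (z, 0) = (b : R) • w := by
    refine hW.1.smul_cancel hr ?_
    rw [← map_smul, smul_comm, ← hw, ← map_smul, Prod.smul_mk, Prod.smul_mk, hz, smul_zero,
      smul_zero]
  have h4 : ((-z, (b : R)) : X × R) = (b : R) • (0, 1) - (z, 0) := by simp
  rw [← h2, h4, map_sub, map_smul, h3, smul_sub]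

/-- The maps to a canonical module separate the points of a lattice. -/
theorem IsCanonicalModule.eq_zero_of_forall [IsReduced R] (hdim : ringKrullDim R = 1)
    (hW : IsCanonicalModule R W) {X : Type u} [AddCommGroup X] [Module R X] (hX : IsLattice R X)
    {x : X} (hx : ∀ f : X →ₗ[R] W, f x = 0) : x = 0 := by
  obtain ⟨t, htm, ht⟩ := exists_regular_mem_maximalIdeal hdim
  have := hX.1
  let Z : Submodule R X := ⨅ f : X →ₗ[R] W, LinearMap.ker f
  have hZ : ∀ x, x ∈ Z ↔ ∀ f : X →ₗ[R] W, f x = 0 := by simp [Z, Submodule.mem_iInf]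
  have h0 := Submodule.eq_bot_of_le_smul_of_le_jacobson_bot (IsLocalRing.maximalIdeal R)
    Z (IsNoetherian.noetherian Z) (by
      intro x hx
      rw [hZ] at hx
      obtain ⟨z, rfl⟩ := hW.exists_eq_smul hdim hX ht (x := x) fun f => ⟨0, by rw [hx, smul_zero]⟩
      refine Submodule.smul_mem_smul htm ((hZ z).mpr fun f => hW.1.eq_zero ht ?_)
      rw [← map_smul, hx])
    (IsLocalRing.jacobson_eq_maximalIdeal (⊥ : Ideal R) bot_ne_top).ge
  have h1 := (hZ x).mpr hx
  rwa [h0, Submodule.mem_bot] at h1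

end Canonical

/-! ### The rational hull -/

section Hull

variable {R A M : Type u} [CommRing R] [Ring A] [Algebra R A]
  [AddCommGroup M] [Module R M] [Module A M] [IsScalarTower R A M]

theorem toHull_injective (hM : IsLattice R M) : Function.Injective (toHull R A M) := by
  have hloc : IsLocalizedModule (nonZeroDivisors R)
      (TensorProduct.mk R (FractionRing R) M 1) :=
    (isLocalizedModule_iff_isBaseChange (nonZeroDivisors R) (FractionRing R) _).mpr
      (TensorProduct.isBaseChange R M (FractionRing R))
  rw [injective_iff_map_eq_zero]
  intro m hm
  have h1 : TensorProduct.mk R (FractionRing R) M 1 m = 0 := by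
    have := congrArg (TensorProduct.comm R M (FractionRing R)) hm
    simpa [toHull] using this
  obtain ⟨c, hc⟩ := (IsLocalizedModule.eq_zero_iff (nonZeroDivisors R) _).mp h1
  exact hM.eq_zero c.2 hc

variable (A) in
/-- Common denominators in `KM`. -/
theorem exists_smul_eq_toHull (x : Hull R M) :
    ∃ r ∈ nonZeroDivisors R, ∃ m : M, r • x = toHull R A M m := by
  induction x using TensorProduct.induction_on with
  | zero => exact ⟨1, one_mem _, 0, by rw [smul_zero, map_zero]⟩
  | tmul m k =>
    obtain ⟨⟨a, s⟩, h⟩ := IsLocalization.surj (nonZeroDivisors R) k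
    refine ⟨s, s.2, a • m, ?_⟩
    change (s : R) • (m ⊗ₜ[R] k) = (a • m) ⊗ₜ[R] 1
    rw [TensorProduct.smul_tmul, ← TensorProduct.tmul_smul, Algebra.smul_def, mul_comm, h,
      Algebra.smul_def, mul_one]
  | add x y hx hy =>
    obtain ⟨r, hr, m, hm⟩ := hx
    obtain ⟨s, hs, n, hn⟩ := hy
    refine ⟨r * s, mul_mem hr hs, s • m + r • n, ?_⟩
    rw [map_add, LinearMap.map_smul_of_tower, LinearMap.map_smul_of_tower, ← hm, ← hn, smul_add,
      smul_smul, smul_smul, mul_comm s r]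

variable (R M) in
theorem isRational_hull : IsRational R (Hull R M) := by
  intro r hr
  obtain ⟨k, hk⟩ := (IsLocalization.map_units (FractionRing R)
    (⟨r, hr⟩ : nonZeroDivisors R)).exists_left_inv
  let μ : Hull R M →ₗ[R] Hull R M := LinearMap.lTensor M (LinearMap.mulLeft R k)
  have h1 : ∀ x, μ (r • x) = x := fun x => by
    induction x using TensorProduct.induction_on with
    | zero => simp
    | tmul m c =>
      change μ ((r • m) ⊗ₜ[R] c) = _
      rw [TensorProduct.smul_tmul]
      change m ⊗ₜ[R] (k * (r • c)) = _
      rw [Algebra.smul_def, ← mul_assoc, hk, one_mul]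
    | add x y hx hy => rw [smul_add, map_add, hx, hy]
  refine ⟨fun x y hxy => ?_, fun x => ⟨μ x, ?_⟩⟩
  · rw [← h1 x, ← h1 y]
    exact congrArg μ hxy
  · change r • μ x = x
    rw [← map_smul, h1]

/-- The image of a submodule of a lattice in the rational hull. -/
noncomputable def equivMapToHull (hM : IsLattice R M) (X : Submodule A M) :
    X ≃ₗ[A] X.map (toHull R A M) :=
  Submodule.equivMapOfInjective _ (toHull_injective hM) X

theorem finite_map_toHull [IsNoetherianRing R] (hM : IsLattice R M) (X : Submodule A M) :
    Module.Finite R (X.map (toHull R A M)) :=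
  have := (hM.submodule X).1
  .equiv ((equivMapToHull hM X).restrictScalars R)

end Hull

/-! ### Elements of the hull that act on a lattice -/

section Stabilizes

variable {R A : Type u} [CommRing R] [Ring A] [Algebra R A]

theorem hull_smul_mul_smul (x y : Hull R A) (r s : R) :
    (r • x) * (s • y) = (r * s) • (x * y) := by
  rw [smul_mul_smul_comm]

theorem toHull_mul (a b : A) : toHull R A A (a * b) = toHull R A A a * toHull R A A b := by
  simp [toHull]

theorem toHull_mul_eq_smul (a : A) (x : Hull R A) : toHull R A A a * x = a • x := by
  induction x using TensorProduct.induction_on with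
  | zero => simp
  | tmul b k => simp [toHull, TensorProduct.smul_tmul']
  | add y z hy hz => rw [mul_add, smul_add, hy, hz]

/-- `x ∈ KA` maps the `A`-lattice `M ⊆ KM` to itself: for a presentation `x = a / r` this says
`a M ⊆ r M`. -/
def Stabilizes (x : Hull R A) (M : Type*) [AddCommGroup M] [Module R M] [Module A M] : Prop :=
  ∃ r ∈ nonZeroDivisors R, ∃ a : A, r • x = toHull R A A a ∧ ∀ m : M, ∃ m' : M, a • m = r • m'

variable {M N : Type*} [AddCommGroup M] [Module R M] [Module A M] [IsScalarTower R A M]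
  [AddCommGroup N] [Module R N] [Module A N] [IsScalarTower R A N] {x y : Hull R A}

/-- Independence of the presentation `x = a / r`: the element `m'` is the product `x m` in `KM`. -/
theorem Stabilizes.exists_forall (hA : IsLattice R A) (hM : IsLattice R M) (h : Stabilizes x M)
    (m : M) : ∃ m' : M, ∀ r ∈ nonZeroDivisors R, ∀ a : A, r • x = toHull R A A a →
      a • m = r • m' := by
  obtain ⟨s, hs, b, hb, h⟩ := h
  obtain ⟨m', hm'⟩ := h m
  refine ⟨m', fun r hr a ha => ?_⟩
  have h1 : s • a = r • b := toHull_injective (A := A) hA (by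
    rw [LinearMap.map_smul_of_tower, LinearMap.map_smul_of_tower, ← ha, ← hb, smul_comm])
  refine hM.smul_cancel hs ?_
  rw [← smul_assoc, h1, smul_assoc, hm', smul_comm]

theorem Stabilizes.add (hA : IsLattice R A) (hM : IsLattice R M) (hx : Stabilizes x M)
    (hy : Stabilizes y M) : Stabilizes (x + y) M := by
  obtain ⟨r, hr, a, ha⟩ := exists_smul_eq_toHull A x
  obtain ⟨s, hs, b, hb⟩ := exists_smul_eq_toHull A y
  refine ⟨r * s, mul_mem hr hs, s • a + r • b, ?_, fun m => ?_⟩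
  · rw [map_add, LinearMap.map_smul_of_tower, LinearMap.map_smul_of_tower, ← ha, ← hb, smul_add,
      smul_smul, smul_smul, mul_comm s r]
  · obtain ⟨m₁, h₁⟩ := hx.exists_forall hA hM m
    obtain ⟨m₂, h₂⟩ := hy.exists_forall hA hM m
    refine ⟨m₁ + m₂, ?_⟩
    rw [add_smul, smul_assoc, smul_assoc, h₁ r hr a ha, h₂ s hs b hb, smul_add, smul_smul,
      smul_smul, mul_comm s r]

theorem Stabilizes.mul (hA : IsLattice R A) (hM : IsLattice R M) (hx : Stabilizes x M)
    (hy : Stabilizes y M) : Stabilizes (x * y) M := by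
  obtain ⟨r, hr, a, ha⟩ := exists_smul_eq_toHull A x
  obtain ⟨s, hs, b, hb⟩ := exists_smul_eq_toHull A y
  refine ⟨r * s, mul_mem hr hs, a * b, ?_, fun m => ?_⟩
  · rw [toHull_mul, ← ha, ← hb, hull_smul_mul_smul]
  · obtain ⟨m₂, h₂⟩ := hy.exists_forall hA hM m
    obtain ⟨m₁, h₁⟩ := hx.exists_forall hA hM m₂
    refine ⟨m₁, ?_⟩
    have : a • (s • m₂) = s • (a • m₂) := smul_comm _ _ _
    rw [mul_smul, h₂ s hs b hb, this, h₁ r hr a ha, smul_smul, mul_comm]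

omit [IsScalarTower R A M] in
theorem stabilizes_toHull (a : A) : Stabilizes (toHull R A A a) M :=
  ⟨1, one_mem _, a, one_smul _ _, fun m => ⟨a • m, (one_smul _ _).symm⟩⟩

theorem Stabilizes.of_isSummand (h : Stabilizes x M) (hN : IsSummand A N M) :
    Stabilizes x N := by
  obtain ⟨r, hr, a, ha, h⟩ := h
  obtain ⟨i, p, hip⟩ := hN
  refine ⟨r, hr, a, ha, fun n => ?_⟩
  obtain ⟨m', hm'⟩ := h (i n)
  refine ⟨p m', ?_⟩
  have h1 : p (i n) = n := LinearMap.congr_fun hip n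
  rw [← LinearMap.map_smul_of_tower, ← hm', map_smul, h1]

theorem Stabilizes.congr (e : N ≃ₗ[A] M) (h : Stabilizes x M) : Stabilizes x N :=
  h.of_isSummand (.of_linearEquiv e)

/-- The action of `x` on a submodule of `KA` that it stabilizes is the multiplication of `KA`. -/
theorem Stabilizes.mul_mem {T : Submodule A (Hull R A)} (h : Stabilizes x T) {b : A}
    (hb : toHull R A A b ∈ T) : x * toHull R A A b ∈ T := by
  obtain ⟨r, hr, a, ha, h⟩ := h
  obtain ⟨t, ht⟩ := h ⟨_, hb⟩
  have h1 : a • toHull R A A b = r • (t : Hull R A) := congrArg Subtype.val ht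
  have h2 : x * toHull R A A b = t := (isRational_hull R A r hr).1 (by
    change r • (x * toHull R A A b) = r • (t : Hull R A)
    rw [← h1, ← smul_mul_assoc, ha, toHull_mul_eq_smul])
  exact h2 ▸ t.2

end Stabilizes

/-! ### Overrings and their lattices -/

section Overring

variable {R A : Type u} [CommRing R] [Ring A] [Algebra R A] (A' : Overring R A)

theorem Overring.toKA_injective : Function.Injective A'.toKA := Subtype.val_injective

theorem Overring.toKA_incl (a : A) : A'.toKA (A'.incl a) = toHull R A A a := rfl

theorem Overring.toHull_mem (a : A) : toHull R A A a ∈ A'.alg := A'.le ⟨a, rfl⟩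

theorem Overring.exists_smul_eq_incl (y : A'.Carrier) :
    ∃ r ∈ nonZeroDivisors R, ∃ a : A, r • y = A'.incl a := by
  obtain ⟨r, hr, a, ha⟩ := exists_smul_eq_toHull A (A'.toKA y)
  exact ⟨r, hr, a, A'.toKA_injective (by rw [map_smul, ha, A'.toKA_incl])⟩

theorem Overring.isLattice : IsLattice R A'.Carrier := A'.isOrder.1

variable {M : Type*} [AddCommGroup M] [Module R M] [Module A M] [IsScalarTower R A M]

/-- An `A`-lattice is an `A'`-lattice if and only if all elements of `A'` stabilize it. -/
theorem Overring.actsOn_iff (hA : IsLattice R A) (hM : IsLattice R M) :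
    A'.ActsOn M ↔ ∀ x ∈ A'.alg, Stabilizes x M := by
  constructor
  · rintro ⟨φ, hφ⟩ x hx
    obtain ⟨r, hr, a, ha⟩ := exists_smul_eq_toHull A x
    let y : A'.Carrier := ⟨x, hx⟩
    have hy : r • y = A'.incl a := A'.toKA_injective (by
      rw [map_smul, A'.toKA_incl, ← ha]
      rfl)
    refine ⟨r, hr, a, ha, fun m => ⟨φ y m, ?_⟩⟩
    have h1 := LinearMap.congr_fun (AlgHom.congr_fun hφ a) m
    rw [← LinearMap.smul_apply, ← map_smul, hy]
    exact h1.symm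
  · intro h
    choose f hf using fun (y : A'.Carrier) (m : M) =>
      (h (A'.toKA y) (Subtype.prop _)).exists_forall hA hM m
    have hf' : ∀ (y : A'.Carrier) (m : M), ∀ r ∈ nonZeroDivisors R, ∀ a : A,
        r • y = A'.incl a → a • m = r • f y m := fun y m r hr a ha =>
      hf y m r hr a (by rw [← map_smul, ha, A'.toKA_incl])
    have hadd : ∀ y m m', f y (m + m') = f y m + f y m' := fun y m m' => by
      obtain ⟨r, hr, a, ha⟩ := A'.exists_smul_eq_incl y
      refine hM.smul_cancel hr ?_
      rw [smul_add, ← hf' _ _ r hr a ha, ← hf' _ _ r hr a ha, ← hf' _ _ r hr a ha, smul_add]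
    have hsmul : ∀ y (c : R) m, f y (c • m) = c • f y m := fun y c m => by
      obtain ⟨r, hr, a, ha⟩ := A'.exists_smul_eq_incl y
      refine hM.smul_cancel hr ?_
      rw [smul_comm r c, ← hf' _ _ r hr a ha, ← hf' _ _ r hr a ha, smul_comm]
    have hincl : ∀ a m, f (A'.incl a) m = a • m := fun a m => by
      have := hf' (A'.incl a) m 1 (one_mem _) a (one_smul _ _)
      rw [this, one_smul]
    have hadd' : ∀ y z m, f (y + z) m = f y m + f z m := fun y z m => by
      obtain ⟨r, hr, a, ha⟩ := A'.exists_smul_eq_incl y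
      obtain ⟨s, hs, b, hb⟩ := A'.exists_smul_eq_incl z
      have h1 : (r * s) • (y + z) = A'.incl (s • a + r • b) := by
        rw [map_add, map_smul, map_smul, ← ha, ← hb, smul_add, smul_smul, smul_smul, mul_comm s r]
      refine hM.smul_cancel (mul_mem hr hs) ?_
      rw [← hf' _ _ _ (mul_mem hr hs) _ h1, add_smul, smul_assoc, smul_assoc, hf' _ m r hr a ha,
        hf' _ m s hs b hb, smul_add, smul_smul, smul_smul, mul_comm s r]
    have hmul : ∀ y z m, f (y * z) m = f y (f z m) := fun y z m => by
      obtain ⟨r, hr, a, ha⟩ := A'.exists_smul_eq_incl y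
      obtain ⟨s, hs, b, hb⟩ := A'.exists_smul_eq_incl z
      have h1 : (r * s) • (y * z) = A'.incl (a * b) := by
        rw [map_mul, ← ha, ← hb, smul_mul_smul_comm]
      refine hM.smul_cancel (mul_mem hr hs) ?_
      have h2 : a • (s • f z m) = s • (a • f z m) := smul_comm _ _ _
      rw [← hf' _ _ _ (mul_mem hr hs) _ h1, mul_smul, hf' _ m s hs b hb, h2, hf' _ _ r hr a ha,
        smul_smul, mul_comm]
    let φ : A'.Carrier →ₐ[R] Module.End R M := AlgHom.ofLinearMap
      { toFun y := { toFun := f y, map_add' := hadd y, map_smul' := hsmul y }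
        map_add' y z := LinearMap.ext fun m => hadd' y z m
        map_smul' c y := LinearMap.ext fun m => by
          change f (c • y) m = c • f y m
          rw [Algebra.smul_def, hmul, ← A'.incl.commutes c, hincl, algebraMap_smul] }
      (LinearMap.ext fun m => by
        change f 1 m = m
        rw [← map_one A'.incl, hincl, one_smul])
      (fun y z => LinearMap.ext fun m => hmul y z m)
    exact ⟨φ, AlgHom.ext fun a => LinearMap.ext fun m => hincl a m⟩

end Overring

/-! ### The overring obtained by rejection -/

section Rejection

variable {R A B : Type u} [CommRing R] [Ring A] [Algebra R A]
  [AddCommGroup B] [Module R B] [Module A B] [IsScalarTower R A B]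

/-- The set of all `x ∈ KA` that map every lattice without summands in common with copies of `B`
to itself.  This is the underlying algebra of `A⁻(B)`. -/
def rejectionAlg (B : Type u) [AddCommGroup B] [Module A B] (hA : IsLattice R A) :
    Subalgebra R (Hull R A) where
  carrier := {x | ∀ (M : Type u) [AddCommGroup M] [Module R M] [Module A M] [IsScalarTower R A M],
    IsLattice R M → HasNoSummand A B M → Stabilizes x M}
  mul_mem' hx hy M _ _ _ _ hM hMB := (hx M hM hMB).mul hA hM (hy M hM hMB)
  add_mem' hx hy M _ _ _ _ hM hMB := (hx M hM hMB).add hA hM (hy M hM hMB)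
  algebraMap_mem' r _ _ _ _ _ _ _ := stabilizes_toHull (algebraMap R A r)

omit [Module R B] [IsScalarTower R A B] in
/-- A coefficient of an element of `P^{+,B}` with respect to a map `P → A` lies in `A⁻(B)`. -/
theorem mem_rejectionAlg_of_extension {hA : IsLattice R A} {V : Type u} [AddCommGroup V]
    [Module R V] [Module A V] [IsScalarTower R A V] {P U : Submodule A V}
    (hext : ∀ (N : Type u) [AddCommGroup N] [Module R N] [Module A N] [IsScalarTower R A N],
        IsLattice R N → HasNoSummand A B N → ∀ φ : P →ₗ[A] N,
          ∃ ψ : U →ₗ[A] N, ∀ (m : V) (hm : m ∈ P) (hm' : m ∈ U), ψ ⟨m, hm'⟩ = φ ⟨m, hm⟩)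
    (hPU : P ≤ U) (φ : P →ₗ[A] A) {r : R} (hr : r ∈ nonZeroDivisors R) (p : P) (u : U)
    (hu : r • (u : V) = p) {y : Hull R A} (hy : r • y = toHull R A A (φ p)) :
    y ∈ rejectionAlg B hA := by
  intro N _ _ _ _ hN hNB
  refine ⟨r, hr, φ p, hy, fun n => ?_⟩
  obtain ⟨ψ, hψ⟩ := hext N hN hNB (LinearMap.toSpanSingleton A N n ∘ₗ φ)
  refine ⟨ψ u, ?_⟩
  have h1 : r • u = ⟨p, hPU p.2⟩ := Subtype.ext hu
  rw [← LinearMap.map_smul_of_tower, h1, hψ p p.2]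
  rfl

variable [IsLocalRing R] [IsNoetherianRing R] [IsReduced R]
  [IsAdicComplete (IsLocalRing.maximalIdeal R) R]

/-- The product of `A⁻(B)` with an indecomposable left ideal `P` of `A` lies in `P^{+,B}`, so
`A⁻(B)` is finitely generated. -/
theorem finite_rejectionAlg (hdim : ringKrullDim R = 1) (hA : IsOrder R A)
    (hconn : IsConnectedRing A) (hher : ¬ IsHereditary A) (hB : IsBijective R A B) :
    Module.Finite R (rejectionAlg B hA.1) := by
  have := hA.1.1
  have : IsNoetherian A A := hA.1.isNoetherian
  obtain ⟨F, hF, h⟩ := induction_isIndecomposable (A := A) (M := A)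
    (fun X => ∃ F : Submodule R (Hull R A), F.FG ∧
      ∀ x ∈ rejectionAlg B hA.1, ∀ b ∈ X, x * toHull R A A b ∈ F)
    ⟨⊥, Submodule.fg_bot, fun x _ b hb => by
      rw [(Submodule.mem_bot A).mp hb, map_zero, mul_zero]
      exact zero_mem _⟩
    (fun X Y ⟨F, hF, hX⟩ ⟨G, hG, hY⟩ => ⟨F ⊔ G, hF.sup hG, fun x hx b hb => by
      obtain ⟨b', hb', c, hc, rfl⟩ := Submodule.mem_sup.mp hb
      rw [map_add, mul_add]
      exact Submodule.add_mem_sup (hX x hx b' hb') (hY x hx c hc)⟩)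
    (fun P hP => by
      obtain ⟨U, -, hU, hUB, -, -⟩ := exists_isPlus (B := B) hdim hA.2 hconn hher
        (isRational_hull R A) hB (hP.congr (equivMapToHull hA.1 P).symm)
        (finite_map_toHull hA.1 P)
      exact ⟨U.restrictScalars R, Module.Finite.iff_fg.mp hU.isLattice.1, fun x hx b hb =>
        (hx U hU.isLattice hUB).mul_mem (hU.le ⟨b, hb, rfl⟩)⟩)
  have : Module.Finite R F := Module.Finite.iff_fg.mpr hF
  have hle : Subalgebra.toSubmodule (rejectionAlg B hA.1) ≤ F := fun x hx => by
    have h1 := h x hx 1 Submodule.mem_top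
    have h2 : toHull R A A 1 = 1 := rfl
    rwa [h2, mul_one] at h1
  have hN : IsNoetherian R F := isNoetherian_of_isNoetherianRing_of_finite R F
  exact Module.Finite.of_injective (Submodule.inclusion hle) (Submodule.inclusion_injective hle)

omit [Module R B] [IsScalarTower R A B] [IsLocalRing R] [IsNoetherianRing R] [IsReduced R]
  [IsAdicComplete (IsLocalRing.maximalIdeal R) R] in
theorem toHull_mem_rejectionAlg {hA : IsLattice R A} (a : A) :
    toHull R A A a ∈ rejectionAlg B hA :=
  fun _ _ _ _ _ _ _ => stabilizes_toHull a

/-- Contraction of nilpotent ideals to a semiprime ring. -/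
theorem eq_zero_of_map_mem_of_pow_eq_bot {C : Type*} [Ring C]
    (hA : ∀ I : Ideal A, I.IsTwoSided → (∃ n : ℕ, I ^ n = ⊥) → I = ⊥) {f : A →+* C}
    (hf : Function.Injective f) {I : Ideal C} (hI : I.IsTwoSided) {n : ℕ} (hn : I ^ n = ⊥)
    {a : A} (ha : f a ∈ I) : a = 0 := by
  have hpow : ∀ k, ∀ x ∈ I.comap f ^ k, f x ∈ I ^ k := by
    intro k
    induction k with
    | zero => exact fun x _ => by simp [Submodule.pow_zero]
    | succ k ih =>
      intro x hx
      rw [Ideal.IsTwoSided.pow_succ] at hx ⊢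
      have : I.comap f * I.comap f ^ k ≤ (I * I ^ k).comap f := Ideal.mul_le.mpr fun y hy z hz => by
        rw [Ideal.mem_comap, map_mul]
        exact Ideal.mul_mem_mul hy (ih z hz)
      exact this hx
  have h0 := hA (I.comap f) inferInstance ⟨n, (Submodule.eq_bot_iff _).mpr fun x hx => by
    have h1 := hpow n x hx
    rw [hn, Submodule.mem_bot] at h1
    exact hf (h1.trans (map_zero f).symm)⟩
  have h1 : a ∈ I.comap f := ha
  rwa [h0, Submodule.mem_bot] at h1

theorem isOrder_rejectionAlg (hdim : ringKrullDim R = 1) (hA : IsOrder R A)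
    (hconn : IsConnectedRing A) (hher : ¬ IsHereditary A) (hB : IsBijective R A B) :
    IsOrder R (rejectionAlg B hA.1) := by
  refine ⟨(isRational_hull R A).isLattice (Subalgebra.toSubmodule (rejectionAlg B hA.1))
    (finite_rejectionAlg hdim hA hconn hher hB), ?_⟩
  rintro I hI ⟨n, hn⟩
  let ι : A →+* rejectionAlg B hA.1 :=
    (Algebra.TensorProduct.includeLeft : A →ₐ[R] A ⊗[R] FractionRing R).toRingHom.codRestrict
      (rejectionAlg B hA.1) toHull_mem_rejectionAlg
  have hinj : Function.Injective ι := fun x y hxy =>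
    toHull_injective (A := A) hA.1 (congrArg Subtype.val hxy)
  rw [Submodule.eq_bot_iff]
  intro x hx
  obtain ⟨r, hr, a, ha⟩ := exists_smul_eq_toHull A (x : Hull R A)
  have h1 : r • x = ι a := Subtype.ext ha
  have h2 : a = 0 := eq_zero_of_map_mem_of_pow_eq_bot hA.2 hinj hI hn
    (h1 ▸ I.smul_of_tower_mem r hx)
  rw [h2, map_zero] at ha
  exact Subtype.ext ((isRational_hull R A).eq_zero hr ha)

/-- The overring `A⁻(B)`. -/
def rejection (hdim : ringKrullDim R = 1) (hA : IsOrder R A)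
    (hconn : IsConnectedRing A) (hher : ¬ IsHereditary A) (hB : IsBijective R A B) :
    Overring R A where
  alg := rejectionAlg B hA.1
  le := by
    rintro _ ⟨a, rfl⟩
    exact toHull_mem_rejectionAlg a
  isOrder := isOrder_rejectionAlg hdim hA hconn hher hB

/-- No nonzero lattice that is stabilized by `A⁻(B)` is a summand of copies of `B`: otherwise
there is an indecomposable one, `X`, and the coefficients in a dual basis of `X` of the elements
of `X^{+,B}` lie in `A⁻(B)`, so that `X^{+,B} = X`. -/
theorem subsingleton_of_stabilizes (hdim : ringKrullDim R = 1) (hA : IsOrder R A)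
    (hconn : IsConnectedRing A) (hher : ¬ IsHereditary A) (hB : IsBijective R A B)
    {M : Type u} [AddCommGroup M] [Module R M] [Module A M] [IsScalarTower R A M]
    (hM : IsLattice R M) (h : ∀ x ∈ rejectionAlg B hA.1, Stabilizes x M)
    (hMB : IsSummandOfPow A M B) : Subsingleton M := by
  have := hA.1.1
  by_contra hcon
  rw [not_subsingleton_iff_nontrivial] at hcon
  have : IsNoetherian A M := hM.isNoetherian
  obtain ⟨X, Y, hXY, hX⟩ := exists_isCompl_isIndecomposable A M
  have hXM : IsSummand A X M := .of_isCompl hXY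
  have hXB : IsSummandOfPow A X B := hMB.of_isSummand hXM
  have hXL : IsLattice R X := hM.submodule X
  have := hB.1
  have hproj : Module.Projective A X := hXB.projective
  let e : X ≃ₗ[A] (⊤ : Submodule A X).map (toHull R A X) :=
    Submodule.topEquiv.symm.trans (equivMapToHull hXL ⊤)
  obtain ⟨U, -, hU, -, hext, hne⟩ := exists_isPlus (B := B) hdim hA.2 hconn hher
    (isRational_hull R X) hB (hX.congr e.symm) (finite_map_toHull hXL ⊤)
  refine hne (hXB.congr e.symm) (hU.le.antisymm fun u hu => ?_)
  obtain ⟨r, hr, x, hx⟩ := exists_smul_eq_toHull A u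
  -- `u = x / r`; with a dual basis, `x = ∑ s x z • z`, and all `s x z / r` act on `X`
  obtain ⟨s, hs⟩ := Module.projective_def.mp hproj
  have hcoef : ∀ z ∈ (s x).support, ∃ z' : X, s x z • z = r • z' := by
    intro z _
    obtain ⟨y, hy⟩ := (isRational_hull R A r hr).2 (toHull R A A (s x z))
    have hyA : y ∈ rejectionAlg B hA.1 := mem_rejectionAlg_of_extension hext hU.le
      ((Finsupp.lapply z ∘ₗ s) ∘ₗ e.symm.toLinearMap) hr (e x) ⟨u, hu⟩ hx (by
        refine Eq.trans hy ?_
        simp)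
    obtain ⟨z', hz'⟩ := ((h y hyA).of_isSummand hXM).exists_forall hA.1 hXL z
    exact ⟨z', hz' r hr _ hy⟩
  choose! f hf using hcoef
  refine ⟨∑ z ∈ (s x).support, f z, Submodule.mem_top, (isRational_hull R X r hr).1 ?_⟩
  change r • toHull R A X _ = r • u
  rw [hx, ← LinearMap.map_smul_of_tower, Finset.smul_sum]
  congr 1
  conv_rhs => rw [← hs x, Finsupp.linearCombination_apply, Finsupp.sum]
  exact Finset.sum_congr rfl fun z hz => (hf z hz).symm

omit [Module R B] [IsScalarTower R A B] [IsLocalRing R] [IsReduced R]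
  [IsAdicComplete (IsLocalRing.maximalIdeal R) R] in
/-- A lattice over an overring obtained by rejection of `B` has no summands from `B`. -/
theorem IsRejection.hasNoSummand {A'' : Overring R A} (hA : IsLattice R A)
    (h : IsRejection B A'') {M : Type u} [AddCommGroup M] [Module R M] [Module A M]
    [IsScalarTower R A M] (hM : IsLattice R M) (hMA : ∀ x ∈ A''.alg, Stabilizes x M) :
    HasNoSummand A B M := by
  intro X Y hXY hX
  have := h.2 X (hM.submodule X)
    ((A''.actsOn_iff hA (hM.submodule X)).mpr fun x hx => (hMA x hx).of_isSummand (.of_isCompl hXY))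
    hX
  exact Submodule.subsingleton_iff_eq_bot.mp this

theorem isRejection_rejection (hdim : ringKrullDim R = 1) (hA : IsOrder R A)
    (hconn : IsConnectedRing A) (hher : ¬ IsHereditary A) (hB : IsBijective R A B) :
    IsRejection B (rejection hdim hA hconn hher hB) := by
  constructor
  · intro M _ _ _ _ hM
    have : IsNoetherian A M := hM.isNoetherian
    obtain ⟨B', M', hc, hB', hM'⟩ := exists_isCompl_hasNoSummand (A := A) (B := B) (M := M)
    exact ⟨B', M', hc, hB', (Overring.actsOn_iff _ hA.1 (hM.submodule M')).mpr fun x hx =>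
      hx M' (hM.submodule M') hM'⟩
  · intro M _ _ _ _ hM hMA hMB
    exact subsingleton_of_stabilizes hdim hA hconn hher hB hM
      ((Overring.actsOn_iff _ hA.1 hM).mp hMA) hMB

/-- There is only one overring obtained by rejection of `B`.  An overring with that property acts
on all lattices without summands in common with copies of `B`, and is itself such a lattice. -/
theorem IsRejection.eq_rejection (hdim : ringKrullDim R = 1) (hA : IsOrder R A)
    (hconn : IsConnectedRing A) (hher : ¬ IsHereditary A) (hB : IsBijective R A B)
    {A'' : Overring R A} (h : IsRejection B A'') : A'' = rejection hdim hA hconn hher hB := by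
  refine Overring.ext (le_antisymm (fun x hx => ?_) fun x hx => ?_)
  · intro M _ _ _ _ hM hMB
    obtain ⟨B', M', hc, hB', hM'⟩ := h.1 M hM
    have hbot : B' = ⊥ := hMB B' M' hc hB'
    subst hbot
    have htop : M' = ⊤ := eq_top_of_bot_isCompl hc
    subst htop
    exact ((A''.actsOn_iff hA.1 (hM.submodule ⊤)).mp hM' x hx).congr Submodule.topEquiv.symm
  · -- `A''` as an `A`-lattice in `KA`; `x ∈ A⁻(B)` maps `1 ∈ A''` into it
    let T : Submodule A (Hull R A) :=
      { (Subalgebra.toSubmodule A''.alg) with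
        smul_mem' := fun a y hy => by
          rw [← toHull_mul_eq_smul]
          exact A''.alg.mul_mem (A''.toHull_mem a) hy }
    have hT : IsLattice R T := A''.isOrder.1
    have hTB : HasNoSummand A B T := h.hasNoSummand hA.1 hT fun y hy => by
      obtain ⟨r, hr, a, ha⟩ := exists_smul_eq_toHull A y
      refine ⟨r, hr, a, ha, fun t => ⟨⟨y * t, A''.alg.mul_mem hy t.2⟩, Subtype.ext ?_⟩⟩
      change a • (t : Hull R A) = r • (y * t)
      rw [← toHull_mul_eq_smul, ← ha, smul_mul_assoc]
    have h1 : x * toHull R A A 1 ∈ T := (hx T hT hTB).mul_mem (A''.toHull_mem 1)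
    have h2 : toHull R A A 1 = 1 := rfl
    rwa [h2, mul_one] at h1

end Rejection

/-! ### Principal modules of the overring -/

section Principal

variable {R A B : Type u} [CommRing R] [Ring A] [Algebra R A]
  [AddCommGroup B] [Module R B] [Module A B] [IsScalarTower R A B]
  [IsLocalRing R] [IsNoetherianRing R] [IsReduced R]
  [IsAdicComplete (IsLocalRing.maximalIdeal R) R]

omit [IsReduced R] in
/-- A principal module is a summand of one of the terms of a decomposition of the ring. -/
theorem IsIndecomposable.exists_isSummand_of_projective {C X : Type*} [Ring C] [Algebra R C]
    [Module.Finite R C] [AddCommGroup X] [Module C X] [Module.Finite C X] [Module.Projective C X]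
    (hX : IsIndecomposable C X) {n : ℕ} {Q : Fin n → Submodule C C}
    (hQ : DirectSum.IsInternal Q) : ∃ i, IsSummand C X (Q i) := by
  let _ : Module R X := Module.compHom X (algebraMap R C)
  have : IsScalarTower R C X := ⟨fun r c x => by
    rw [Algebra.smul_def, mul_smul]
    rfl⟩
  have : Module.Finite R X := Module.Finite.trans C X
  obtain ⟨m, q, hq⟩ := Module.Finite.exists_fin' C X
  obtain ⟨i, hi⟩ := Module.projective_lifting_property q LinearMap.id hq
  exact hX.exists_isSummand R hQ ⟨i, q, hi⟩

/-- If `A = ⨁ P i`, then `A⁻(B) = ⨁ (P i)^{+,B}`: the summand of `A⁻(B)` that is cut out by the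
idempotent belonging to `P i` is `(P i)^{+,B}`. -/
theorem exists_isInternal_isPlus (hdim : ringKrullDim R = 1) (hA : IsOrder R A)
    (hconn : IsConnectedRing A) (hher : ¬ IsHereditary A) (hB : IsBijective R A B)
    {A' : Overring R A} (hA' : A'.alg = rejectionAlg B hA.1) {n : ℕ} {P : Fin n → Submodule A A}
    (hP : DirectSum.IsInternal P) (hPi : ∀ i, IsIndecomposable A (P i)) :
    ∃ Q : Fin n → Submodule A'.Carrier A'.Carrier, DirectSum.IsInternal Q ∧
      (∀ i (N : Submodule A (Hull R A)),
        IsPlus R B ((P i).map (toHull R A A)) N ↔ N = A'.idealToHull (Q i)) ∧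
      ∀ i, Module.Projective A'.Carrier (Q i) := by
  have := hA.1.1
  obtain ⟨π, hπP, hπsum, hπsame, hπne⟩ := exists_projections hP
  let e : Fin n → A := fun k => π k 1
  have hπe : ∀ k x, π k x = x * e k := fun k x => by
    rw [← smul_eq_mul, ← map_smul, smul_eq_mul, mul_one]
  have he : ∑ k, e k = 1 := hπsum 1
  have heP : ∀ k, e k ∈ P k := fun k => hπP k 1
  have hee : ∀ k, e k * e k = e k := fun k => by
    rw [← hπe]
    exact hπsame k _ (heP k)
  have hene : ∀ k j, j ≠ k → e j * e k = 0 := fun k j hjk => by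
    rw [← hπe]
    exact hπne k j hjk _ (heP j)
  let σ : Fin n → Module.End A'.Carrier A'.Carrier := fun k =>
    LinearMap.toSpanSingleton A'.Carrier A'.Carrier (A'.incl (e k))
  have hσ : ∀ k y, σ k y = y * A'.incl (e k) := fun _ _ => rfl
  let Q : Fin n → Submodule A'.Carrier A'.Carrier := fun k => LinearMap.range (σ k)
  have hσQ : ∀ k, ∀ y ∈ Q k, σ k y = y := by
    rintro k _ ⟨y, rfl⟩
    rw [hσ, hσ, mul_assoc, ← map_mul, hee]
  refine ⟨Q, isInternal_of_projections σ (fun k y => ⟨y, rfl⟩) (fun y => ?_) ?_, fun i N => ?_,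
    fun i => ?_⟩
  · simp only [hσ]
    rw [← Finset.mul_sum, ← map_sum, he, map_one, mul_one]
  · rintro k j hjk _ ⟨y, rfl⟩
    rw [hσ, hσ, mul_assoc, ← map_mul, hene k j hjk, map_zero, mul_zero]
  · obtain ⟨U, hplus, hU, hUB, hext, -⟩ := exists_isPlus (B := B) hdim hA.2 hconn hher
      (isRational_hull R A) hB ((hPi i).congr (equivMapToHull hA.1 (P i)).symm)
      (finite_map_toHull hA.1 (P i))
    have hUQ : U = A'.idealToHull (Q i) := by
      refine le_antisymm (fun u hu => ?_) ?_
      · -- the inclusion `P i → A` shows that `u = p / r` lies in `A⁻(B)`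
        obtain ⟨r, hr, hru⟩ := hU.exists_smul_mem u hu
        obtain ⟨p, hp, hpu⟩ := hru
        have hpu : toHull R A A p = r • u := hpu
        have huA : u ∈ A'.alg := by
          rw [hA']
          refine mem_rejectionAlg_of_extension hext hU.le
            ((P i).subtype ∘ₗ (equivMapToHull hA.1 (P i)).symm.toLinearMap) hr
            (equivMapToHull hA.1 (P i) ⟨p, hp⟩) ⟨u, hu⟩ hpu.symm ?_
          rw [← hpu]
          simp
        let y : A'.Carrier := ⟨u, huA⟩
        have hy : r • y = A'.incl p := A'.toKA_injective (by
          rw [map_smul, A'.toKA_incl, hpu]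
          rfl)
        refine ⟨y, ⟨y, A'.isLattice.smul_cancel hr ?_⟩, rfl⟩
        rw [hσ, ← smul_mul_assoc, hy, ← map_mul, ← hπe, hπsame i p hp]
      · rintro _ ⟨_, ⟨y, rfl⟩, rfl⟩
        have hy : A'.toKA y ∈ rejectionAlg B hA.1 := hA' ▸ Subtype.prop y
        exact (hy U hU.isLattice hUB).mul_mem (hU.le ⟨e i, heP i, rfl⟩)
    rw [hplus, hUQ]
  · exact Module.Projective.of_split (Q i).subtype (σ i).rangeRestrict
      (LinearMap.ext fun y => Subtype.ext (hσQ i y y.2))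

end Principal

/-! ### Maps into the dual of an order -/

section OmegaLift

variable {R C W : Type u} [CommRing R] [Ring C] [Algebra R C] [AddCommGroup W] [Module R W]

/-- An element of `ω_C`, seen as a linear map. -/
noncomputable def Omega.toLin : Omega R C W ≃ₗ[R] (C →ₗ[R] W) := LinearEquiv.refl R (C →ₗ[R] W)

/-- Evaluation at `1`, the universal `R`-linear map from `ω_C` to `W`. -/
noncomputable def Omega.evalOne : Omega R C W →ₗ[R] W := LinearMap.applyₗ 1 ∘ₗ Omega.toLin.toLinearMap

theorem Omega.evalOne_smul (c : C) (f : Omega R C W) :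
    Omega.evalOne (c • f) = Omega.toLin f c :=
  congrArg (Omega.toLin f) (one_mul c)

theorem Omega.ext_evalOne {f g : Omega R C W}
    (h : ∀ c : C, Omega.evalOne (c • f) = Omega.evalOne (c • g)) : f = g :=
  LinearMap.ext fun c => by
    have := h c
    rwa [Omega.evalOne_smul, Omega.evalOne_smul] at this

variable {M : Type*} [AddCommGroup M] [Module R M] [Module C M] [IsScalarTower R C M]

/-- The `C`-linear map `M → ω_C` that belongs to an `R`-linear map `M → W`. -/
noncomputable def Omega.lift (g : M →ₗ[R] W) : M →ₗ[C] Omega R C W where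
  toFun m := g ∘ₗ (LinearMap.toSpanSingleton C M m).restrictScalars R
  map_add' m m' := LinearMap.ext fun c => by
    change g (c • (m + m')) = g (c • m) + g (c • m')
    rw [smul_add, map_add]
  map_smul' c m := LinearMap.ext fun d => by
    change g (d • c • m) = g ((d * c) • m)
    rw [mul_smul]

theorem Omega.evalOne_lift (g : M →ₗ[R] W) (m : M) :
    Omega.evalOne (Omega.lift (C := C) g m) = g m :=
  congrArg g (one_smul C m)

variable [IsLocalRing R] [IsNoetherianRing R] [IsReduced R]

omit [IsLocalRing R] [IsReduced R] in
theorem isLattice_omega (hC : Module.Finite R C) (hW : IsLattice R W) :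
    IsLattice R (Omega R C W) := by
  have := hW.1
  refine ⟨.equiv (Omega.toLin (R := R) (C := C) (W := W)).symm, isTorsionFree_iff.mpr
    fun r hr f hf => LinearMap.ext fun c => hW.eq_zero hr (LinearMap.congr_fun hf c)⟩

/-- The module `ω_C` inherits the extension property from the canonical module. -/
theorem hasExtension_omega (hdim : ringKrullDim R = 1) (hW : IsCanonicalModule R W) :
    HasExtension R C (Omega R C W) := by
  intro N _ _ _ _ hN X hX f
  obtain ⟨g, hg⟩ := hW.exists_extension hdim hN (X := X.restrictScalars R) hX
    (Omega.evalOne ∘ₗ f.restrictScalars R)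
  refine ⟨Omega.lift g, fun x => Omega.ext_evalOne fun c => ?_⟩
  rw [← map_smul, ← map_smul, Omega.evalOne_lift]
  exact hg (c • x)

/-- Every lattice embeds as a saturated submodule into a power of `ω_C`: collect the maps that
belong to generators of `Hom_R(X, W)`.  Hence an L-injective lattice is a summand of such a
power. -/
theorem IsLInjective.exists_isSummand_omega (hdim : ringKrullDim R = 1)
    (hC : Module.Finite R C) (hW : IsCanonicalModule R W)
    {X : Type u} [AddCommGroup X] [Module R X] [Module C X] [IsScalarTower R C X]
    (hX : IsLInjective R C X) : ∃ r : ℕ, IsSummand C X (Fin r → Omega R C W) := by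
  have := hX.1.1
  have := hW.1.1
  obtain ⟨r, s, hs⟩ := Module.Finite.exists_fin (R := R) (M := X →ₗ[R] W)
  let F : X →ₗ[C] (Fin r → Omega R C W) := LinearMap.pi fun j => Omega.lift (s j)
  have hF : ∀ x j, Omega.evalOne (F x j) = s j x := fun x j => Omega.evalOne_lift _ _
  have hL : IsLattice R (Fin r → Omega R C W) := .pi fun _ => isLattice_omega hC hW.1
  have hinj : Function.Injective F := by
    rw [injective_iff_map_eq_zero]
    intro x hx
    refine hW.eq_zero_of_forall hdim hX.1 fun f => ?_
    have hf : f ∈ Submodule.span R (Set.range s) := hs ▸ Submodule.mem_top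
    induction hf using Submodule.span_induction with
    | mem f hf =>
      obtain ⟨j, rfl⟩ := hf
      rw [← hF, hx, Pi.zero_apply, map_zero]
    | zero => rfl
    | add f g _ _ hf hg => rw [LinearMap.add_apply, hf, hg, add_zero]
    | smul c f _ hf => rw [LinearMap.smul_apply, hf, smul_zero]
  have hsat : IsSaturated R (LinearMap.range F) := by
    rintro c hc w ⟨x, hx⟩
    obtain ⟨z, rfl⟩ := hW.exists_eq_smul hdim hX.1 hc (x := x) fun f => by
      have hf : f ∈ Submodule.span R (Set.range s) := hs ▸ Submodule.mem_top
      induction hf using Submodule.span_induction with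
      | mem f hf =>
        obtain ⟨j, rfl⟩ := hf
        exact ⟨Omega.evalOne (w j), by rw [← hF, hx, Pi.smul_apply, map_smul]⟩
      | zero => exact ⟨0, by rw [smul_zero, LinearMap.zero_apply]⟩
      | add f g _ _ hf hg =>
        obtain ⟨v, hv⟩ := hf
        obtain ⟨w, hw⟩ := hg
        exact ⟨v + w, by rw [LinearMap.add_apply, hv, hw, smul_add]⟩
      | smul d f _ hf =>
        obtain ⟨v, hv⟩ := hf
        exact ⟨d • v, by rw [LinearMap.smul_apply, hv, smul_comm]⟩
    refine ⟨z, hL.smul_cancel hc ?_⟩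
    rw [← LinearMap.map_smul_of_tower, hx]
  let e := LinearEquiv.ofInjective F hinj
  obtain ⟨Y, hY⟩ := HasExtension.exists_isCompl hL hsat
    (hX.hasExtension.of_isSummand (.of_linearEquiv e.symm))
  exact ⟨r, (IsSummand.of_linearEquiv e).trans (.of_isCompl hY)⟩

end OmegaLift

/-! ### Coprincipal lattices of the overring -/

section Coprincipal

variable {R A W : Type u} [CommRing R] [Ring A] [Algebra R A] [AddCommGroup W] [Module R W]
  (A' : Overring R A)

theorem Overring.toLin_res (f : Omega R A'.Carrier W) (a : A) :
    Omega.toLin (A'.res f) a = Omega.toLin f (A'.incl a) := rfl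

theorem Overring.res_incl_smul (a : A) (f : Omega R A'.Carrier W) :
    A'.res (A'.incl a • f) = a • A'.res f :=
  LinearMap.ext fun b => congrArg (Omega.toLin f) (A'.incl.map_mul b a).symm

theorem Overring.res_injective (hW : IsLattice R W) :
    Function.Injective (A'.res : Omega R A'.Carrier W → Omega R A W) := by
  intro f g h
  refine LinearMap.ext fun y => ?_
  obtain ⟨r, hr, a, ha⟩ := A'.exists_smul_eq_incl y
  refine hW.smul_cancel hr ?_
  change r • Omega.toLin f y = r • Omega.toLin g y
  rw [← map_smul, ← map_smul, ha, ← A'.toLin_res, ← A'.toLin_res, h]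

/-- Restriction `ω_{A'} → ω_A` as a linear map. -/
noncomputable def Overring.resLin : Omega R A'.Carrier W →ₗ[R] Omega R A W where
  toFun := A'.res
  map_add' _ _ := rfl
  map_smul' _ _ := rfl

theorem Overring.resLin_apply (f : Omega R A'.Carrier W) : A'.resLin f = A'.res f := rfl

/-- An endomorphism of `ω_A` extends to one of `ω_{A'}`. -/
noncomputable def Overring.omegaEnd (π : Module.End A (Omega R A W)) :
    Module.End A'.Carrier (Omega R A'.Carrier W) :=
  Omega.lift (Omega.evalOne ∘ₗ π.restrictScalars R ∘ₗ A'.resLin)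

theorem Overring.res_omegaEnd (π : Module.End A (Omega R A W)) (f : Omega R A'.Carrier W) :
    A'.res (A'.omegaEnd π f) = π (A'.res f) := by
  refine LinearMap.ext fun a => ?_
  change Omega.evalOne (π (A'.res (A'.incl a • f))) = Omega.toLin (π (A'.res f)) a
  rw [A'.res_incl_smul, map_smul, Omega.evalOne_smul]

variable {B : Type u} [AddCommGroup B] [Module R B] [Module A B] [IsScalarTower R A B]
  [IsLocalRing R] [IsNoetherianRing R] [IsReduced R]
  [IsAdicComplete (IsLocalRing.maximalIdeal R) R]

/-- If `ω_A = ⨁ I i`, then `ω_{A'} = ⨁ (I i)^{-,B}` for `A' = A⁻(B)`.  The part `J i` of `ω_{A'}` that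
restricts into `I i` is the largest `A'`-lattice in `I i`, and `A'`-lattices are the lattices without
summands from `B`. -/
theorem exists_isInternal_isMinus (hdim : ringKrullDim R = 1) (hA : IsOrder R A)
    (hconn : IsConnectedRing A) (hher : ¬ IsHereditary A) (hB : IsBijective R A B)
    {A' : Overring R A} (hA' : A'.alg = rejectionAlg B hA.1) (hRej : IsRejection B A')
    (hW : IsLattice R W)
    {n : ℕ} {I : Fin n → Submodule A (Omega R A W)}
    (hI : DirectSum.IsInternal I) (hIi : ∀ i, IsIndecomposable A (I i)) :
    ∃ J : Fin n → Submodule A'.Carrier (Omega R A'.Carrier W), DirectSum.IsInternal J ∧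
      (∀ i (N : Submodule A (Hull R (Omega R A W))),
        IsMinus R B ((I i).map (toHull R A (Omega R A W))) N ↔ N = A'.omegaToHull (J i)) ∧
      ∀ i, IsSummand A'.Carrier (J i) (Omega R A'.Carrier W) := by
  have := hA.1.1
  have hΩ : IsLattice R (Omega R A W) := isLattice_omega hA.1.1 hW
  obtain ⟨π, hπI, hπsum, hπsame, hπne⟩ := exists_projections hI
  have hinj := A'.res_injective hW
  let J : Fin n → Submodule A'.Carrier (Omega R A'.Carrier W) := fun k =>
    LinearMap.range (A'.omegaEnd (π k))
  have hJ : ∀ k f, f ∈ J k ↔ A'.res f ∈ I k := fun k f => by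
    constructor
    · rintro ⟨f, rfl⟩
      rw [A'.res_omegaEnd]
      exact hπI k _
    · intro hf
      exact ⟨f, hinj (by rw [A'.res_omegaEnd, hπsame k _ hf])⟩
  have hJsame : ∀ k, ∀ f ∈ J k, A'.omegaEnd (π k) f = f := fun k f hf =>
    hinj (by rw [A'.res_omegaEnd, hπsame k _ ((hJ k f).mp hf)])
  refine ⟨J, isInternal_of_projections (fun k => A'.omegaEnd (π k)) (fun k f => ⟨f, rfl⟩)
    (fun f => hinj ?_) (fun k j hjk f hf => hinj ?_), fun i N => ?_,
    fun i => ⟨(J i).subtype, (A'.omegaEnd (π i)).rangeRestrict,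
      LinearMap.ext fun f => Subtype.ext (hJsame i f f.2)⟩⟩
  · rw [← A'.resLin_apply, map_sum]
    simp only [A'.resLin_apply, A'.res_omegaEnd]
    exact hπsum _
  · rw [A'.res_omegaEnd, hπne k j hjk _ ((hJ j f).mp hf)]
    rfl
  · obtain ⟨L, hminus, hL, hLB, hmax⟩ := exists_isMinus (B := B) hdim hA.2 hconn hher
      (isRational_hull R (Omega R A W)) hB ((hIi i).congr (equivMapToHull hΩ (I i)).symm)
    have hfin := finite_map_toHull hΩ (I i)
    have hMlat := (isRational_hull R (Omega R A W)).isLattice _ hfin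
    have hsubl : ∀ X : Submodule A (Hull R (Omega R A W)),
        X ≤ (I i).map (toHull R A (Omega R A W)) → IsLattice R X := fun X hX =>
      hMlat.of_injective ((Submodule.inclusion hX).restrictScalars R)
        (Submodule.inclusion_injective hX)
    have hLJ : L = A'.omegaToHull (J i) := by
      refine le_antisymm (fun v hv => ?_) ?_
      · -- `L` is an `A'`-lattice, so its elements extend from `A` to `A'`
        have hLlat := hsubl L hL
        obtain ⟨φ, hφ⟩ := (A'.actsOn_iff hA.1 hLlat).mpr fun x hx =>
          (hA' ▸ hx : x ∈ rejectionAlg B hA.1) L hLlat hLB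
        let g : L →ₗ[A] Omega R A W := (I i).subtype ∘ₗ
          (equivMapToHull hΩ (I i)).symm.toLinearMap ∘ₗ Submodule.inclusion hL
        have hg : ∀ x : L, toHull R A (Omega R A W) (g x) = x := fun x =>
          congrArg Subtype.val ((equivMapToHull hΩ (I i)).apply_symm_apply
            (Submodule.inclusion hL x))
        let f : Omega R A'.Carrier W := Omega.toLin.symm
          ((Omega.evalOne ∘ₗ g.restrictScalars R) ∘ₗ
            LinearMap.applyₗ (⟨v, hv⟩ : L) ∘ₗ φ.toLinearMap)
        have hf : A'.res f = g ⟨v, hv⟩ := by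
          refine LinearMap.ext fun a => ?_
          change Omega.evalOne (g (φ (A'.incl a) ⟨v, hv⟩)) = Omega.toLin (g ⟨v, hv⟩) a
          have h1 : φ (A'.incl a) ⟨v, hv⟩ = a • (⟨v, hv⟩ : L) :=
            LinearMap.congr_fun (AlgHom.congr_fun hφ a) _
          rw [h1, map_smul, Omega.evalOne_smul]
        refine ⟨f, (hJ i f).mpr ?_, ?_⟩
        · rw [hf]
          exact Subtype.prop _
        · change toHull R A (Omega R A W) (A'.res f) = v
          rw [hf, hg]
      · have hle : A'.omegaToHull (J i) ≤ (I i).map (toHull R A (Omega R A W)) := by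
          rintro _ ⟨f, hf, rfl⟩
          exact ⟨_, (hJ i f).mp hf, rfl⟩
        refine hmax _ hle (hRej.hasNoSummand hA.1 (hsubl _ hle) fun x hx => ?_)
        obtain ⟨r, hr, a, ha⟩ := exists_smul_eq_toHull A x
        refine ⟨r, hr, a, ha, ?_⟩
        rintro ⟨_, f, hf, rfl⟩
        let y : A'.Carrier := ⟨x, hx⟩
        have hy : r • y = A'.incl a := A'.toKA_injective (by
          rw [map_smul, A'.toKA_incl, ← ha]
          rfl)
        refine ⟨⟨_, y • f, (J i).smul_mem y hf, rfl⟩, Subtype.ext ?_⟩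
        change a • toHull R A (Omega R A W) (A'.res f) =
          r • toHull R A (Omega R A W) (A'.res (y • f))
        rw [← map_smul, ← A'.res_incl_smul, ← hy, smul_assoc, ← LinearMap.map_smul_of_tower]
        rfl
    rw [hminus, hLJ]

end Coprincipal

end RejectionOrders

theorem theorem3p7 {R : Type u} [CommRing R] [IsLocalRing R] [IsNoetherianRing R] [IsReduced R]
    [IsAdicComplete (IsLocalRing.maximalIdeal R) R] (hdim : ringKrullDim R = 1)
    {A : Type u} [Ring A] [Algebra R A] (hA : RejectionOrders.IsOrder R A)
    (hconn : RejectionOrders.IsConnectedRing A) (hher : ¬ RejectionOrders.IsHereditary A)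
    {B : Type u} [AddCommGroup B] [Module R B] [Module A B] [IsScalarTower R A B]
    (hB : RejectionOrders.IsBijective R A B) :
    ∃ A' : RejectionOrders.Overring R A,
      -- `A' = A⁻(B)`: the one and only overring obtained by rejection of `B`
      (∀ A'' : RejectionOrders.Overring R A,
        RejectionOrders.IsRejection B A'' ↔ A'' = A') ∧
      -- `A = ⨁ P i` implies `A' = ⨁ (P i)^{+,B}`
      (∀ (n : ℕ) (P : Fin n → Submodule A A), DirectSum.IsInternal P →
        (∀ i, RejectionOrders.IsIndecomposable A (P i)) →
        ∃ Q : Fin n → Submodule A'.Carrier A'.Carrier,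
          DirectSum.IsInternal Q ∧
          (∀ i (N : Submodule A (RejectionOrders.Hull R A)),
            RejectionOrders.IsPlus R B ((P i).map (RejectionOrders.toHull R A A)) N ↔
              N = A'.idealToHull (Q i)) ∧
          (∀ i, Module.Projective A'.Carrier (Q i)) ∧
          (∀ (X : Type u) [AddCommGroup X] [Module A'.Carrier X],
            Module.Finite A'.Carrier X → Module.Projective A'.Carrier X →
            RejectionOrders.IsIndecomposable A'.Carrier X →
            ∃ i, RejectionOrders.IsSummand A'.Carrier X (Q i))) ∧
      -- `ω_A = ⨁ I i` implies `ω_{A'} = ⨁ (I i)^{-,B}`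
      (∀ (W : Type u) [AddCommGroup W] [Module R W], RejectionOrders.IsCanonicalModule R W →
        ∀ (n : ℕ) (I : Fin n → Submodule A (RejectionOrders.Omega R A W)),
        DirectSum.IsInternal I → (∀ i, RejectionOrders.IsIndecomposable A (I i)) →
        ∃ J : Fin n → Submodule A'.Carrier (RejectionOrders.Omega R A'.Carrier W),
          DirectSum.IsInternal J ∧
          (∀ i (N : Submodule A (RejectionOrders.Hull R (RejectionOrders.Omega R A W))),
            RejectionOrders.IsMinus R B
              ((I i).map (RejectionOrders.toHull R A (RejectionOrders.Omega R A W))) N ↔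
              N = A'.omegaToHull (J i)) ∧
          (∀ i, RejectionOrders.IsLInjective R A'.Carrier (J i)) ∧
          (∀ (X : Type u) [AddCommGroup X] [Module R X] [Module A'.Carrier X]
            [IsScalarTower R A'.Carrier X],
            RejectionOrders.IsLInjective R A'.Carrier X →
            RejectionOrders.IsIndecomposable A'.Carrier X →
            ∃ i, RejectionOrders.IsSummand A'.Carrier X (J i))) := by
  have hRej := RejectionOrders.isRejection_rejection hdim hA hconn hher hB
  refine ⟨RejectionOrders.rejection hdim hA hconn hher hB, fun A'' =>
    ⟨fun h => h.eq_rejection hdim hA hconn hher hB, fun h => h ▸ hRej⟩, fun n P hP hPi => ?_,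
    fun W _ _ hW n I hI hIi => ?_⟩
  · obtain ⟨Q, hQ, hplus, hproj⟩ :=
      RejectionOrders.exists_isInternal_isPlus hdim hA hconn hher hB
        (A' := RejectionOrders.rejection hdim hA hconn hher hB) rfl hP hPi
    refine ⟨Q, hQ, hplus, hproj, fun X _ _ _ _ hX => ?_⟩
    have := (RejectionOrders.rejection hdim hA hconn hher hB).isLattice.1
    exact hX.exists_isSummand_of_projective (R := R) hQ
  · obtain ⟨J, hJ, hminus, hsum⟩ :=
      RejectionOrders.exists_isInternal_isMinus hdim hA hconn hher hB
        (A' := RejectionOrders.rejection hdim hA hconn hher hB) rfl hRej hW.1 hI hIi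
    have hfin := (RejectionOrders.rejection hdim hA hconn hher hB).isLattice.1
    refine ⟨J, hJ, hminus, fun i => ?_, fun X _ _ _ _ hX hXi => ?_⟩
    · exact ((RejectionOrders.hasExtension_omega hdim hW).of_isSummand (hsum i)).isLInjective
        ((RejectionOrders.isLattice_omega hfin hW.1).submodule (J i))
    · obtain ⟨r, hr⟩ := hX.exists_isSummand_omega hdim hfin hW
      have := hX.1.1
      exact hXi.exists_isSummand R hJ hr
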